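/- **Definitions.** A *rational-valued 2ADfA verifier* over a finite input alphabet $\Sigma$ is a two-way finite automaton on the read-only tape $¢w\$$ with a finite number $k>0$ of affine registers. The $i$-th register holds a vector $v\in\mathbb{Q}^{m_i}$ with entries summing to $1$ and starts in the first basis vector. In one step, depending on the deterministic state and the scanned symbol, each register is either multiplied by a rational matrix whose columns sum to $1$, or *weighted*: basis index $j$ is observed with probability $|v_j|/\|v\|_1$ and the register collapses to $e_j$; then a new state and a head move in $\{-1,0,+1\}$ are determined by the state, the scanned symbol and the observed outcomes. On entering a communication state, the verifier writes a symbol of a fixed finite communication alphabet to a cell, the prover replaces it by a reply symbol, and the verifier changes its state according to its current state and the reply; this counts as one step. The computation halts as soon as an accepting or a rejecting state is entered. The system is Arthur–Merlin: a prover is an arbitrary function that computes its reply from the input, the content of the cell and the whole history of revealed states, head moves, weighting outcomes and messages. The verifier *strongly verifies* $L\subseteq\Sigma^*$ with error $\epsilon$ if (completeness) there is a prover $P$ with which every $w\in L$ is accepted with probability at least $1-\epsilon$, and (soundness) for every $w\notin L$ and every prover $P^*$, $w$ is rejected with probability at least $1-\epsilon$. Its running time is the number of steps until it halts. **Theorem.**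 Let $s,t:\mathbb{N}\to\mathbb{N}$, and let $L\subseteq\Sigma^*$ be decided by a single-tape deterministic Turing machine (with a semi-infinite tape) that scans $O(s(|w|))$ tape cells and halts after at most $t(|w|)$ steps on input $w$. Assume that, for some constant $k\in\mathbb{N}$, either $s(n)\,t(n)=O(n^k)$ or $s(n)\,t(n)=O(2^{kn})$. Then there are constants $K$ and $n_1$ such that for every $\epsilon\in(0,1/2)$ there is a rational-valued 2ADfA verifier that strongly verifies $L$ with error $\epsilon$ and whose expected running time on every input $w$ with $|w|\ge n_1$ and with every prover is at most $$K\cdot\frac{|w|\,s(|w|)\,t(|w|)}{\epsilon}.$$ -/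

import Mathlib

open Filter Asymptotics
open scoped ENNReal

/-- A head movement: one cell to the left, none, one cell to the right. -/
inductive HeadMove where
  | left
  | stay
  | right

/-- The new head position on a tape whose cells are numbered `0, 1, 2, …`. A left move in
cell `0` leaves the head there. -/
def HeadMove.apply : HeadMove → ℕ → ℕ
  | .left, p => p - 1
  | .stay, p => p
  | .right, p => p + 1

/-! ### Single-tape deterministic Turing machines -/

/-- A single-tape deterministic Turing machine with input alphabet `α`. -/
structure SingleTapeDTM (α : Type) where
  /-- control states -/
  State : Type
  [finState : Fintype State]
  /-- tape alphabet -/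
  Symbol : Type
  [finSymbol : Fintype Symbol]
  blank : Symbol
  /-- the input alphabet as a part of the tape alphabet -/
  letter : α → Symbol
  letter_injective : Function.Injective letter
  letter_ne_blank : ∀ a, letter a ≠ blank
  start : State
  accept : State
  reject : State
  accept_ne_reject : accept ≠ reject
  /-- new state, written symbol, head movement -/
  trans : State → Symbol → State × Symbol × HeadMove

namespace SingleTapeDTM

variable {α : Type} (M : SingleTapeDTM α)

/-- A configuration: control state, head position, contents of the semi-infinite tape. -/
structure Conf where
  state : M.State
  pos : ℕ
  tape : ℕ → M.Symbol

/-- The input stands in the cells `0, …, |w| - 1`, all other cells are blank, and the head scans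
cell `0`. -/
def initConf (w : List α) : M.Conf where
  state := M.start
  pos := 0
  tape := fun j => (w[j]?).elim M.blank M.letter

open Classical in
/-- One step; a configuration in the accepting or the rejecting state is left unchanged. -/
noncomputable def step (c : M.Conf) : M.Conf :=
  if c.state = M.accept ∨ c.state = M.reject then c
  else
    { state := (M.trans c.state (c.tape c.pos)).1
      pos := (M.trans c.state (c.tape c.pos)).2.2.apply c.pos
      tape := Function.update c.tape c.pos (M.trans c.state (c.tape c.pos)).2.1 }

/-- The configuration after `n` steps on input `w`. -/
noncomputable def run (w : List α) (n : ℕ) : M.Conf :=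
  M.step^[n] (M.initConf w)

/-- The number of tape cells that the head scans in the computation on `w`. -/
noncomputable def cellsScanned (w : List α) : ℕ∞ :=
  (Set.range fun n => (M.run w n).pos).encard

/-- `M` decides `L`, halting on every input `w` after at most `t |w|` steps. -/
def DecidesInTime (L : Language α) (t : ℕ → ℕ) : Prop :=
  ∀ w : List α,
    (w ∈ L → (M.run w (t w.length)).state = M.accept) ∧
    (w ∉ L → (M.run w (t w.length)).state = M.reject)

/-- `M` scans `O(s(|w|))` tape cells on input `w`. -/
def UsesSpaceBigO (s : ℕ → ℕ) : Prop :=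
  ∃ c n₀ : ℕ, ∀ w : List α, n₀ ≤ w.length → M.cellsScanned w ≤ ((c * s w.length : ℕ) : ℕ∞)

end SingleTapeDTM

/-! ### Two-way automata with deterministic and affine states, as Arthur-Merlin verifiers -/

/-- The symbols of the read-only tape: the two end-markers and the input letters. -/
inductive MarkedSymbol (α : Type) where
  | leftEnd
  | letter (a : α)
  | rightEnd

/-- The symbol in cell `j` of the input tape, which holds `w` between the two end-markers, the left
one in cell `0` and the right one in cell `|w| + 1`. -/
def markedTape {α : Type} (w : List α) : ℕ → MarkedSymbol α
  | 0 => .leftEnd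
  | j + 1 => (w[j]?).elim .rightEnd .letter

/-- A rational affine operator on an `m`-state register: every column sums to `1`. -/
def RatAffineOp (m : ℕ) : Type :=
  {A : Matrix (Fin m) (Fin m) ℚ // ∀ j, ∑ i, A i j = 1}

/-- A rational-valued 2ADfA over the input alphabet `α`, equipped as a verifier with communication
states and a communication alphabet. -/
structure Rat2ADfAVerifier (α : Type) where
  /-- deterministic states -/
  State : Type
  [finState : Fintype State]
  start : State
  accepting : Set State
  rejecting : Set State
  accepting_disjoint_rejecting : Disjoint accepting rejecting
  /-- number of affine registers -/
  numReg : ℕ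
  numReg_pos : 0 < numReg
  /-- number of basis states of each register -/
  dim : Fin numReg → ℕ
  dim_pos : ∀ i, 0 < dim i
  /-- The affine part of the transition function: for every register either an affine operator
  (`some A`) or the weighting operator (`none`). -/
  affinePart : State → MarkedSymbol α → (i : Fin numReg) → Option (RatAffineOp (dim i))
  /-- The deterministic part of the transition function: it depends on the weighting outcomes
  (`some j` for a register found in its `j`-th basis state, `none` for one not weighted). -/
  classicalPart : State → MarkedSymbol α → ((i : Fin numReg) → Option (Fin (dim i))) →
    State × HeadMove
  /-- the head does not leave the tape -/
  not_left_of_leftEnd : ∀ q τ, (classicalPart q .leftEnd τ).2 ≠ .left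
  not_right_of_rightEnd : ∀ q τ, (classicalPart q .rightEnd τ).2 ≠ .right
  /-- communication alphabet -/
  Comm : Type
  [finComm : Fintype Comm]
  [nonemptyComm : Nonempty Comm]
  /-- communication states -/
  communicating : Set State
  /-- the symbol that is written to the communication cell in a communication state -/
  message : communicating → Comm
  /-- the new state, given the communication state and the reply of the prover -/
  onReply : communicating → Comm → State

namespace Rat2ADfAVerifier

variable {α : Type} (V : Rat2ADfAVerifier α)

/-- A tuple of outcomes, one for each register. -/
abbrev Outcomes : Type := (i : Fin V.numReg) → Option (Fin (V.dim i))

/-- What one step reveals to the prover. -/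
inductive Event where
  /-- an ordinary step: new state, head move, weighting outcomes -/
  | move (q : V.State) (d : HeadMove) (τ : V.Outcomes)
  /-- a communication: message, reply, new state -/
  | comm (message reply : V.Comm) (q : V.State)

/-- A prover (with public coins): it is given the input, everything revealed so far and the
content of the communication cell, and it answers with a symbol. It is otherwise arbitrary. -/
abbrev Prover : Type := List α → List V.Event → V.Comm → V.Comm

/-- A node of the computation tree: deterministic state, head position, affine states of the
registers, and the list of the events on the path to it, the latest first. -/
structure Conf where
  state : V.State
  pos : ℕ
  reg : (i : Fin V.numReg) → Fin (V.dim i) → ℚ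
  history : List V.Event

/-- The root: every register is in its first basis state, the head scans the left end-marker. -/
def initConf : V.Conf where
  state := V.start
  pos := 0
  reg := fun i => Pi.single ⟨0, V.dim_pos i⟩ 1
  history := []

variable {V}

/-- The computation halts as soon as an accepting or a rejecting state is entered. -/
def Conf.Halted (c : V.Conf) : Prop :=
  c.state ∈ V.accepting ∨ c.state ∈ V.rejecting

/-- The probability of an outcome at one register in affine state `v`. If an affine operator is
applied then the outcome is `none`; weighting has the outcome `j` with probability
`|v j| / ‖v‖₁`. -/
def outcomeProb {m : ℕ} (v : Fin m → ℚ) : Option (RatAffineOp m) → Option (Fin m) → ℚ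
  | some _, none => 1
  | some _, some _ => 0
  | none, some j => |v j| / ∑ i, |v i|
  | none, none => 0

/-- The affine state of a register after an operation with the given outcome. Weighting with
outcome `j` collapses the register to its `j`-th basis state. -/
def updateReg {m : ℕ} (v : Fin m → ℚ) : Option (RatAffineOp m) → Option (Fin m) → (Fin m → ℚ)
  | some A, _ => A.1.mulVec v
  | none, some j => Pi.single j 1
  | none, none => v

/-- The probability of a tuple of outcomes in an ordinary step from `c`. -/
def Conf.prob (w : List α) (c : V.Conf) (τ : V.Outcomes) : ℚ :=
  ∏ i, outcomeProb (c.reg i) (V.affinePart c.state (markedTape w c.pos) i) (τ i)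

/-- The configuration after an ordinary step from `c` with outcomes `τ`. -/
def Conf.moveStep (w : List α) (c : V.Conf) (τ : V.Outcomes) : V.Conf :=
  let r := V.classicalPart c.state (markedTape w c.pos) τ
  { state := r.1
    pos := r.2.apply c.pos
    reg := fun i => updateReg (c.reg i) (V.affinePart c.state (markedTape w c.pos) i) (τ i)
    history := .move r.1 r.2 τ :: c.history }

/-- The configuration after the communication in the communication state of `c`. -/
def Conf.commStep (P : V.Prover) (w : List α) (c : V.Conf) (h : c.state ∈ V.communicating) :
    V.Conf :=
  let a := V.message ⟨c.state, h⟩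
  let b := P w c.history a
  let q := V.onReply ⟨c.state, h⟩ b
  { c with state := q, history := .comm a b q :: c.history }

open Classical in
/-- The expected value of `f` at the configuration that is reached from `c` after `n` steps of the
computation with prover `P` on input `w`, where halted configurations do not change any more. -/
noncomputable def expectAfter (P : V.Prover) (w : List α) (f : V.Conf → ℝ≥0∞) :
    ℕ → V.Conf → ℝ≥0∞
  | 0, c => f c
  | n + 1, c =>
    if c.Halted then f c
    else if h : c.state ∈ V.communicating then expectAfter P w f n (c.commStep P w h)
    else ∑ τ : V.Outcomes,
      ENNReal.ofReal (c.prob w τ : ℝ) * expectAfter P w f n (c.moveStep w τ)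

variable (V)

open Classical in
/-- The total acceptance probability on `w` in interaction with `P`. -/
noncomputable def acceptProb (P : V.Prover) (w : List α) : ℝ≥0∞ :=
  ⨆ n, expectAfter P w (fun c => if c.state ∈ V.accepting then 1 else 0) n V.initConf

open Classical in
/-- The total rejection probability on `w` in interaction with `P`. -/
noncomputable def rejectProb (P : V.Prover) (w : List α) : ℝ≥0∞ :=
  ⨆ n, expectAfter P w (fun c => if c.state ∈ V.rejecting then 1 else 0) n V.initConf

open Classical in
/-- The expected number of steps on `w` in interaction with `P`: the sum over all `n` of the
probability that the computation has not halted after `n` steps. -/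
noncomputable def expectedTime (P : V.Prover) (w : List α) : ℝ≥0∞ :=
  ∑' n, expectAfter P w (fun c => if c.Halted then 0 else 1) n V.initConf

/-- `V` strongly verifies `L` with error `ε`. -/
def StronglyVerifies (L : Language α) (ε : ℝ) : Prop :=
  (∃ P : V.Prover, ∀ w ∈ L, ENNReal.ofReal (1 - ε) ≤ V.acceptProb P w) ∧
  (∀ w ∉ L, ∀ P : V.Prover, ENNReal.ofReal (1 - ε) ≤ V.rejectProb P w)

end Rat2ADfAVerifier

/-! ### Programs with five test registers -/

/-! The prover spells out the computation of `M` cell by cell, and the verifier checks with affine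
registers that consecutive configurations fit together. A configuration is a string of cell
contents, stored as an integer in base `cellBase`. In a sweep every announced cell is subtracted
from the code of the present configuration (register 0), while the code of the successor is built up
(register 1). The successor is computed locally, so one cell of lookahead is enough. At the end
register 0 must hold zero, and register 1 takes over its role.

A register stores a pair `(v, η)` as the affine vector `(1 - η, v, η - v)`. Weighting it, and
rejecting unless the first basis state is observed, tests whether `v = 0`. The value `v = 0` is
rejected with probability only `η` (`passProb_zero`), every `v` with probability at least `η`
(`passProb_le_sub`), and if `|v| ≥ 1/η` then `v` passes with probability at most `η`
(`passProb_le_of_large`). A wrong integer has absolute value at least `1`, so multiplication by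
`1/η` makes it large enough. With `n` the input length and `1/η = N β^(n+1)`, this factor is
produced by one walk across the input, at a factor `β` per move.

Beyond the input no head position limits the number of cells, so register 2 counts those still to
come. Before each of them the prover sends the decremented count in base `β`, one digit per
input-tape cell, and the difference is tested. The test destroys the old count and registers do not
interact, so the digits are fed into two registers: one for the comparison, one to keep.

With `e` cells beyond the input, honest play meets at most `(t+1)(e+4)` tests. Since `s t` is at
most exponential, `β` can be chosen so that their false alarms sum to at most `1/N ≤ ε`. A lie
leaves an integer that no later message can bring to zero (`unreachable_of_ne`) and escapes its test
with probability at most `η`; without lies an input outside `L` is rejected. For the time, a test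
comes within `O(n)` steps against any prover and rejects with probability at least `η`, so `O(n/η)`
more steps are expected from anywhere (`boundedFor_of_sound`). An escaped lie, of probability at
most `η`, therefore costs `O(n)` on average. Truthful play consists of at most `t+1` sweeps of
`O(n(e+1))` steps.

`Controlled` bundles the time bound, the bound on acceptance and the success of honest replies, and
it is proved backwards along the computation: `controlled_consume_false` for sweeps with a lie,
`controlled_askNext` for honest ones, `controlled_run` over the steps of `M`. -/

/-- The coefficients of the operation `v ↦ a v + g η + c`, `η ↦ d η + e` on a pair `(v, η)`. -/
structure RegCoeff where
  a : ℚ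
  g : ℚ
  c : ℚ
  d : ℚ
  e : ℚ

namespace RegCoeff

/-- The action of the coefficients on a pair. -/
def apply (k : RegCoeff) (x : ℚ × ℚ) : ℚ × ℚ :=
  (k.a * x.1 + k.g * x.2 + k.c, k.d * x.2 + k.e)

/-- The coefficients of the identity. -/
def id : RegCoeff := ⟨1, 0, 0, 1, 0⟩

@[simp] lemma id_apply (x : ℚ × ℚ) : id.apply x = x := by
  simp [id, apply]

/-- The affine operator that realizes the coefficients on the vectors `regVec`. -/
def toOp (k : RegCoeff) : RatAffineOp 3 :=
  ⟨!![1 - k.e, 1 - (k.d + k.e), 1 - (k.d + k.e);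
      k.c, k.a + k.g + k.c, k.g + k.c;
      k.e - k.c, k.d + k.e - (k.a + k.g + k.c), k.d + k.e - (k.g + k.c)], by
    intro j
    fin_cases j <;> simp [Fin.sum_univ_three]⟩

end RegCoeff

/-- The affine state of a register that holds the pair `(v, η)`. -/
def regVec (x : ℚ × ℚ) : Fin 3 → ℚ := ![1 - x.2, x.1, x.2 - x.1]

/-- The basis vectors are `regVec` of `(0, 0)`, `(1, 1)` and `(0, 1)`. The columns of `toOp` are
`regVec` of their images, and affinity does the rest. -/
lemma RegCoeff.toOp_mulVec (k : RegCoeff) (x : ℚ × ℚ) :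
    k.toOp.1.mulVec (regVec x) = regVec (k.apply x) := by
  funext i
  fin_cases i <;>
    simp [RegCoeff.toOp, regVec, RegCoeff.apply, Matrix.mulVec, dotProduct, Fin.sum_univ_three] <;>
    ring

/-- A register that passes a weighting collapses to this vector, so a passed test also resets the
register. -/
lemma regVec_zero : regVec (0, 0) = Pi.single 0 1 := by
  funext i
  fin_cases i <;> simp [regVec]

/-! ### The odds of the zero test -/

/-- The probability that a register with the pair `(v, η)` is found in its first basis state. -/
def passProb (x : ℚ × ℚ) : ℚ := |1 - x.2| / (|1 - x.2| + |x.1| + |x.2 - x.1|)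

lemma passProb_eq (x : ℚ × ℚ) : passProb x = |regVec x 0| / ∑ i, |regVec x i| := by
  simp [passProb, regVec, Fin.sum_univ_three]

lemma regVec_norm_pos (x : ℚ × ℚ) : 0 < ∑ i, |regVec x i| := by
  have h : |∑ i, regVec x i| ≤ ∑ i, |regVec x i| := Finset.abs_sum_le_sum_abs _ _
  have h1 : ∑ i, regVec x i = 1 := by simp [regVec, Fin.sum_univ_three]
  rw [h1, abs_one] at h
  linarith

lemma passProb_nonneg (x : ℚ × ℚ) : 0 ≤ passProb x := by
  unfold passProb; positivity

lemma passProb_le_one (x : ℚ × ℚ) : passProb x ≤ 1 := by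
  rw [passProb_eq]
  refine div_le_one_of_le₀ ?_ (regVec_norm_pos x).le
  exact Finset.single_le_sum (f := fun i => |regVec x i|) (fun _ _ => abs_nonneg _)
    (Finset.mem_univ 0)

/-- The false-alarm probability of a test on a correct value is exactly `η`. -/
lemma passProb_zero {η : ℚ} (h0 : 0 ≤ η) (h1 : η ≤ 1) : passProb (0, η) = 1 - η := by
  simp only [passProb, sub_zero, abs_zero, add_zero, abs_of_nonneg h0]
  rw [abs_of_nonneg (by linarith : (0 : ℚ) ≤ 1 - η)]
  simp

/-- By the triangle inequality the denominator is at least `(1 - η) + η = 1`. This bound, uniform in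
`v`, forces termination against every prover. -/
lemma passProb_le_sub {v η : ℚ} (h0 : 0 ≤ η) (h1 : η ≤ 1) : passProb (v, η) ≤ 1 - η := by
  unfold passProb
  have ha : |1 - η| = 1 - η := abs_of_nonneg (by linarith)
  have hb : η ≤ |v| + |η - v| := by
    calc η = |v + (η - v)| := by rw [add_sub_cancel, abs_of_nonneg h0]
      _ ≤ _ := abs_add_le _ _
  simp only [ha]
  refine div_le_of_le_mul₀ (by linarith) (by linarith) ?_
  nlinarith

/-- Already `η * |v| ≥ 1` dominates the numerator `1 - η`. A revealed lie survives with probability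
at most `η`. -/
lemma passProb_le_of_large {v η : ℚ} (h0 : 0 < η) (h1 : η ≤ 1) (hv : 1 ≤ |v| * η) :
    passProb (v, η) ≤ η := by
  unfold passProb
  have ha : |1 - η| = 1 - η := abs_of_nonneg (by linarith)
  have hb : 0 ≤ |η - v| := abs_nonneg _
  have hc : 0 ≤ |v| := abs_nonneg _
  simp only [ha]
  refine div_le_of_le_mul₀ (by linarith) h0.le ?_
  nlinarith [mul_nonneg h0.le hb, mul_nonneg h0.le (sub_nonneg.2 h1)]

/-! ### Register programs and the verifiers that execute them -/

/-- A finite-state program with five test registers, which may be permuted by the finite control. A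
step with a weighting goes to the rejecting state unless the first basis state is found. -/
structure RegProgram (α : Type) where
  State : Type
  [finState : Fintype State]
  start : State
  acc : State
  rej : State
  acc_ne_rej : acc ≠ rej
  Comm : Type
  [finComm : Fintype Comm]
  [nonemptyComm : Nonempty Comm]
  ask : State → Option (Comm → State)
  weighted : State → MarkedSymbol α → Option (Fin 5)
  coeff : State → MarkedSymbol α → Fin 5 → RegCoeff
  perm : State → MarkedSymbol α → Equiv.Perm (Fin 5)
  next : State → MarkedSymbol α → State × HeadMove

/-- Head moves that would leave the tape are suppressed. -/
def clampMove {α : Type} : MarkedSymbol α → HeadMove → HeadMove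
  | .leftEnd, .left => .stay
  | .rightEnd, .right => .stay
  | _, d => d

/-- No register is found in a basis state other than the first one. -/
def OutcomesPass (τ : Fin 5 → Option (Fin 3)) : Prop := ∀ i, τ i = none ∨ τ i = some 0

namespace RegProgram

variable {α : Type} (p : RegProgram α)

open Classical in
/-- The verifier that executes a program. -/
noncomputable def toVerifier : Rat2ADfAVerifier α :=
  letI := p.finState
  letI := p.finComm
  letI := p.nonemptyComm
  { State := p.State × Equiv.Perm (Fin 5)
    start := (p.start, 1)
    accepting := {s | s.1 = p.acc}
    rejecting := {s | s.1 = p.rej}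
    accepting_disjoint_rejecting := by
      rw [Set.disjoint_left]
      intro s h h'
      exact p.acc_ne_rej (h.symm.trans h')
    numReg := 5
    numReg_pos := by norm_num
    dim := fun _ => 3
    dim_pos := fun _ => by norm_num
    affinePart := fun s σ i =>
      if p.weighted s.1 σ = some (s.2.symm i) then none
      else some (p.coeff s.1 σ (s.2.symm i)).toOp
    classicalPart := fun s σ τ =>
      if OutcomesPass τ then
        (((p.next s.1 σ).1, s.2 * p.perm s.1 σ), clampMove σ (p.next s.1 σ).2)
      else ((p.rej, s.2), .stay)
    not_left_of_leftEnd := by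
      intro q τ
      split_ifs
      · cases (p.next q.1 .leftEnd).2 <;> simp [clampMove]
      · simp
    not_right_of_rightEnd := by
      intro q τ
      split_ifs
      · cases (p.next q.1 .rightEnd).2 <;> simp [clampMove]
      · simp
    Comm := p.Comm
    communicating := {s | (p.ask s.1).isSome}
    message := fun _ => Classical.arbitrary _
    onReply := fun s b => ((p.ask s.1.1).get s.2 b, s.1.2) }

/-- A configuration of a program: state, head position, pairs in the registers. -/
@[ext] structure Conf where
  state : p.State
  pos : ℕ
  val : Fin 5 → ℚ × ℚ

variable {p}

/-- The next configuration after an ordinary step that does not reject. -/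
def Conf.next (w : List α) (c : p.Conf) : p.Conf where
  state := (p.next c.state (markedTape w c.pos)).1
  pos := (clampMove (markedTape w c.pos) (p.next c.state (markedTape w c.pos)).2).apply c.pos
  val := fun r =>
    let r' := p.perm c.state (markedTape w c.pos) r
    if p.weighted c.state (markedTape w c.pos) = some r' then (0, 0)
    else (p.coeff c.state (markedTape w c.pos) r').apply (c.val r')

/-- The probability that an ordinary step does not reject. -/
def Conf.pass (w : List α) (c : p.Conf) : ℚ :=
  (p.weighted c.state (markedTape w c.pos)).elim 1 fun r => passProb (c.val r)

lemma Conf.pass_nonneg (w : List α) (c : p.Conf) : 0 ≤ c.pass w := by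
  unfold Conf.pass
  cases p.weighted c.state (markedTape w c.pos)
  · simp
  · exact passProb_nonneg _

lemma Conf.pass_le_one (w : List α) (c : p.Conf) : c.pass w ≤ 1 := by
  unfold Conf.pass
  cases p.weighted c.state (markedTape w c.pos)
  · simp
  · exact passProb_le_one _

/-- A configuration of the verifier that represents a configuration of the program. -/
structure Represents (c : p.toVerifier.Conf) (b : p.Conf) : Prop where
  state : (c.state : p.State × Equiv.Perm (Fin 5)).1 = b.state
  pos : c.pos = b.pos
  reg : ∀ r : Fin 5, c.reg ((c.state : p.State × Equiv.Perm (Fin 5)).2 r) = regVec (b.val r)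

end RegProgram

/-! ### One step of the verifier: a single outcome does not reject -/

namespace RegProgram

open Rat2ADfAVerifier

variable {α : Type} {p : RegProgram α}

lemma sum_outcomeProb_some {m : ℕ} (v : Fin m → ℚ) (A : RatAffineOp m) :
    ∑ o, outcomeProb v (some A) o = 1 := by
  simp [Fintype.sum_option, outcomeProb]

lemma sum_outcomeProb_none {m : ℕ} (v : Fin m → ℚ) (h : 0 < ∑ i, |v i|) :
    ∑ o, outcomeProb v none o = 1 := by
  simp only [Fintype.sum_option, outcomeProb, zero_add]
  rw [← Finset.sum_div, div_self h.ne']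

lemma outcomeProb_nonneg {m : ℕ} (v : Fin m → ℚ) (A : Option (RatAffineOp m)) (o : Option (Fin m)) :
    0 ≤ outcomeProb v A o := by
  cases A <;> cases o <;> simp only [outcomeProb] <;> positivity

/-- The only outcomes of an ordinary step that do not reject. -/
def passOutcomes (p : RegProgram α) (w : List α) (b : p.Conf) (σ : Equiv.Perm (Fin 5)) :
    Fin 5 → Option (Fin 3) :=
  fun i => if p.weighted b.state (markedTape w b.pos) = some (σ.symm i) then some 0 else none

lemma passOutcomes_pass (w : List α) (b : p.Conf) (σ : Equiv.Perm (Fin 5)) :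
    OutcomesPass (passOutcomes p w b σ) := by
  intro i
  unfold passOutcomes
  split_ifs <;> simp

open Classical in
lemma affinePart_eq {c : p.toVerifier.Conf} {b : p.Conf} (h : Represents c b) (w : List α)
    (i : Fin 5) :
    p.toVerifier.affinePart c.state (markedTape w c.pos) i =
      if p.weighted b.state (markedTape w b.pos) =
          some ((c.state : p.State × Equiv.Perm (Fin 5)).2.symm i) then none
      else some (p.coeff b.state (markedTape w b.pos)
        ((c.state : p.State × Equiv.Perm (Fin 5)).2.symm i)).toOp := by
  rw [← h.pos, ← h.state]
  rfl

lemma reg_eq {c : p.toVerifier.Conf} {b : p.Conf} (h : Represents c b) (i : Fin 5) :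
    c.reg i = regVec (b.val ((c.state : p.State × Equiv.Perm (Fin 5)).2.symm i)) := by
  have := h.reg ((c.state : p.State × Equiv.Perm (Fin 5)).2.symm i)
  rwa [Equiv.apply_symm_apply] at this

lemma sum_prob {c : p.toVerifier.Conf} {b : p.Conf} (h : Represents c b) (w : List α) :
    ∑ τ : p.toVerifier.Outcomes, c.prob w τ = 1 := by
  have key : ∀ i : Fin 5, ∑ o : Option (Fin 3), outcomeProb (m := 3) (c.reg i)
      (p.toVerifier.affinePart c.state (markedTape w c.pos) i) o = 1 := by
    intro i
    rw [affinePart_eq h]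
    split_ifs
    · rw [reg_eq h]
      exact sum_outcomeProb_none _ (regVec_norm_pos _)
    · exact sum_outcomeProb_some _ _
  have := Finset.prod_univ_sum (fun _ : Fin 5 => (Finset.univ : Finset (Option (Fin 3))))
    (fun i o => outcomeProb (m := 3) (c.reg i)
      (p.toVerifier.affinePart c.state (markedTape w c.pos) i) o)
  rw [Finset.prod_congr rfl (fun i _ => key i), Finset.prod_const_one,
    Fintype.piFinset_univ] at this
  exact this.symm

lemma prob_passOutcomes {c : p.toVerifier.Conf} {b : p.Conf} (h : Represents c b) (w : List α) :
    c.prob w (passOutcomes p w b (c.state : p.State × Equiv.Perm (Fin 5)).2) = b.pass w := by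
  set σ := (c.state : p.State × Equiv.Perm (Fin 5)).2 with hσ
  have key : ∀ i : Fin 5, outcomeProb (m := 3) (c.reg i)
      (p.toVerifier.affinePart c.state (markedTape w c.pos) i) (passOutcomes p w b σ i) =
      if p.weighted b.state (markedTape w b.pos) = some (σ.symm i) then
        passProb (b.val (σ.symm i)) else 1 := by
    intro i
    rw [affinePart_eq h, reg_eq h, passOutcomes]
    by_cases hw : p.weighted b.state (markedTape w b.pos) = some (σ.symm i)
    · rw [if_pos hw, if_pos hw, if_pos hw, passProb_eq]
      rfl
    · rw [if_neg hw, if_neg hw, if_neg hw]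
      rfl
  have : c.prob w (passOutcomes p w b σ) = ∏ i : Fin 5, outcomeProb (m := 3) (c.reg i)
      (p.toVerifier.affinePart c.state (markedTape w c.pos) i) (passOutcomes p w b σ i) := rfl
  rw [this, Finset.prod_congr rfl (fun i _ => key i)]
  unfold Conf.pass
  cases hw : p.weighted b.state (markedTape w b.pos) with
  | none => simp
  | some r =>
    rw [Finset.prod_eq_single (σ r)]
    · simp
    · intro i _ hi
      rw [if_neg]
      intro h'
      apply hi
      rw [Option.some.inj h', Equiv.apply_symm_apply]
    · simp

/-- Which registers are weighted is fixed by state and symbol. Among outcomes of positive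
probability, passing leaves `some 0` for those and `none` for the others. -/
lemma eq_passOutcomes {c : p.toVerifier.Conf} {b : p.Conf} (h : Represents c b) (w : List α)
    (τ : Fin 5 → Option (Fin 3)) (hp : c.prob w τ ≠ 0) (hτ : OutcomesPass τ) :
    τ = passOutcomes p w b (c.state : p.State × Equiv.Perm (Fin 5)).2 := by
  have hp' : (∏ i : Fin 5, outcomeProb (m := 3) (c.reg i)
      (p.toVerifier.affinePart c.state (markedTape w c.pos) i) (τ i)) ≠ 0 := hp
  rw [Finset.prod_ne_zero_iff] at hp'
  funext i
  have h1 := hp' i (Finset.mem_univ i)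
  rw [affinePart_eq h] at h1
  unfold passOutcomes
  rcases hτ i with h2 | h2 <;> rw [h2] at h1 ⊢ <;> split_ifs at h1 ⊢ <;>
    first | rfl | exact absurd rfl h1

lemma prob_nonneg (c : p.toVerifier.Conf) (w : List α) (τ : p.toVerifier.Outcomes) :
    0 ≤ c.prob w τ :=
  Finset.prod_nonneg fun _ _ => outcomeProb_nonneg _ _ _

/-- Contents stay in their physical registers; only the permutation in the control state, which
assigns roles to registers, is composed with `p.perm`. -/
lemma represents_moveStep {c : p.toVerifier.Conf} {b : p.Conf} (h : Represents c b) (w : List α) :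
    Represents (c.moveStep w (passOutcomes p w b (c.state : p.State × Equiv.Perm (Fin 5)).2))
      (b.next w) := by
  set σ := (c.state : p.State × Equiv.Perm (Fin 5)).2 with hσ
  have hpass := passOutcomes_pass w b σ
  have hcl : p.toVerifier.classicalPart c.state (markedTape w c.pos) (passOutcomes p w b σ) =
      (((p.next b.state (markedTape w b.pos)).1, σ * p.perm b.state (markedTape w b.pos)),
        clampMove (markedTape w b.pos) (p.next b.state (markedTape w b.pos)).2) := by
    rw [← h.state, ← h.pos]
    exact if_pos hpass
  have hst : (c.moveStep w (passOutcomes p w b σ)).state =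
      ((p.next b.state (markedTape w b.pos)).1, σ * p.perm b.state (markedTape w b.pos)) :=
    congrArg Prod.fst hcl
  refine ⟨?_, ?_, ?_⟩
  · exact congrArg Prod.fst hst
  · show (p.toVerifier.classicalPart c.state (markedTape w c.pos)
      (passOutcomes p w b σ)).2.apply c.pos = _
    rw [hcl, h.pos]
    rfl
  · intro r
    rw [hst]
    show updateReg (m := 3) (c.reg (σ (p.perm b.state (markedTape w b.pos) r)))
      (p.toVerifier.affinePart c.state (markedTape w c.pos)
        (σ (p.perm b.state (markedTape w b.pos) r)))
      (passOutcomes p w b σ (σ (p.perm b.state (markedTape w b.pos) r))) = _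
    rw [affinePart_eq h, reg_eq h, passOutcomes, ← hσ, Equiv.symm_apply_apply]
    simp only [Conf.next]
    split_ifs
    · exact regVec_zero.symm
    · exact RegCoeff.toOp_mulVec _ _

lemma moveStep_rejects {c : p.toVerifier.Conf} (w : List α)
    (τ : Fin 5 → Option (Fin 3)) (hτ : ¬ OutcomesPass τ) :
    ((c.moveStep w τ).state : p.State × Equiv.Perm (Fin 5)).1 = p.rej := by
  have hcl : p.toVerifier.classicalPart c.state (markedTape w c.pos) τ =
      ((p.rej, (c.state : p.State × Equiv.Perm (Fin 5)).2), .stay) := if_neg hτ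
  have hst : (c.moveStep w τ).state = (p.rej, (c.state : p.State × Equiv.Perm (Fin 5)).2) :=
    congrArg Prod.fst hcl
  exact congrArg Prod.fst hst

lemma halted_iff (c : p.toVerifier.Conf) : c.Halted ↔
    (c.state : p.State × Equiv.Perm (Fin 5)).1 = p.acc ∨
    (c.state : p.State × Equiv.Perm (Fin 5)).1 = p.rej := Iff.rfl

lemma expectAfter_halted (P : p.toVerifier.Prover) (w : List α) (f : p.toVerifier.Conf → ℝ≥0∞)
    (n : ℕ) {c : p.toVerifier.Conf} (h : c.Halted) : expectAfter P w f n c = f c := by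
  cases n with
  | zero => rfl
  | succ n => rw [expectAfter, if_pos h]

/-- All outcomes but one either have no weight or give the same value `κ`, so their total weight is
`1 - q i₀`. Applied with `κ` the value in the rejecting state. -/
lemma sum_ofReal_mul_eq {ι : Type*} [Fintype ι] (i₀ : ι) (q : ι → ℚ) (hq : ∀ i, 0 ≤ q i)
    (hsum : ∑ i, q i = 1) (X : ι → ℝ≥0∞) (κ : ℝ≥0∞) (h : ∀ i, i ≠ i₀ → q i = 0 ∨ X i = κ) :
    ∑ i, ENNReal.ofReal (q i : ℝ) * X i =
      ENNReal.ofReal (q i₀ : ℝ) * X i₀ + ENNReal.ofReal (1 - (q i₀ : ℝ)) * κ := by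
  classical
  rw [← Finset.add_sum_erase _ _ (Finset.mem_univ i₀)]
  congr 1
  have h3 : ∀ i ∈ Finset.univ.erase i₀, ENNReal.ofReal (q i : ℝ) * X i =
      ENNReal.ofReal (q i : ℝ) * κ := by
    intro i hi
    rcases h i (Finset.mem_erase.1 hi).1 with h' | h' <;> simp [h']
  rw [Finset.sum_congr rfl h3, ← Finset.sum_mul, ← ENNReal.ofReal_sum_of_nonneg
    (fun i _ => by exact_mod_cast hq i)]
  congr 2
  rw [← Finset.add_sum_erase _ _ (Finset.mem_univ i₀)] at hsum
  have : ((q i₀ : ℝ) + ∑ i ∈ Finset.univ.erase i₀, (q i : ℝ)) = 1 := by exact_mod_cast hsum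
  linarith

/-- The recursion for the expected values at an ordinary step. -/
lemma expectAfter_step (w : List α) {c : p.toVerifier.Conf} {b : p.Conf} (h : Represents c b)
    (hacc : b.state ≠ p.acc) (hrej : b.state ≠ p.rej) (hask : p.ask b.state = none) :
    ∃ c', Represents c' (b.next w) ∧ c'.history.length = c.history.length + 1 ∧
      ∀ (P : p.toVerifier.Prover) (f : p.toVerifier.Conf → ℝ≥0∞) (κ : ℝ≥0∞),
        (∀ c : p.toVerifier.Conf, (c.state : p.State × Equiv.Perm (Fin 5)).1 = p.rej → f c = κ) →
        ∀ n, expectAfter P w f (n + 1) c =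
          ENNReal.ofReal (b.pass w : ℝ) * expectAfter P w f n c' +
          ENNReal.ofReal (1 - (b.pass w : ℝ)) * κ := by
  obtain ⟨τ₀, hτ₀⟩ : ∃ τ₀ : p.toVerifier.Outcomes,
      τ₀ = passOutcomes p w b (c.state : p.State × Equiv.Perm (Fin 5)).2 := ⟨_, rfl⟩
  have hrep : Represents (c.moveStep w τ₀) (b.next w) := hτ₀ ▸ represents_moveStep h w
  refine ⟨_, hrep, rfl, ?_⟩
  intro P f κ hf n
  have h1 : ¬ c.Halted := by
    rw [halted_iff, h.state]
    tauto
  have h2 : c.state ∉ p.toVerifier.communicating := by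
    intro h'
    have : (p.ask (c.state : p.State × Equiv.Perm (Fin 5)).1).isSome := h'
    rw [h.state, hask] at this
    simp at this
  rw [expectAfter, if_neg h1, dif_neg h2]
  have hp0 : c.prob w τ₀ = b.pass w := hτ₀ ▸ prob_passOutcomes h w
  rw [← hp0]
  refine sum_ofReal_mul_eq τ₀ (fun τ => c.prob w τ) (fun τ => prob_nonneg c w τ) (sum_prob h w)
    (fun τ => expectAfter P w f n (c.moveStep w τ)) κ ?_
  intro τ hτ
  by_cases hz : c.prob w τ = 0
  · exact Or.inl hz
  · right
    have hr : ¬ OutcomesPass τ := fun h' => hτ ((eq_passOutcomes h w τ hz h').trans hτ₀.symm)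
    have hs := moveStep_rejects (c := c) w τ hr
    show expectAfter P w f n (c.moveStep w τ) = κ
    rw [expectAfter_halted P w f n ((halted_iff _).2 (Or.inr hs)), hf _ hs]

/-- The configuration after a reply. -/
def Conf.reply (b : p.Conf) (q : p.State) : p.Conf := { b with state := q }

/-- The message carries no information and is therefore left existential; the prover knows
everything from the history. -/
lemma expectAfter_comm (w : List α) {c : p.toVerifier.Conf} {b : p.Conf} (h : Represents c b)
    (hacc : b.state ≠ p.acc) (hrej : b.state ≠ p.rej) {k : p.Comm → p.State}
    (hask : p.ask b.state = some k) (P : p.toVerifier.Prover) :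
    ∃ (m : p.Comm) (c' : p.toVerifier.Conf),
      Represents c' (b.reply (k (P w c.history m))) ∧
      c'.history.length = c.history.length + 1 ∧
      ∀ (f : p.toVerifier.Conf → ℝ≥0∞) n,
        expectAfter P w f (n + 1) c = expectAfter P w f n c' := by
  have h1 : ¬ c.Halted := by
    rw [halted_iff, h.state]
    tauto
  have h2' : (p.ask (c.state : p.State × Equiv.Perm (Fin 5)).1).isSome := by
    rw [h.state, hask]; rfl
  have h2 : c.state ∈ p.toVerifier.communicating := h2'
  have hget : (p.ask (c.state : p.State × Equiv.Perm (Fin 5)).1).get h2' = k := by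
    apply Option.get_of_mem
    rw [h.state, hask]; rfl
  refine ⟨p.toVerifier.message ⟨c.state, h2⟩, c.commStep P w h2, ?_, rfl, ?_⟩
  · refine ⟨?_, h.pos, h.reg⟩
    show (p.ask (c.state : p.State × Equiv.Perm (Fin 5)).1).get h2' _ = _
    rw [hget]; rfl
  · intro f n
    rw [expectAfter, if_neg h1, dif_pos h2]

end RegProgram

/-! ### Bounds on time and acceptance, and success of honest replies -/

namespace RegProgram

open Rat2ADfAVerifier

variable {α : Type} {p : RegProgram α}

open Classical in
/-- The indicator of the configurations that have not halted. -/
noncomputable def runInd (c : p.toVerifier.Conf) : ℝ≥0∞ := if c.Halted then 0 else 1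

open Classical in
/-- The indicator of the accepting configurations. -/
noncomputable def accInd (c : p.toVerifier.Conf) : ℝ≥0∞ :=
  if c.state ∈ p.toVerifier.accepting then 1 else 0

open Classical in
/-- The indicator of the rejecting configurations. -/
noncomputable def rejInd (c : p.toVerifier.Conf) : ℝ≥0∞ :=
  if c.state ∈ p.toVerifier.rejecting then 1 else 0

lemma runInd_of_rej (c : p.toVerifier.Conf)
    (h : (c.state : p.State × Equiv.Perm (Fin 5)).1 = p.rej) : runInd c = 0 :=
  if_pos ((halted_iff c).2 (Or.inr h))

lemma accInd_of_rej (c : p.toVerifier.Conf)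
    (h : (c.state : p.State × Equiv.Perm (Fin 5)).1 = p.rej) : accInd c = 0 :=
  if_neg fun h' => p.acc_ne_rej (Eq.trans (Eq.symm h') h)

lemma rejInd_of_rej (c : p.toVerifier.Conf)
    (h : (c.state : p.State × Equiv.Perm (Fin 5)).1 = p.rej) : rejInd c = 1 :=
  if_pos h

lemma runInd_of_acc (c : p.toVerifier.Conf)
    (h : (c.state : p.State × Equiv.Perm (Fin 5)).1 = p.acc) : runInd c = 0 :=
  if_pos ((halted_iff c).2 (Or.inl h))

lemma accInd_of_acc (c : p.toVerifier.Conf)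
    (h : (c.state : p.State × Equiv.Perm (Fin 5)).1 = p.acc) : accInd c = 1 :=
  if_pos h

lemma rejInd_of_acc (c : p.toVerifier.Conf)
    (h : (c.state : p.State × Equiv.Perm (Fin 5)).1 = p.acc) : rejInd c = 0 :=
  if_neg fun h' => p.acc_ne_rej (h.symm.trans h')

lemma runInd_of_ne (c : p.toVerifier.Conf)
    (h : (c.state : p.State × Equiv.Perm (Fin 5)).1 ≠ p.acc)
    (h' : (c.state : p.State × Equiv.Perm (Fin 5)).1 ≠ p.rej) : runInd c = 1 :=
  if_neg fun hh => ((halted_iff c).1 hh).elim h h'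

lemma accInd_of_ne (c : p.toVerifier.Conf)
    (h : (c.state : p.State × Equiv.Perm (Fin 5)).1 ≠ p.acc) : accInd c = 0 :=
  if_neg h

lemma rejInd_of_ne (c : p.toVerifier.Conf)
    (h : (c.state : p.State × Equiv.Perm (Fin 5)).1 ≠ p.rej) : rejInd c = 0 :=
  if_neg h

/-- With every prover, the expected number of steps among the first `n` ones is at most `T` and the
probability of acceptance within `n` steps is at most `A`. -/
def BoundedFor (w : List α) (n : ℕ) (b : p.Conf) (T A : ℝ) : Prop :=
  ∀ (P : p.toVerifier.Prover) (c : p.toVerifier.Conf), Represents c b →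
    ∑ i ∈ Finset.range n, expectAfter P w runInd i c ≤ ENNReal.ofReal T ∧
    expectAfter P w accInd n c ≤ ENNReal.ofReal A

namespace BoundedFor

variable {w : List α} {n : ℕ} {b : p.Conf} {T T' A A' : ℝ}

lemma mono (h : BoundedFor w n b T A) (hT : T ≤ T') (hA : A ≤ A') : BoundedFor w n b T' A' :=
  fun P c hc => ⟨(h P c hc).1.trans (ENNReal.ofReal_le_ofReal hT),
    (h P c hc).2.trans (ENNReal.ofReal_le_ofReal hA)⟩

lemma zero (hb : b.state ≠ p.acc) : BoundedFor w 0 b T A := by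
  intro P c hc
  refine ⟨by simp, ?_⟩
  rw [expectAfter, accInd_of_ne c (by rwa [hc.state])]
  exact zero_le

lemma of_rej (hb : b.state = p.rej) : BoundedFor w n b T A := by
  intro P c hc
  have h1 := hc.state.trans hb
  have h2 : c.Halted := (halted_iff c).2 (Or.inr h1)
  refine ⟨?_, ?_⟩
  · rw [Finset.sum_eq_zero]
    · exact zero_le
    · intro i _
      rw [expectAfter_halted _ _ _ _ h2, runInd_of_rej c h1]
  · rw [expectAfter_halted _ _ _ _ h2, accInd_of_rej c h1]
    exact zero_le

lemma of_acc (hb : b.state = p.acc) (hA : 1 ≤ A) : BoundedFor w n b T A := by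
  intro P c hc
  have h1 := hc.state.trans hb
  have h2 : c.Halted := (halted_iff c).2 (Or.inl h1)
  refine ⟨?_, ?_⟩
  · rw [Finset.sum_eq_zero]
    · exact zero_le
    · intro i _
      rw [expectAfter_halted _ _ _ _ h2, runInd_of_acc c h1]
  · rw [expectAfter_halted _ _ _ _ h2, accInd_of_acc c h1]
    simpa using ENNReal.ofReal_le_ofReal hA

lemma step (hacc : b.state ≠ p.acc) (hrej : b.state ≠ p.rej) (hask : p.ask b.state = none)
    (h : BoundedFor w n (b.next w) T A) (hT : 0 ≤ T)
    (hT' : 1 + (b.pass w : ℝ) * T ≤ T') (hA' : (b.pass w : ℝ) * A ≤ A') :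
    BoundedFor w (n + 1) b T' A' := by
  intro P c hc
  obtain ⟨c', hc', -, hrec⟩ := expectAfter_step w hc hacc hrej hask
  have hp : (0 : ℝ) ≤ (b.pass w : ℝ) := by exact_mod_cast b.pass_nonneg w
  obtain ⟨h1, h2⟩ := h P c' hc'
  refine ⟨?_, ?_⟩
  · rw [Finset.sum_range_succ']
    simp only [hrec P runInd 0 runInd_of_rej, mul_zero, add_zero]
    rw [← Finset.mul_sum, expectAfter, runInd_of_ne c (by rwa [hc.state]) (by rwa [hc.state])]
    calc _ ≤ ENNReal.ofReal (b.pass w : ℝ) * ENNReal.ofReal T + ENNReal.ofReal 1 := by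
          rw [ENNReal.ofReal_one]
          gcongr
      _ = ENNReal.ofReal ((b.pass w : ℝ) * T + 1) := by
          rw [ENNReal.ofReal_add (by positivity) (by norm_num), ENNReal.ofReal_mul hp]
      _ ≤ _ := ENNReal.ofReal_le_ofReal (by linarith)
  · rw [hrec P accInd 0 accInd_of_rej, mul_zero, add_zero]
    calc _ ≤ ENNReal.ofReal (b.pass w : ℝ) * ENNReal.ofReal A := by gcongr
      _ = ENNReal.ofReal ((b.pass w : ℝ) * A) := by rw [ENNReal.ofReal_mul hp]
      _ ≤ _ := ENNReal.ofReal_le_ofReal hA'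

/-- The prover is arbitrary, so the bounds are required after every possible reply. -/
lemma comm (hacc : b.state ≠ p.acc) (hrej : b.state ≠ p.rej) {k : p.Comm → p.State}
    (hask : p.ask b.state = some k) (h : ∀ x, BoundedFor w n (b.reply (k x)) T A) (hT : 0 ≤ T)
    (hT' : 1 + T ≤ T') : BoundedFor w (n + 1) b T' A := by
  intro P c hc
  obtain ⟨m, c', hc', -, hrec⟩ := expectAfter_comm w hc hacc hrej hask P
  obtain ⟨h1, h2⟩ := h _ P c' hc'
  refine ⟨?_, ?_⟩
  · rw [Finset.sum_range_succ']
    simp only [hrec]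
    rw [expectAfter, runInd_of_ne c (by rwa [hc.state]) (by rwa [hc.state])]
    calc _ ≤ ENNReal.ofReal T + ENNReal.ofReal 1 := by
          rw [ENNReal.ofReal_one]
          gcongr
      _ = ENNReal.ofReal (T + 1) := by rw [ENNReal.ofReal_add hT (by norm_num)]
      _ ≤ _ := ENNReal.ofReal_le_ofReal (by linarith)
  · rw [hrec]
    exact h2

end BoundedFor

/-- Some fixed sequence of replies leads to acceptance with probability at least `1 - F`. -/
def Attains (w : List α) (b : p.Conf) (F : ℝ) : Prop :=
  ∃ (n : ℕ) (ρ : ℕ → p.Comm), ∀ (P : p.toVerifier.Prover) (c : p.toVerifier.Conf), Represents c b →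
    (∀ (l : List p.toVerifier.Event) (m : p.Comm), c.history.length ≤ l.length →
      P w l m = ρ (l.length - c.history.length)) →
    ENNReal.ofReal (1 - F) ≤ expectAfter P w accInd n c

namespace Attains

variable {w : List α} {b : p.Conf} {F F' : ℝ}

lemma mono (h : Attains w b F) (hF : F ≤ F') : Attains w b F' := by
  obtain ⟨n, ρ, h⟩ := h
  exact ⟨n, ρ, fun P c hc hP => (ENNReal.ofReal_le_ofReal (by linarith)).trans (h P c hc hP)⟩

lemma of_acc (hb : b.state = p.acc) (hF : 0 ≤ F) : Attains w b F := by
  let _ := p.nonemptyComm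
  refine ⟨0, fun _ => Classical.arbitrary _, fun P c hc _ => ?_⟩
  rw [expectAfter, accInd_of_acc c (hc.state.trans hb)]
  simpa using ENNReal.ofReal_le_ofReal (by linarith : 1 - F ≤ 1)

lemma step (hacc : b.state ≠ p.acc) (hrej : b.state ≠ p.rej) (hask : p.ask b.state = none)
    (h : Attains w (b.next w) F) (hF : 1 - F' ≤ (b.pass w : ℝ) * (1 - F)) : Attains w b F' := by
  obtain ⟨n, ρ, h⟩ := h
  -- Replies are indexed by the number of events since `b`. An ordinary step is an event too, so the
  -- indices shift and slot `0` is never read.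
  refine ⟨n + 1, fun i => ρ (i - 1), fun P c hc hP => ?_⟩
  obtain ⟨c', hc', hl, hrec⟩ := expectAfter_step w hc hacc hrej hask
  have hp : (0 : ℝ) ≤ (b.pass w : ℝ) := by exact_mod_cast b.pass_nonneg w
  have h1 := h P c' hc' (fun l m hm => by
    refine (hP l m (by omega)).trans ?_
    show ρ (l.length - c.history.length - 1) = _
    congr 1
    omega)
  rw [hrec P accInd 0 accInd_of_rej, mul_zero, add_zero]
  calc _ ≤ ENNReal.ofReal ((b.pass w : ℝ) * (1 - F)) := ENNReal.ofReal_le_ofReal hF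
    _ = ENNReal.ofReal (b.pass w : ℝ) * ENNReal.ofReal (1 - F) := by rw [ENNReal.ofReal_mul hp]
    _ ≤ _ := by gcongr

lemma comm (hacc : b.state ≠ p.acc) (hrej : b.state ≠ p.rej) {k : p.Comm → p.State}
    (hask : p.ask b.state = some k) (h : ∃ x, Attains w (b.reply (k x)) F) : Attains w b F := by
  obtain ⟨x, n, ρ, h⟩ := h
  refine ⟨n + 1, fun i => if i = 0 then x else ρ (i - 1), fun P c hc hP => ?_⟩
  obtain ⟨m, c', hc', hl, hrec⟩ := expectAfter_comm w hc hacc hrej hask P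
  rw [hrec]
  have h0 : P w c.history m = x := (hP c.history m le_rfl).trans (if_pos (Nat.sub_self _))
  rw [h0] at hc'
  refine h P c' hc' (fun l m hm => ?_)
  refine ((hP l m (by omega)).trans (if_neg (by omega))).trans ?_
  congr 1
  omega

end Attains

/-- Time at most `T` and acceptance probability at most `A` with every prover, and, if `Q` holds,
acceptance with probability at least `1 - F` for some sequence of replies. -/
structure Controlled (w : List α) (A : ℝ) (Q : Prop) (b : p.Conf) (T F : ℝ) : Prop where
  bounded : ∀ n, BoundedFor w n b T A
  attains : Q → Attains w b F

namespace Controlled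

variable {w : List α} {b : p.Conf} {T T' A A' F F' : ℝ} {Q : Prop}

lemma mono (h : Controlled w A Q b T F) (hT : T ≤ T') (hA : A ≤ A') (hF : F ≤ F') :
    Controlled w A' Q b T' F' :=
  ⟨fun n => (h.bounded n).mono hT hA, fun hQ => (h.attains hQ).mono hF⟩

lemma of_rej (hb : b.state = p.rej) (hQ : ¬ Q) : Controlled w A Q b T F :=
  ⟨fun _ => .of_rej hb, fun h => absurd h hQ⟩

lemma of_acc (hb : b.state = p.acc) (hA : 1 ≤ A) (hF : 0 ≤ F) : Controlled w A Q b T F :=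
  ⟨fun _ => .of_acc hb hA, fun _ => .of_acc hb hF⟩

lemma step (hacc : b.state ≠ p.acc) (hrej : b.state ≠ p.rej) (hask : p.ask b.state = none)
    (h : Controlled w A Q (b.next w) T F) (hT : 0 ≤ T) (hA : 0 ≤ A) (hT' : 1 + T ≤ T')
    (hF : Q → 1 - F' ≤ (b.pass w : ℝ) * (1 - F)) : Controlled w A Q b T' F' := by
  have hp : (b.pass w : ℝ) ≤ 1 := by exact_mod_cast b.pass_le_one w
  refine ⟨fun n => ?_, fun hQ => .step hacc hrej hask (h.attains hQ) (hF hQ)⟩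
  cases n with
  | zero => exact .zero hacc
  | succ n =>
    exact .step hacc hrej hask (h.bounded n) hT (by nlinarith) (by nlinarith)

lemma move (hacc : b.state ≠ p.acc) (hrej : b.state ≠ p.rej) (hask : p.ask b.state = none)
    (hwt : p.weighted b.state (markedTape w b.pos) = none)
    (h : Controlled w A Q (b.next w) T F) (hT : 0 ≤ T) (hA : 0 ≤ A) (hT' : 1 + T ≤ T') :
    Controlled w A Q b T' F :=
  step hacc hrej hask h hT hA hT' fun _ => by simp [Conf.pass, hwt]

lemma comm (hacc : b.state ≠ p.acc) (hrej : b.state ≠ p.rej) {k : p.Comm → p.State}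
    (hask : p.ask b.state = some k) (h : ∀ x n, BoundedFor w n (b.reply (k x)) T A) (hT : 0 ≤ T)
    (hT' : 1 + T ≤ T') (h' : Q → ∃ x, Attains w (b.reply (k x)) F) :
    Controlled w A Q b T' F := by
  refine ⟨fun n => ?_, fun hQ => .comm hacc hrej hask (h' hQ)⟩
  cases n with
  | zero => exact .zero hacc
  | succ n => exact .comm hacc hrej hask (fun x => h x n) hT hT'

end Controlled

/-- The starting configuration of a program. -/
def startConf (p : RegProgram α) : p.Conf := ⟨p.start, 0, fun _ => (0, 0)⟩

lemma represents_startConf : Represents p.toVerifier.initConf p.startConf :=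
  ⟨rfl, rfl, fun _ => regVec_zero.symm⟩

/-- Acceptance, rejection and not having halted exhaust the probability. Only truncated computations
are involved, so induction on `n` suffices. -/
lemma expectAfter_total (P : p.toVerifier.Prover) (w : List α) (n : ℕ) :
    ∀ (b : p.Conf) (c : p.toVerifier.Conf), Represents c b →
      expectAfter P w accInd n c + expectAfter P w rejInd n c + expectAfter P w runInd n c = 1 := by
  have hal : ∀ (n : ℕ) (b : p.Conf) (c : p.toVerifier.Conf), Represents c b →
      (b.state = p.acc ∨ b.state = p.rej) →
      expectAfter P w accInd n c + expectAfter P w rejInd n c + expectAfter P w runInd n c = 1 := by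
    intro n b c hc hb
    rw [← hc.state] at hb
    have h2 : c.Halted := (halted_iff c).2 hb
    simp only [expectAfter_halted _ _ _ _ h2]
    rcases hb with hb | hb
    · simp [accInd_of_acc c hb, rejInd_of_acc c hb, runInd_of_acc c hb]
    · simp [accInd_of_rej c hb, rejInd_of_rej c hb, runInd_of_rej c hb]
  induction n with
  | zero =>
    intro b c hc
    by_cases hb : b.state = p.acc ∨ b.state = p.rej
    · exact hal 0 b c hc hb
    · rw [← hc.state] at hb
      push Not at hb
      simp [expectAfter, accInd_of_ne c hb.1, rejInd_of_ne c hb.2, runInd_of_ne c hb.1 hb.2]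
  | succ n ih =>
    intro b c hc
    by_cases hb : b.state = p.acc ∨ b.state = p.rej
    · exact hal _ b c hc hb
    · push Not at hb
      cases hask : p.ask b.state with
      | none =>
        obtain ⟨c', hc', -, hrec⟩ := expectAfter_step w hc hb.1 hb.2 hask
        rw [hrec P accInd 0 accInd_of_rej, hrec P rejInd 1 rejInd_of_rej,
          hrec P runInd 0 runInd_of_rej]
        have hp : (0 : ℝ) ≤ (b.pass w : ℝ) := by exact_mod_cast b.pass_nonneg w
        have hp1 : (b.pass w : ℝ) ≤ 1 := by exact_mod_cast b.pass_le_one w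
        have hi := ih _ c' hc'
        calc _ = ENNReal.ofReal (b.pass w : ℝ) * (expectAfter P w accInd n c' +
              expectAfter P w rejInd n c' + expectAfter P w runInd n c') +
              ENNReal.ofReal (1 - (b.pass w : ℝ)) := by ring
          _ = 1 := by
            rw [hi, mul_one, ← ENNReal.ofReal_add hp (by linarith)]
            simp
      | some k =>
        obtain ⟨m, c', hc', -, hrec⟩ := expectAfter_comm w hc hb.1 hb.2 hask P
        simp only [hrec]
        exact ih _ c' hc'

lemma expectedTime_le {w : List α} {T A : ℝ} (h : ∀ n, BoundedFor w n p.startConf T A)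
    (P : p.toVerifier.Prover) : p.toVerifier.expectedTime P w ≤ ENNReal.ofReal T :=
  ENNReal.tsum_le_of_sum_range_le fun n => (h n P _ represents_startConf).1

/-- A finite expected time is a convergent sum of the probabilities of still running, which
therefore tend to `0`; what is not accepted is then rejected in the limit. -/
lemma le_rejectProb {w : List α} {T A : ℝ} (h : ∀ n, BoundedFor w n p.startConf T A) (hA : 0 ≤ A)
    (P : p.toVerifier.Prover) : ENNReal.ofReal (1 - A) ≤ p.toVerifier.rejectProb P w := by
  have hfin : ∑' n, expectAfter P w runInd n p.toVerifier.initConf ≠ ⊤ :=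
    ne_top_of_le_ne_top ENNReal.ofReal_ne_top (expectedTime_le h P)
  have hlim := ENNReal.tendsto_atTop_zero_of_tsum_ne_top hfin
  have h1 : ∀ n, (1 : ℝ≥0∞) ≤ ENNReal.ofReal A + p.toVerifier.rejectProb P w +
      expectAfter P w runInd n p.toVerifier.initConf := by
    intro n
    rw [← expectAfter_total P w n _ _ represents_startConf]
    gcongr
    · exact (h n P _ represents_startConf).2
    · exact le_iSup (fun n => expectAfter P w rejInd n p.toVerifier.initConf) n
  have h2 : (1 : ℝ≥0∞) ≤ ENNReal.ofReal A + p.toVerifier.rejectProb P w + 0 :=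
    ge_of_tendsto' (hlim.const_add _) h1
  rw [add_zero] at h2
  rw [ENNReal.ofReal_sub _ hA, ENNReal.ofReal_one]
  exact tsub_le_iff_left.2 h2

/-- If the starting configuration is controlled on all inputs then the program is a verifier. -/
lemma stronglyVerifies {L : Language α} {ε : ℝ} (A T F : List α → ℝ)
    (h : ∀ w, Controlled w (A w) (w ∈ L) p.startConf (T w) (F w)) (hA0 : ∀ w, 0 ≤ A w)
    (hA : ∀ w ∉ L, A w ≤ ε) (hF : ∀ w ∈ L, F w ≤ ε) : p.toVerifier.StronglyVerifies L ε := by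
  constructor
  · have : ∀ w : List α, ∃ ρ : ℕ → p.Comm, w ∈ L → ∃ n, ∀ P : p.toVerifier.Prover,
        (∀ l m, P w l m = ρ l.length) →
        ENNReal.ofReal (1 - F w) ≤ expectAfter P w accInd n p.toVerifier.initConf := by
      intro w
      by_cases hw : w ∈ L
      · obtain ⟨n, ρ, hρ⟩ := (h w).attains hw
        exact ⟨ρ, fun _ => ⟨n, fun P hP => hρ P _ represents_startConf fun l m _ => hP l m⟩⟩
      · let _ := p.nonemptyComm
        exact ⟨fun _ => Classical.arbitrary _, fun h => absurd h hw⟩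
    choose ρ hρ using this
    -- Any failed weighting halts, so the surviving path is deterministic and the honest prover
    -- needs only a clock, the length of the history.
    refine ⟨fun w l _ => ρ w l.length, fun w hw => ?_⟩
    obtain ⟨n, hn⟩ := hρ w hw
    refine (ENNReal.ofReal_le_ofReal (by linarith [hF w hw])).trans
      ((hn (fun w l _ => ρ w l.length) fun _ _ => rfl).trans ?_)
    exact le_iSup (fun n => expectAfter (fun w l _ => ρ w l.length) w accInd n
      p.toVerifier.initConf) n
  · intro w hw P
    exact (ENNReal.ofReal_le_ofReal (by linarith [hA w hw])).trans
      (le_rejectProb (h w).bounded (hA0 w) P)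

end RegProgram

/-! ### The tape cells of a Turing machine -/

namespace SingleTapeDTM

variable {α : Type} (M : SingleTapeDTM α)

/-- The contents of a tape cell, with the state of the machine if the head is there. -/
abbrev Cell : Type := Option M.State × M.Symbol

noncomputable instance : Fintype M.Cell :=
  letI := M.finState
  letI := M.finSymbol
  inferInstance

/-- The number of possible contents of a cell. -/
noncomputable def cellBase : ℕ := Fintype.card M.Cell

/-- A code of the contents of a cell. -/
noncomputable def cellCode (x : M.Cell) : ℕ := (Fintype.equivFin M.Cell x : ℕ)

lemma cellCode_lt (x : M.Cell) : M.cellCode x < M.cellBase := (Fintype.equivFin M.Cell x).2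

lemma cellCode_injective : Function.Injective M.cellCode := fun _ _ h =>
  (Fintype.equivFin M.Cell).injective (Fin.ext h)

lemma cellBase_pos : 0 < M.cellBase := (Nat.zero_le _).trans_lt (M.cellCode_lt (none, M.blank))

/-- The symbol in a cell after one step. -/
def nextSymbol (x : M.Cell) : M.Symbol :=
  x.1.elim x.2 fun q => (M.trans q x.2).2.1

/-- The state that moves into a cell from the left neighbour. -/
def fromLeft : Option M.Cell → Option M.State
  | some (some q, a) => match (M.trans q a).2.2 with
    | .right => some (M.trans q a).1
    | _ => none
  | _ => none

/-- The state that moves into a cell from the right neighbour. -/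
def fromRight : Option M.Cell → Option M.State
  | some (some q, a) => match (M.trans q a).2.2 with
    | .left => some (M.trans q a).1
    | _ => none
  | _ => none

/-- The state that stays in a cell, which is the first one if there is no left neighbour. -/
def fromSelf (l : Option M.Cell) : M.Cell → Option M.State
  | (some q, a) => match (M.trans q a).2.2 with
    | .stay => some (M.trans q a).1
    | .left => if l.isNone then some (M.trans q a).1 else none
    | .right => none
  | _ => none

/-- The contents of a cell after one step, given its neighbours. -/
def nextCell (l : Option M.Cell) (x : M.Cell) (r : Option M.Cell) : M.Cell :=
  (((M.fromSelf l x).or (M.fromLeft l)).or (M.fromRight r), M.nextSymbol x)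

/-- A blank cell without the head. -/
def blankCell : M.Cell := (none, M.blank)

/-- Whether the head moves from the last cell `x` to a new one. -/
def grows (x : M.Cell) : Bool := (M.fromLeft (some x)).isSome

/-- The tape symbol for a symbol of the input tape. -/
def symbolOf : MarkedSymbol α → M.Symbol
  | .letter a => M.letter a
  | _ => M.blank

end SingleTapeDTM

/-! ### The protocol: states, register operations, control -/

/-- The states of the verifier. -/
inductive SweepState (C : Type) (β : ℕ) where
  | loadStart
  | loadFirst
  | loadRest
  | sweepStart
  | askFirst
  | askNext (l : Option C) (x : C) (acc : Bool)
  | consume (l : Option C) (x : C) (z : Option C) (acc : Bool)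
  | askDigit (l : Option C) (x : C) (acc : Bool)
  | digit (l : Option C) (x : C) (acc : Bool) (d : Fin β)
  | checkStart (l : Option C) (x : C) (acc : Bool)
  | check (l : Option C) (x : C) (acc : Bool)
  | checkTest (l : Option C) (x : C) (acc : Bool)
  | turnBack (acc : Bool)
  | walkBack (acc : Bool)
  | testCount (acc : Bool)
  | testTape (acc : Bool)
  | accept
  | reject

namespace SweepState

/-- The components of a state. -/
def components {C : Type} {β : ℕ} :
    SweepState C β → Fin 18 × Option C × Option C × Option C × Bool × Option (Fin β)
  | loadStart => (0, none, none, none, false, none)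
  | loadFirst => (1, none, none, none, false, none)
  | loadRest => (2, none, none, none, false, none)
  | sweepStart => (3, none, none, none, false, none)
  | askFirst => (4, none, none, none, false, none)
  | askNext l x acc => (5, l, some x, none, acc, none)
  | consume l x z acc => (6, l, some x, z, acc, none)
  | askDigit l x acc => (7, l, some x, none, acc, none)
  | digit l x acc d => (8, l, some x, none, acc, some d)
  | checkStart l x acc => (9, l, some x, none, acc, none)
  | check l x acc => (10, l, some x, none, acc, none)
  | checkTest l x acc => (11, l, some x, none, acc, none)
  | turnBack acc => (12, none, none, none, acc, none)
  | walkBack acc => (13, none, none, none, acc, none)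
  | testCount acc => (14, none, none, none, acc, none)
  | testTape acc => (15, none, none, none, acc, none)
  | accept => (16, none, none, none, false, none)
  | reject => (17, none, none, none, false, none)

lemma components_injective {C : Type} {β : ℕ} :
    Function.Injective (components : SweepState C β → _) := by
  intro s t h
  cases s <;> cases t <;> simp_all [components]

instance {C : Type} {β : ℕ} [Finite C] : Finite (SweepState C β) :=
  Finite.of_injective _ components_injective

end SweepState

namespace RegCoeff

/-- Set the second component to `1`. -/
def setOne : RegCoeff := ⟨1, 0, 0, 0, 1⟩
/-- Add the digit `c` at the next position of a base `b` expansion. -/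
def push (b c : ℚ) : RegCoeff := ⟨1, c, 0, b, 0⟩
/-- Add two digits to a base `b` expansion. -/
def pushTwo (b c c' : ℚ) : RegCoeff := ⟨1, c + c' * b, 0, b * b, 0⟩
/-- Increment the first component. -/
def incr : RegCoeff := ⟨1, 0, 1, 1, 0⟩
/-- A Horner step in the second component. -/
def hornerSnd (β d : ℚ) : RegCoeff := ⟨1, 0, 0, β, d⟩
/-- A Horner step in the first component. -/
def hornerFst (β d : ℚ) : RegCoeff := ⟨β, 0, d, 1, 0⟩
/-- Amplify the first component and reduce the second one. -/
def amplify (β : ℚ) : RegCoeff := ⟨β, 0, 0, β⁻¹, 0⟩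
/-- Prepare the test of the first component. -/
def coin (N : ℚ) : RegCoeff := ⟨N, 0, 0, 0, N⁻¹⟩
/-- Prepare the test whether the first component exceeds the second one by `1`. -/
def coinCheck (N : ℚ) : RegCoeff := ⟨N, -N, -N, 0, N⁻¹⟩

variable (b c c' : ℚ) (x : ℚ × ℚ)

lemma setOne_apply : setOne.apply x = (x.1, 1) := by simp [setOne, apply]
lemma push_apply : (push b c).apply x = (x.1 + c * x.2, b * x.2) := by simp [push, apply]
lemma pushTwo_apply :
    (pushTwo b c c').apply x = (x.1 + (c + c' * b) * x.2, b * b * x.2) := by simp [pushTwo, apply]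
lemma incr_apply : incr.apply x = (x.1 + 1, x.2) := by simp [incr, apply]
lemma hornerSnd_apply : (hornerSnd b c).apply x = (x.1, b * x.2 + c) := by simp [hornerSnd, apply]
lemma hornerFst_apply : (hornerFst b c).apply x = (b * x.1 + c, x.2) := by simp [hornerFst, apply]
lemma amplify_apply : (amplify b).apply x = (b * x.1, b⁻¹ * x.2) := by simp [amplify, apply]
lemma coin_apply : (coin b).apply x = (b * x.1, b⁻¹) := by simp [coin, apply]
lemma coinCheck_apply : (coinCheck b).apply x = (b * (x.1 - x.2 - 1), b⁻¹) := by
  simp [coinCheck, apply]; ring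

end RegCoeff

namespace SingleTapeDTM

variable {α : Type} (M : SingleTapeDTM α) (β N : ℕ)

open SweepState

/-- The reaction of the verifier to a reply. -/
def sweepAsk : SweepState M.Cell β → Option (Option M.Cell × Fin β → SweepState M.Cell β)
  | askFirst => some fun r => r.1.elim .reject fun x => askNext none x false
  | askNext l x acc => some fun r => consume l x r.1 acc
  | askDigit l x acc => some fun r => digit l x acc r.2
  | _ => none

/-- The register that is weighted. -/
def sweepWeighted : SweepState M.Cell β → MarkedSymbol α → Option (Fin 5)
  | checkTest _ _ _, _ => some 2
  | testCount _, _ => some 2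
  | testTape _, _ => some 0
  | _, _ => none

/-- The operations on the registers. Their roles: the encoding of the present configuration, which
is consumed, the encoding of the next configuration, the number of cells beyond the input that are
still to come, its claimed next value, and the number of such cells in the next configuration. -/
noncomputable def sweepCoeff : SweepState M.Cell β → MarkedSymbol α → Fin 5 → RegCoeff
  | loadStart, _ => ![.id, .setOne, .id, .id, .id]
  | loadFirst, σ => ![.id, .push M.cellBase (M.cellCode (some M.start, M.symbolOf σ)), .id, .id, .id]
  | loadRest, σ => ![.id, .push M.cellBase (M.cellCode (none, M.symbolOf σ)), .id, .id, .id]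
  | sweepStart, _ => ![.setOne, .setOne, .id, .id, .id]
  | consume l x (some z) _, .rightEnd =>
    ![.push M.cellBase (-M.cellCode x), .push M.cellBase (M.cellCode (M.nextCell l x (some z))),
      .id, .id, .incr]
  | consume l x none _, .rightEnd =>
    ![.push M.cellBase (-M.cellCode x),
      if M.grows x then
        RegCoeff.pushTwo M.cellBase (M.cellCode (M.nextCell l x none))
          (M.cellCode (M.nextCell (some x) M.blankCell none))
      else RegCoeff.push M.cellBase (M.cellCode (M.nextCell l x none)),
      .id, .id, if M.grows x then RegCoeff.incr else .id]
  | consume l x z _, _ =>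
    ![.push M.cellBase (-M.cellCode x), .push M.cellBase (M.cellCode (M.nextCell l x z)),
      .id, .id, .id]
  | digit _ _ _ d, _ => ![.id, .id, .hornerSnd β (d : ℕ), .hornerFst β (d : ℕ), .id]
  | checkStart _ _ _, _ => ![.id, .id, .coinCheck N, .id, .id]
  | check _ _ _, .rightEnd => fun _ => .id
  | check _ _ _, _ => ![.id, .id, .amplify β, .id, .id]
  | turnBack _, _ => ![.coin N, .id, .coin N, .id, .id]
  | walkBack _, .leftEnd => fun _ => .id
  | walkBack _, _ => ![.amplify β, .id, .amplify β, .id, .id]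
  | _, _ => fun _ => .id

/-- The exchange of the roles of the registers. -/
def sweepPerm : SweepState M.Cell β → MarkedSymbol α → Equiv.Perm (Fin 5)
  | checkTest _ _ _, _ => Equiv.swap 2 3
  | testTape _, _ => Equiv.swap 0 1 * Equiv.swap 2 4
  | _, _ => 1

open Classical in
/-- The next state and the head move. -/
noncomputable def sweepNext :
    SweepState M.Cell β → MarkedSymbol α → SweepState M.Cell β × HeadMove
  | loadStart, _ => (loadFirst, .right)
  | loadFirst, .rightEnd => (turnBack false, .stay)
  | loadFirst, _ => (loadRest, .right)
  | loadRest, .rightEnd => (turnBack false, .stay)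
  | loadRest, _ => (loadRest, .right)
  | sweepStart, _ => (askFirst, .right)
  | consume _ x z acc, σ =>
    if x.1 = some M.reject then (.reject, .stay)
    else match σ, z with
      | .letter _, some z => (askNext (some x) z (acc || decide (x.1 = some M.accept)), .right)
      | .rightEnd, some z => (askDigit (some x) z (acc || decide (x.1 = some M.accept)), .stay)
      | .rightEnd, none => (turnBack (acc || decide (x.1 = some M.accept)), .stay)
      | _, _ => (.reject, .stay)
  | digit l x acc _, .leftEnd => (checkStart l x acc, .stay)
  | digit l x acc _, _ => (askDigit l x acc, .left)
  | checkStart l x acc, _ => (check l x acc, .stay)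
  | check l x acc, .rightEnd => (checkTest l x acc, .stay)
  | check l x acc, _ => (check l x acc, .right)
  | checkTest l x acc, _ => (askNext l x acc, .stay)
  | turnBack acc, _ => (walkBack acc, .stay)
  | walkBack acc, .leftEnd => (testCount acc, .stay)
  | walkBack acc, _ => (walkBack acc, .left)
  | testCount acc, _ => (testTape acc, .stay)
  | testTape acc, _ => (if acc then .accept else sweepStart, .stay)
  | q, _ => (q, .stay)

open Classical in
/-- The program of the verifier for the language of `M`. -/
noncomputable def sweepProgram (hβ : 0 < β) : RegProgram α where
  State := SweepState M.Cell β
  finState := Fintype.ofFinite _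
  start := if M.start = M.accept then .accept else if M.start = M.reject then .reject else loadStart
  acc := .accept
  rej := .reject
  acc_ne_rej := by simp
  Comm := Option M.Cell × Fin β
  nonemptyComm := ⟨(none, ⟨0, hβ⟩)⟩
  ask := M.sweepAsk β
  weighted := M.sweepWeighted β
  coeff := M.sweepCoeff β N
  perm := M.sweepPerm β
  next := M.sweepNext β

end SingleTapeDTM

lemma markedTape_zero {α : Type} (w : List α) : markedTape w 0 = .leftEnd := rfl

lemma markedTape_letter {α : Type} (w : List α) {j : ℕ} (hj : j < w.length) :
    markedTape w (j + 1) = .letter w[j] := by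
  simp [markedTape, hj]

lemma markedTape_right {α : Type} (w : List α) : markedTape w (w.length + 1) = .rightEnd := by
  simp [markedTape]

lemma markedTape_cases {α : Type} (w : List α) {p : ℕ} (h1 : 1 ≤ p) (h2 : p ≤ w.length + 1) :
    (p ≤ w.length ∧ ∃ a, markedTape w p = .letter a) ∨
      (p = w.length + 1 ∧ markedTape w p = .rightEnd) := by
  rcases Nat.lt_or_ge w.length p with h | h
  · obtain rfl : p = w.length + 1 := by omega
    exact Or.inr ⟨rfl, markedTape_right w⟩
  · obtain ⟨j, rfl⟩ : ∃ j, p = j + 1 := ⟨p - 1, by omega⟩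
    exact Or.inl ⟨h, _, markedTape_letter w h⟩

lemma clampMove_stay {α : Type} (σ : MarkedSymbol α) : clampMove σ .stay = .stay := by
  cases σ <;> rfl

/-! ### The effect of each single step of the protocol -/

namespace SingleTapeDTM

open SweepState RegProgram RegCoeff

variable {α : Type} (M : SingleTapeDTM α) {β : ℕ} (N : ℕ) (hβ : 0 < β)

/-- A configuration of the program. -/
def sweepConf (q : SweepState M.Cell β) (p : ℕ) (v : Fin 5 → ℚ × ℚ) :
    (M.sweepProgram β N hβ).Conf := ⟨q, p, v⟩

variable {M N hβ} {w : List α} {p : ℕ} (v : Fin 5 → ℚ × ℚ)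

lemma sweepConf_next {q q' : SweepState M.Cell β} {σ : MarkedSymbol α} {d : HeadMove}
    (hσ : markedTape w p = σ) (hn : M.sweepNext β q σ = (q', d))
    (hw : M.sweepWeighted β q σ = none) (hp : M.sweepPerm β q σ = 1) :
    (sweepConf M N hβ q p v).next w = sweepConf M N hβ q' ((clampMove σ d).apply p)
      fun r => (M.sweepCoeff β N q σ r).apply (v r) := by
  subst hσ
  have h1 : (M.sweepProgram β N hβ).weighted q (markedTape w p) = none := hw
  have h2 : (M.sweepProgram β N hβ).perm q (markedTape w p) = 1 := hp
  have h3 : (M.sweepProgram β N hβ).next q (markedTape w p) = (q', d) := hn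
  have h4 : (M.sweepProgram β N hβ).coeff q (markedTape w p) =
    M.sweepCoeff β N q (markedTape w p) := rfl
  simp only [Conf.next, sweepConf, h1, h2, h3, h4]
  simp

lemma sweepConf_congr {q q' : SweepState M.Cell β} {p p' : ℕ} {v v' : Fin 5 → ℚ × ℚ} (hq : q = q')
    (hp : p = p') (h0 : v 0 = v' 0) (h1 : v 1 = v' 1) (h2 : v 2 = v' 2) (h3 : v 3 = v' 3)
    (h4 : v 4 = v' 4) : sweepConf M N hβ q p v = sweepConf M N hβ q' p' v' := by
  subst hq hp
  congr 1
  funext r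
  fin_cases r <;> assumption

lemma next_loadStart : (sweepConf M N hβ loadStart 0 v).next w =
    sweepConf M N hβ loadFirst 1 ![v 0, ((v 1).1, 1), v 2, v 3, v 4] := by
  rw [sweepConf_next v (markedTape_zero w) rfl rfl rfl]
  apply sweepConf_congr <;> simp [sweepCoeff, clampMove, HeadMove.apply, setOne_apply]

lemma next_loadFirst_letter {a : α} (hp : markedTape w p = .letter a) :
    (sweepConf M N hβ loadFirst p v).next w = sweepConf M N hβ loadRest (p + 1)
      ![v 0, (push M.cellBase (M.cellCode (some M.start, M.letter a))).apply (v 1), v 2, v 3,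
        v 4] := by
  rw [sweepConf_next v hp rfl rfl rfl]
  apply sweepConf_congr <;> simp [sweepCoeff, clampMove, HeadMove.apply, symbolOf]

lemma next_loadFirst_right (hp : markedTape w p = .rightEnd) :
    (sweepConf M N hβ loadFirst p v).next w = sweepConf M N hβ (turnBack false) p
      ![v 0, (push M.cellBase (M.cellCode (some M.start, M.blank))).apply (v 1), v 2, v 3,
        v 4] := by
  rw [sweepConf_next v hp rfl rfl rfl]
  apply sweepConf_congr <;> simp [sweepCoeff, clampMove, HeadMove.apply, symbolOf]

lemma next_loadRest_letter {a : α} (hp : markedTape w p = .letter a) :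
    (sweepConf M N hβ loadRest p v).next w = sweepConf M N hβ loadRest (p + 1)
      ![v 0, (push M.cellBase (M.cellCode (none, M.letter a))).apply (v 1), v 2, v 3, v 4] := by
  rw [sweepConf_next v hp rfl rfl rfl]
  apply sweepConf_congr <;> simp [sweepCoeff, clampMove, HeadMove.apply, symbolOf]

lemma next_loadRest_right (hp : markedTape w p = .rightEnd) :
    (sweepConf M N hβ loadRest p v).next w = sweepConf M N hβ (turnBack false) p
      ![v 0, (push M.cellBase (M.cellCode (none, M.blank))).apply (v 1), v 2, v 3, v 4] := by
  rw [sweepConf_next v hp rfl rfl rfl]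
  apply sweepConf_congr <;> simp [sweepCoeff, clampMove, HeadMove.apply, symbolOf]

lemma next_sweepStart : (sweepConf M N hβ sweepStart 0 v).next w =
    sweepConf M N hβ askFirst 1 ![((v 0).1, 1), ((v 1).1, 1), v 2, v 3, v 4] := by
  rw [sweepConf_next v (markedTape_zero w) rfl rfl rfl]
  apply sweepConf_congr <;> simp [sweepCoeff, clampMove, HeadMove.apply, setOne_apply]

open Classical in
/-- The acceptance flag after a cell has been seen. -/
noncomputable def flag (acc : Bool) (x : M.Cell) : Bool := acc || decide (x.1 = some M.accept)

lemma next_consume_reject {l : Option M.Cell} {x : M.Cell} {z : Option M.Cell} {acc : Bool}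
    (hx : x.1 = some M.reject ∨ markedTape w p = .leftEnd ∨
      (∃ a, markedTape w p = .letter a) ∧ z = none) :
    ((sweepConf M N hβ (consume l x z acc) p v).next w).state = SweepState.reject := by
  have hn : (M.sweepNext β (consume l x z acc) (markedTape w p)).1 = .reject := by
    simp only [sweepNext]
    split_ifs with h
    · rfl
    · rcases hx with hx | hx | ⟨⟨a, hx⟩, hz⟩
      · exact absurd hx h
      · rw [hx]
      · rw [hx, hz]
  exact hn

lemma next_consume_letter {l : Option M.Cell} {x z : M.Cell} {acc : Bool} {a : α}
    (hx : x.1 ≠ some M.reject) (hp : markedTape w p = .letter a) :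
    (sweepConf M N hβ (consume l x (some z) acc) p v).next w =
      sweepConf M N hβ (askNext (some x) z (flag acc x)) (p + 1)
        ![(push M.cellBase (-M.cellCode x)).apply (v 0),
          (push M.cellBase (M.cellCode (M.nextCell l x (some z)))).apply (v 1), v 2, v 3, v 4] := by
  rw [sweepConf_next v hp (by simp only [sweepNext, if_neg hx]; rfl) rfl rfl]
  apply sweepConf_congr <;> simp [sweepCoeff, clampMove, HeadMove.apply, flag]

lemma next_consume_right {l : Option M.Cell} {x z : M.Cell} {acc : Bool}
    (hx : x.1 ≠ some M.reject) (hp : markedTape w p = .rightEnd) :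
    (sweepConf M N hβ (consume l x (some z) acc) p v).next w =
      sweepConf M N hβ (askDigit (some x) z (flag acc x)) p
        ![(push M.cellBase (-M.cellCode x)).apply (v 0),
          (push M.cellBase (M.cellCode (M.nextCell l x (some z)))).apply (v 1), v 2, v 3,
          ((v 4).1 + 1, (v 4).2)] := by
  rw [sweepConf_next v hp (by simp only [sweepNext, if_neg hx]; rfl) rfl rfl]
  apply sweepConf_congr <;> simp [sweepCoeff, clampMove, HeadMove.apply, flag, incr_apply]

lemma next_consume_end {l : Option M.Cell} {x : M.Cell} {acc : Bool}
    (hx : x.1 ≠ some M.reject) (hp : markedTape w p = .rightEnd) :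
    (sweepConf M N hβ (consume l x none acc) p v).next w =
      sweepConf M N hβ (turnBack (flag acc x)) p
        ![(push M.cellBase (-M.cellCode x)).apply (v 0),
          if M.grows x then
            (pushTwo M.cellBase (M.cellCode (M.nextCell l x none))
              (M.cellCode (M.nextCell (some x) M.blankCell none))).apply (v 1)
          else (push M.cellBase (M.cellCode (M.nextCell l x none))).apply (v 1), v 2, v 3,
          if M.grows x then ((v 4).1 + 1, (v 4).2) else v 4] := by
  rw [sweepConf_next v hp (by simp only [sweepNext, if_neg hx]; rfl) rfl rfl]
  apply sweepConf_congr <;> by_cases hg : M.grows x <;>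
    simp [sweepCoeff, clampMove, HeadMove.apply, flag, incr_apply, hg]

lemma next_digit_left {l : Option M.Cell} {x : M.Cell} {acc : Bool} {d : Fin β} :
    (sweepConf M N hβ (digit l x acc d) 0 v).next w = sweepConf M N hβ (checkStart l x acc) 0
      ![v 0, v 1, ((v 2).1, β * (v 2).2 + (d : ℕ)), (β * (v 3).1 + (d : ℕ), (v 3).2), v 4] := by
  rw [sweepConf_next v (markedTape_zero w) rfl rfl rfl]
  apply sweepConf_congr <;>
    simp [sweepCoeff, clampMove, HeadMove.apply, hornerFst_apply, hornerSnd_apply]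

lemma next_digit {l : Option M.Cell} {x : M.Cell} {acc : Bool} {d : Fin β}
    (hp : p ≤ w.length) :
    (sweepConf M N hβ (digit l x acc d) (p + 1) v).next w = sweepConf M N hβ (askDigit l x acc) p
      ![v 0, v 1, ((v 2).1, β * (v 2).2 + (d : ℕ)), (β * (v 3).1 + (d : ℕ), (v 3).2), v 4] := by
  rcases markedTape_cases w (p := p + 1) (by omega) (by omega) with ⟨-, a, h⟩ | ⟨-, h⟩ <;>
  · rw [sweepConf_next v h rfl rfl rfl]
    apply sweepConf_congr <;>
      simp [sweepCoeff, clampMove, HeadMove.apply, hornerFst_apply, hornerSnd_apply]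

lemma next_checkStart {l : Option M.Cell} {x : M.Cell} {acc : Bool} :
    (sweepConf M N hβ (checkStart l x acc) p v).next w = sweepConf M N hβ (check l x acc) p
      ![v 0, v 1, (N * ((v 2).1 - (v 2).2 - 1), (N : ℚ)⁻¹), v 3, v 4] := by
  rw [sweepConf_next v rfl rfl rfl rfl]
  apply sweepConf_congr <;> simp [sweepCoeff, clampMove_stay, HeadMove.apply, coinCheck_apply]

lemma next_check {l : Option M.Cell} {x : M.Cell} {acc : Bool} (hp : p ≤ w.length) :
    (sweepConf M N hβ (check l x acc) p v).next w = sweepConf M N hβ (check l x acc) (p + 1)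
      ![v 0, v 1, (β * (v 2).1, (β : ℚ)⁻¹ * (v 2).2), v 3, v 4] := by
  obtain ⟨σ, h, hσ⟩ : ∃ σ, markedTape w p = σ ∧ (σ = .leftEnd ∨ ∃ a, σ = .letter a) := by
    refine ⟨_, rfl, ?_⟩
    rcases Nat.eq_zero_or_pos p with rfl | h
    · exact Or.inl rfl
    · rcases markedTape_cases w h (by omega) with ⟨-, h⟩ | ⟨h', -⟩
      · exact Or.inr h
      · omega
  rcases hσ with rfl | ⟨a, rfl⟩ <;>
  · rw [sweepConf_next v h rfl rfl rfl]
    apply sweepConf_congr <;> simp [sweepCoeff, clampMove, HeadMove.apply, amplify_apply]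

lemma next_check_right {l : Option M.Cell} {x : M.Cell} {acc : Bool} :
    (sweepConf M N hβ (check l x acc) (w.length + 1) v).next w =
      sweepConf M N hβ (checkTest l x acc) (w.length + 1) v := by
  rw [sweepConf_next v (markedTape_right w) rfl rfl rfl]
  apply sweepConf_congr <;> simp [sweepCoeff, clampMove, HeadMove.apply]

lemma next_turnBack {acc : Bool} :
    (sweepConf M N hβ (turnBack acc) p v).next w = sweepConf M N hβ (walkBack acc) p
      ![(N * (v 0).1, (N : ℚ)⁻¹), v 1, (N * (v 2).1, (N : ℚ)⁻¹), v 3, v 4] := by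
  rw [sweepConf_next v rfl rfl rfl rfl]
  apply sweepConf_congr <;> simp [sweepCoeff, clampMove_stay, HeadMove.apply, coin_apply]

lemma next_walkBack {acc : Bool} (hp : p ≤ w.length) :
    (sweepConf M N hβ (walkBack acc) (p + 1) v).next w = sweepConf M N hβ (walkBack acc) p
      ![(β * (v 0).1, (β : ℚ)⁻¹ * (v 0).2), v 1, (β * (v 2).1, (β : ℚ)⁻¹ * (v 2).2), v 3, v 4] := by
  rcases markedTape_cases w (p := p + 1) (by omega) (by omega) with ⟨-, a, h⟩ | ⟨-, h⟩ <;>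
  · rw [sweepConf_next v h rfl rfl rfl]
    apply sweepConf_congr <;> simp [sweepCoeff, clampMove, HeadMove.apply, amplify_apply]

lemma next_walkBack_left {acc : Bool} :
    (sweepConf M N hβ (walkBack acc) 0 v).next w = sweepConf M N hβ (testCount acc) 0 v := by
  rw [sweepConf_next v (markedTape_zero w) rfl rfl rfl]
  apply sweepConf_congr <;> simp [sweepCoeff, clampMove, HeadMove.apply]

/-- The comparison has used up the old count, so the second copy of the new count moves to register
2 and the reset register takes the place of register 3. -/
lemma next_checkTest {l : Option M.Cell} {x : M.Cell} {acc : Bool} :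
    (sweepConf M N hβ (checkTest l x acc) p v).next w = sweepConf M N hβ (askNext l x acc) p
      ![v 0, v 1, v 3, (0, 0), v 4] := by
  apply sweepConf_congr <;>
    simp [sweepProgram, sweepCoeff, sweepWeighted, sweepPerm, sweepNext, sweepConf,
      HeadMove.apply, clampMove_stay, Equiv.swap_apply_def]

lemma next_testCount {acc : Bool} :
    (sweepConf M N hβ (testCount acc) p v).next w = sweepConf M N hβ (testTape acc) p
      ![v 0, v 1, (0, 0), v 3, v 4] := by
  apply sweepConf_congr <;>
    simp [sweepProgram, sweepCoeff, sweepWeighted, sweepPerm, sweepNext, sweepConf,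
      HeadMove.apply, clampMove_stay]

/-- Here the successor configuration and its count become the present ones. The two tested
registers, now reset, serve as the next accumulators. -/
lemma next_testTape {acc : Bool} :
    (sweepConf M N hβ (testTape acc) p v).next w =
      sweepConf M N hβ (if acc then .accept else sweepStart) p
      ![v 1, (0, 0), v 4, v 3, v 2] := by
  apply sweepConf_congr <;>
    simp [sweepProgram, sweepCoeff, sweepWeighted, sweepPerm, sweepNext, sweepConf,
      HeadMove.apply, clampMove_stay, Equiv.swap_apply_def]

end SingleTapeDTM

namespace RegProgram

variable {α : Type} {p : RegProgram α}

lemma BoundedFor.move {w : List α} {n : ℕ} {b : p.Conf} {T T' A : ℝ} (hacc : b.state ≠ p.acc)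
    (hrej : b.state ≠ p.rej) (hask : p.ask b.state = none)
    (hwt : p.weighted b.state (markedTape w b.pos) = none)
    (h : BoundedFor w n (b.next w) T A) (hT : 0 ≤ T) (hT' : 1 + T ≤ T') :
    BoundedFor w (n + 1) b T' A :=
  have hp : b.pass w = 1 := by simp [Conf.pass, hwt]
  .step hacc hrej hask h hT (by rw [hp]; push_cast; linarith) (by rw [hp]; simp)

end RegProgram

/-! ### Expected time against an arbitrary prover -/

namespace SingleTapeDTM

open SweepState RegProgram

variable {α : Type} (M : SingleTapeDTM α) {β : ℕ} (N : ℕ) (hβ : 0 < β)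

/-- The false-alarm probability of a test on input `w`. -/
def alarmRate (β N : ℕ) (w : List α) : ℚ := (N : ℚ)⁻¹ * (β : ℚ)⁻¹ ^ (w.length + 1)

/-- The circumstances in which a test with the prescribed false-alarm probability will come. -/
def Sound (w : List α) : SweepState M.Cell β → ℕ → (Fin 5 → ℚ × ℚ) → Prop
  | loadStart, p, _ | sweepStart, p, _ | checkStart _ _ _, p, _ => p = 0
  | loadFirst, p, _ | loadRest, p, _ | askFirst, p, _ | askNext _ _ _, p, _
  | consume _ _ _ _, p, _ => 1 ≤ p ∧ p ≤ w.length + 1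
  | askDigit _ _ _, p, _ | digit _ _ _ _, p, _ => p ≤ w.length + 1
  | check _ _ _, p, v => p ≤ w.length + 1 ∧ (v 2).2 = (N : ℚ)⁻¹ * (β : ℚ)⁻¹ ^ p
  | checkTest _ _ _, p, v => p = w.length + 1 ∧ (v 2).2 = alarmRate β N w
  | turnBack _, p, _ => p = w.length + 1
  | walkBack _, p, v => p ≤ w.length + 1 ∧
      (v 2).2 = (N : ℚ)⁻¹ * (β : ℚ)⁻¹ ^ (w.length + 1 - p) ∧
      (v 0).2 = (N : ℚ)⁻¹ * (β : ℚ)⁻¹ ^ (w.length + 1 - p)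
  | testCount _, p, v => p = 0 ∧ (v 2).2 = alarmRate β N w ∧ (v 0).2 = alarmRate β N w
  | testTape _, p, v => p = 0 ∧ (v 0).2 = alarmRate β N w
  | .accept, p, _ | .reject, p, _ => p ≤ w.length + 1

/-- A bound for the number of steps until a test or until the program halts. -/
def distToTest {C : Type} {β : ℕ} (m : ℝ) : SweepState C β → ℝ → ℝ
  | loadStart, _ => 2 * m + 3
  | loadFirst, p | loadRest, p => m - p + m + 3
  | sweepStart, _ => 5 * m + 6
  | askFirst, p => 2 * (m - p) + 3 * m + 7
  | askNext _ _ _, p => 2 * (m - p) + 3 * m + 6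
  | consume _ _ _ _, p => 2 * (m - p) + 3 * m + 5
  | askDigit _ _ _, p => 2 * p + m + 4
  | digit _ _ _ _, p => 2 * p + m + 3
  | checkStart _ _ _, _ => m + 2
  | check _ _ _, p => m - p + 1
  | turnBack _, _ => m + 2
  | walkBack _, p => p + 1
  | _, _ => 0

lemma distToTest_nonneg {C : Type} {β : ℕ} {m p : ℝ} (hp : 0 ≤ p) (hm : p ≤ m)
    (q : SweepState C β) : 0 ≤ distToTest m q p := by
  cases q <;> simp only [distToTest] <;> linarith

lemma distToTest_le {C : Type} {β : ℕ} {m p : ℝ} (hp : 0 ≤ p) (hm : p ≤ m)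
    (q : SweepState C β) : distToTest m q p ≤ 5 * m + 7 := by
  cases q <;> simp only [distToTest] <;> linarith

/-- A bound for the expected number of steps after a test, whatever happens. -/
noncomputable def worstTime (β N : ℕ) (w : List α) : ℝ :=
  (5 * ((w.length : ℝ) + 1) + 8) / (alarmRate β N w : ℝ)

variable {N}

lemma alarmRate_pos (hβ : 0 < β) (hN : 0 < N) (w : List α) : 0 < alarmRate β N w := by
  unfold alarmRate; positivity

lemma alarmRate_le_one (hβ : 0 < β) (hN : 0 < N) (w : List α) : alarmRate β N w ≤ 1 := by
  unfold alarmRate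
  have h1 : (N : ℚ)⁻¹ ≤ 1 := inv_le_one_of_one_le₀ (by exact_mod_cast hN)
  have h2 : (β : ℚ)⁻¹ ^ (w.length + 1) ≤ 1 :=
    pow_le_one₀ (by positivity) (inv_le_one_of_one_le₀ (by exact_mod_cast hβ))
  have h3 : (0 : ℚ) ≤ (β : ℚ)⁻¹ ^ (w.length + 1) := by positivity
  calc _ ≤ (1 : ℚ) * 1 := mul_le_mul h1 h2 h3 zero_le_one
    _ = 1 := one_mul 1

lemma worstTime_nonneg (hβ : 0 < β) (hN : 0 < N) (w : List α) : 0 ≤ worstTime β N w := by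
  have hη : (0 : ℝ) < (alarmRate β N w : ℝ) := by exact_mod_cast alarmRate_pos hβ hN w
  unfold worstTime; positivity

lemma alarmRate_mul_worstTime (hβ : 0 < β) (hN : 0 < N) (w : List α) :
    (alarmRate β N w : ℝ) * worstTime β N w = 5 * ((w.length : ℝ) + 1) + 8 := by
  have hη : (0 : ℝ) < (alarmRate β N w : ℝ) := by exact_mod_cast alarmRate_pos hβ hN w
  unfold worstTime; field_simp

variable {M hβ}

lemma boundedFor_move {w : List α} {n : ℕ} {q q' : SweepState M.Cell β} {p p' : ℕ}
    {v v' : Fin 5 → ℚ × ℚ} {T T' A : ℝ} (hacc : q ≠ .accept) (hrej : q ≠ .reject)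
    (hask : M.sweepAsk β q = none) (hwt : M.sweepWeighted β q (markedTape w p) = none)
    (hnext : (sweepConf M N hβ q p v).next w = sweepConf M N hβ q' p' v')
    (h : BoundedFor w n (sweepConf M N hβ q' p' v') T A) (hT : 0 ≤ T) (hT' : 1 + T ≤ T') :
    BoundedFor w (n + 1) (sweepConf M N hβ q p v) T' A :=
  .move hacc hrej hask hwt (hnext ▸ h) hT hT'

lemma sweepConf_pass {w : List α} {q : SweepState M.Cell β} {p : ℕ} {v : Fin 5 → ℚ × ℚ}
    {r : Fin 5} (hwt : M.sweepWeighted β q (markedTape w p) = some r) :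
    (sweepConf M N hβ q p v).pass w = passProb (v r) := by
  have : (M.sweepProgram β N hβ).weighted q (markedTape w p) = some r := hwt
  simp [Conf.pass, sweepConf, this]

/-- Writing `m` for the input length plus one, `B` for `worstTime` and `η` for `alarmRate`, the
recursion closes because `η B = 5 m + 8` gives `1 + (1 - η)(5 m + 7 + B) ≤ B`. -/
lemma boundedFor_test (hN : 0 < N) {w : List α} {n : ℕ} {q q' : SweepState M.Cell β} {p p' : ℕ}
    {v v' : Fin 5 → ℚ × ℚ} {r : Fin 5} (hacc : q ≠ .accept) (hrej : q ≠ .reject)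
    (hask : M.sweepAsk β q = none) (hwt : M.sweepWeighted β q (markedTape w p) = some r)
    (hr : (v r).2 = alarmRate β N w)
    (hnext : (sweepConf M N hβ q p v).next w = sweepConf M N hβ q' p' v')
    (hpos : p' ≤ w.length + 1)
    (h : BoundedFor w n (sweepConf M N hβ q' p' v')
      (distToTest (w.length + 1) q' p' + worstTime β N w) 1) :
    BoundedFor w (n + 1) (sweepConf M N hβ q p v) (worstTime β N w) 1 := by
  have hpos' : (p' : ℝ) ≤ (w.length : ℝ) + 1 := by exact_mod_cast hpos
  have hd := distToTest_le (Nat.cast_nonneg _) hpos' q'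
  have hd0 := distToTest_nonneg (Nat.cast_nonneg _) hpos' q'
  have hpass : (sweepConf M N hβ q p v).pass w ≤ 1 - alarmRate β N w := by
    rw [sweepConf_pass hwt, ← hr]
    exact passProb_le_sub (by rw [hr]; exact (alarmRate_pos hβ hN w).le)
      (by rw [hr]; exact alarmRate_le_one hβ hN w)
  have hpass' : ((sweepConf M N hβ q p v).pass w : ℝ) ≤ 1 - (alarmRate β N w : ℝ) := by
    exact_mod_cast hpass
  have hη : (0 : ℝ) < (alarmRate β N w : ℝ) := by exact_mod_cast alarmRate_pos hβ hN w
  have hB := alarmRate_mul_worstTime hβ hN w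
  have hB0 := worstTime_nonneg hβ hN w
  refine .step hacc hrej hask (hnext ▸ h) (by linarith) ?_ (by linarith)
  have h2 := mul_le_mul_of_nonneg_right hpass' (add_nonneg hd0 hB0)
  nlinarith

/-- `distToTest` drops by at least one in every step that is not a test, whatever the prover
replies, and each test rejects with probability at least `η`. Nothing is assumed about the first
components, so this also covers everything after an undetected lie. -/
lemma boundedFor_of_sound (hN : 0 < N) (w : List α) (n : ℕ) :
    ∀ (q : SweepState M.Cell β) (p : ℕ) (v : Fin 5 → ℚ × ℚ), M.Sound N w q p v →
      BoundedFor w n (sweepConf M N hβ q p v)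
        (distToTest (w.length + 1) q p + worstTime β N w) 1 := by
  have hB0 := worstTime_nonneg hβ hN w
  induction n with
  | zero =>
    intro q p v _
    by_cases h : q = .accept
    · exact .of_acc h le_rfl
    · exact .zero h
  | succ n ih =>
    have key : ∀ {q q' : SweepState M.Cell β} {p p' : ℕ} {v v' : Fin 5 → ℚ × ℚ},
        (sweepConf M N hβ q p v).next w = sweepConf M N hβ q' p' v' →
        q ≠ .accept → q ≠ .reject →
        M.sweepAsk β q = none → M.sweepWeighted β q (markedTape w p) = none →
        M.Sound N w q' p' v' → p' ≤ w.length + 1 →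
        1 + distToTest (w.length + 1) q' p' ≤ distToTest (w.length + 1) q p →
        BoundedFor w (n + 1) (sweepConf M N hβ q p v)
          (distToTest (w.length + 1) q p + worstTime β N w) 1 := by
      intro q q' p p' v v' h0 h1 h2 h3 h4 h5 h6 h7
      have := distToTest_nonneg (Nat.cast_nonneg p') (by exact_mod_cast h6 :
        (p' : ℝ) ≤ (w.length : ℝ) + 1) q'
      exact boundedFor_move h1 h2 h3 h4 h0 (ih _ _ _ h5) (by linarith) (by linarith)
    have keyAsk : ∀ {q : SweepState M.Cell β} {p : ℕ} {v : Fin 5 → ℚ × ℚ}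
        {k : Option M.Cell × Fin β → SweepState M.Cell β}, q ≠ .accept → q ≠ .reject →
        M.sweepAsk β q = some k → p ≤ w.length + 1 → (∀ x, M.Sound N w (k x) p v) →
        (∀ x, 1 + distToTest (w.length + 1) (k x) p ≤ distToTest (w.length + 1) q p) →
        BoundedFor w (n + 1) (sweepConf M N hβ q p v)
          (distToTest (w.length + 1) q p + worstTime β N w) 1 := by
      intro q p v k h1 h2 h3 h4 h5 h6
      have hq := distToTest_nonneg (Nat.cast_nonneg p) (by exact_mod_cast h4 :
        (p : ℝ) ≤ (w.length : ℝ) + 1) (k (none, ⟨0, hβ⟩))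
      have h7 := h6 (none, ⟨0, hβ⟩)
      exact .comm (T := distToTest (w.length + 1) q p + worstTime β N w - 1) h1 h2 h3
        (fun x => (ih (k x) p v (h5 x)).mono (by linarith [h6 x]) le_rfl)
        (by linarith) (by linarith)
    have hreject : ∀ {l : Option M.Cell} {x : M.Cell} {z : Option M.Cell} {acc : Bool} {p : ℕ}
        {v : Fin 5 → ℚ × ℚ}, p ≤ w.length + 1 → (x.1 = some M.reject ∨
        markedTape w p = .leftEnd ∨ (∃ a, markedTape w p = .letter a) ∧ z = none) →
        BoundedFor w (n + 1) (sweepConf M N hβ (consume l x z acc) p v)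
          (distToTest (w.length + 1) (consume l x z acc : SweepState M.Cell β) p +
            worstTime β N w) 1 := by
      intro l x z acc p v hp hx
      refine .move (T := 0) (by simp [sweepConf, sweepProgram]) (by simp [sweepConf, sweepProgram])
        rfl rfl (.of_rej (next_consume_reject v hx)) le_rfl ?_
      have hp' : (p : ℝ) ≤ (w.length : ℝ) + 1 := by exact_mod_cast hp
      simp only [distToTest]
      linarith
    intro q p v hb
    have hcast : p ≤ w.length + 1 → (p : ℝ) ≤ (w.length : ℝ) + 1 := fun h => by exact_mod_cast h
    cases q with
    | loadStart =>
      obtain rfl : p = 0 := hb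
      refine key (next_loadStart v) (by simp) (by simp) rfl rfl ⟨le_rfl, by omega⟩ (by omega) ?_
      simp only [distToTest]; push_cast; linarith
    | loadFirst =>
      rcases markedTape_cases w hb.1 hb.2 with ⟨h, a, ha⟩ | ⟨h, hr⟩
      · refine key (next_loadFirst_letter v ha) (by simp) (by simp) rfl rfl ⟨by omega, by omega⟩
          (by omega) ?_
        simp only [distToTest]; push_cast; linarith
      · refine key (next_loadFirst_right v hr) (by simp) (by simp) rfl rfl h (by omega) ?_
        simp only [distToTest]; linarith [hcast hb.2]
    | loadRest =>
      rcases markedTape_cases w hb.1 hb.2 with ⟨h, a, ha⟩ | ⟨h, hr⟩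
      · refine key (next_loadRest_letter v ha) (by simp) (by simp) rfl rfl ⟨by omega, by omega⟩
          (by omega) ?_
        simp only [distToTest]; push_cast; linarith
      · refine key (next_loadRest_right v hr) (by simp) (by simp) rfl rfl h (by omega) ?_
        simp only [distToTest]; linarith [hcast hb.2]
    | sweepStart =>
      obtain rfl : p = 0 := hb
      refine key (next_sweepStart v) (by simp) (by simp) rfl rfl ⟨le_rfl, by omega⟩ (by omega) ?_
      simp only [distToTest]; push_cast; linarith
    | askFirst =>
      have := hcast hb.2
      refine keyAsk (by simp) (by simp) rfl hb.2 ?_ ?_ <;> rintro ⟨_ | x, d⟩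
      · exact hb.2
      · exact hb
      · simp only [distToTest, Option.elim]; linarith
      · simp only [distToTest, Option.elim]; linarith
    | askNext l x acc =>
      refine keyAsk (by simp) (by simp) rfl hb.2 (fun _ => hb) fun _ => ?_
      simp only [distToTest]; linarith
    | consume l x z acc =>
      have hp := hcast hb.2
      by_cases hx : x.1 = some M.reject
      · exact hreject hb.2 (Or.inl hx)
      rcases markedTape_cases w hb.1 hb.2 with ⟨h, a, ha⟩ | ⟨h, hr⟩ <;> rcases z with _ | z
      · exact hreject hb.2 (Or.inr (Or.inr ⟨⟨a, ha⟩, rfl⟩))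
      · refine key (next_consume_letter v hx ha) (by simp) (by simp) rfl rfl ⟨by omega, by omega⟩
          (by omega) ?_
        simp only [distToTest]; push_cast; linarith
      · refine key (next_consume_end v hx hr) (by simp) (by simp) rfl rfl h (by omega) ?_
        simp only [distToTest]; linarith
      · refine key (next_consume_right v hx hr) (by simp) (by simp) rfl rfl hb.2 hb.2 ?_
        have : (p : ℝ) = w.length + 1 := by exact_mod_cast h
        simp only [distToTest]; linarith
    | askDigit l x acc =>
      refine keyAsk (by simp) (by simp) rfl hb (fun _ => hb) fun _ => ?_
      simp only [distToTest]; linarith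
    | digit l x acc d =>
      rcases p with _ | p
      · refine key (next_digit_left v) (by simp) (by simp) rfl rfl rfl (by omega) ?_
        simp only [distToTest]; push_cast; linarith
      · have hp : p ≤ w.length := Nat.le_of_succ_le_succ hb
        refine key (next_digit v hp) (by simp) (by simp) rfl rfl (hp.trans (Nat.le_succ _))
          (by omega) ?_
        simp only [distToTest]; push_cast; linarith
    | checkStart l x acc =>
      obtain rfl : p = 0 := hb
      refine key (next_checkStart v) (by simp) (by simp) rfl rfl ⟨by omega, by simp⟩ (by omega) ?_
      simp only [distToTest]; push_cast; linarith
    | check l x acc =>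
      rcases Nat.lt_or_ge w.length p with h | h
      · obtain rfl : p = w.length + 1 := by have := hb.1; omega
        refine key (next_check_right v) (by simp) (by simp) rfl rfl ⟨rfl, hb.2⟩ le_rfl ?_
        simp only [distToTest]; push_cast; linarith
      · refine key (next_check v h) (by simp) (by simp) rfl rfl ⟨by omega, ?_⟩ (by omega) ?_
        · have := hb.2
          simp only [Matrix.cons_val] at this ⊢
          rw [this, pow_succ]; ring
        · simp only [distToTest]; push_cast; linarith
    | checkTest l x acc =>
      refine (boundedFor_test hN (by simp) (by simp) rfl rfl hb.2 (next_checkTest v) hb.1.le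
        (ih _ _ _ ⟨by have := hb.1; omega, hb.1.le⟩)).mono ?_ le_rfl
      simp [distToTest]
    | turnBack acc =>
      obtain rfl : p = w.length + 1 := hb
      refine key (next_turnBack v) (by simp) (by simp) rfl rfl ⟨by omega, by simp, by simp⟩
        (by omega) ?_
      simp only [distToTest]; push_cast; linarith
    | walkBack acc =>
      rcases p with _ | p
      · refine key (next_walkBack_left v) (by simp) (by simp) rfl rfl ⟨rfl, hb.2.1, hb.2.2⟩
          (by omega) ?_
        simp only [distToTest]; push_cast; linarith
      · have hp : p ≤ w.length := Nat.le_of_succ_le_succ hb.1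
        have he : w.length + 1 - p = (w.length + 1 - (p + 1)) + 1 := by omega
        refine key (next_walkBack v hp) (by simp) (by simp) rfl rfl
          ⟨by omega, ?_, ?_⟩ (by omega) ?_
        · have := hb.2.1
          simp only [Matrix.cons_val] at this ⊢
          rw [this, he, pow_succ]; ring
        · have := hb.2.2
          simp only [Matrix.cons_val] at this ⊢
          rw [this, he, pow_succ]; ring
        · simp only [distToTest]; push_cast; linarith
    | testCount acc =>
      refine (boundedFor_test hN (by simp) (by simp) rfl rfl hb.2.1 (next_testCount v)
        (by have := hb.1; omega) (ih _ _ _ ⟨hb.1, hb.2.2⟩)).mono ?_ le_rfl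
      simp [distToTest]
    | testTape acc =>
      refine (boundedFor_test hN (by simp) (by simp) rfl rfl hb.2 (next_testTape v)
        (by have := hb.1; omega) (ih _ _ _ ?_)).mono ?_ le_rfl
      · have := hb.1
        cases acc
        · exact this
        · exact (by omega : p ≤ w.length + 1)
      · simp [distToTest]
    | accept => exact .of_acc rfl le_rfl
    | reject => exact .of_rej rfl

end SingleTapeDTM

/-! ### Tests of correct and of false values -/

namespace SingleTapeDTM

open SweepState RegProgram RegCoeff

variable {α : Type} {M : SingleTapeDTM α} {β N : ℕ} {hβ : 0 < β} {w : List α} {A : ℝ} {Q : Prop}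

lemma controlled_move {q q' : SweepState M.Cell β} {p p' : ℕ} {v v' : Fin 5 → ℚ × ℚ} {T F : ℝ}
    (hnext : (sweepConf M N hβ q p v).next w = sweepConf M N hβ q' p' v') (hacc : q ≠ .accept)
    (hrej : q ≠ .reject) (hask : M.sweepAsk β q = none)
    (hwt : M.sweepWeighted β q (markedTape w p) = none)
    (h : Controlled w A Q (sweepConf M N hβ q' p' v') T F) (hT : 0 ≤ T) (hA : 0 ≤ A) :
    Controlled w A Q (sweepConf M N hβ q p v) (T + 1) F :=
  .move hacc hrej hask hwt (hnext ▸ h) hT hA (by linarith)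

/-- A bound for the expected number of steps from a test that reveals a lie. -/
def lieTime (w : List α) : ℝ := 10 * ((w.length : ℝ) + 1) + 16

lemma lieTime_pos (w : List α) : 0 < lieTime w := by unfold lieTime; positivity

/-- A correct value costs the completeness error only `η`, as `(1 - η)(1 - F) ≥ 1 - (F + η)`. -/
lemma controlled_test {q q' : SweepState M.Cell β} {p p' : ℕ} {v v' : Fin 5 → ℚ × ℚ} {T F : ℝ}
    {r : Fin 5} (hN : 0 < N)
    (hnext : (sweepConf M N hβ q p v).next w = sweepConf M N hβ q' p' v') (hacc : q ≠ .accept)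
    (hrej : q ≠ .reject) (hask : M.sweepAsk β q = none)
    (hwt : M.sweepWeighted β q (markedTape w p) = some r) (hv : v r = (0, alarmRate β N w))
    (h : Controlled w A Q (sweepConf M N hβ q' p' v') T F) (hT : 0 ≤ T) (hA : 0 ≤ A)
    (hF : 0 ≤ F) :
    Controlled w A Q (sweepConf M N hβ q p v) (T + 1) (F + alarmRate β N w) := by
  have h0 := alarmRate_pos hβ hN w
  refine .step hacc hrej hask (hnext ▸ h) hT hA (by linarith) fun _ => ?_
  rw [sweepConf_pass hwt, hv, passProb_zero h0.le (alarmRate_le_one hβ hN w)]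
  have h1 : (0 : ℝ) < (alarmRate β N w : ℝ) := by exact_mod_cast h0
  push_cast
  nlinarith [mul_nonneg h1.le hF]

/-- The test is survived with probability at most `η`. Afterwards only the worst-case bounds are
available: acceptance at most `1`, hence at most `η` in total, and time `1 + η (5 m + 7 + worstTime)
≤ 10 m + 16`, where `m` is the input length plus one. -/
lemma controlled_lie {q q' : SweepState M.Cell β} {p p' : ℕ} {v v' : Fin 5 → ℚ × ℚ}
    {r : Fin 5} (hN : 0 < N)
    (hnext : (sweepConf M N hβ q p v).next w = sweepConf M N hβ q' p' v') (hacc : q ≠ .accept)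
    (hrej : q ≠ .reject) (hask : M.sweepAsk β q = none)
    (hwt : M.sweepWeighted β q (markedTape w p) = some r) (hr : (v r).2 = alarmRate β N w)
    (hv : 1 ≤ |(v r).1| * alarmRate β N w) (hs : M.Sound N w q' p' v') (hp' : p' ≤ w.length + 1)
    (hA : (alarmRate β N w : ℝ) ≤ A) :
    Controlled w A False (sweepConf M N hβ q p v) (lieTime w) 0 := by
  refine ⟨fun n => ?_, False.elim⟩
  have h0 := alarmRate_pos hβ hN w
  have h0' : (0 : ℝ) < (alarmRate β N w : ℝ) := by exact_mod_cast h0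
  have h1 : (alarmRate β N w : ℝ) ≤ 1 := by exact_mod_cast alarmRate_le_one hβ hN w
  cases n with
  | zero => exact .zero hacc
  | succ n =>
    have hp : ((sweepConf M N hβ q p v).pass w : ℝ) ≤ alarmRate β N w := by
      rw [sweepConf_pass hwt]
      have : passProb (v r) ≤ alarmRate β N w := by
        have := passProb_le_of_large (v := (v r).1) h0 (alarmRate_le_one hβ hN w) hv
        rwa [← hr] at this ⊢
      exact_mod_cast this
    have hp0 : (0 : ℝ) ≤ ((sweepConf M N hβ q p v).pass w : ℝ) := by
      exact_mod_cast (sweepConf M N hβ q p v).pass_nonneg w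
    have hB := alarmRate_mul_worstTime hβ hN w
    have hB0 := worstTime_nonneg hβ hN w
    have hpos' : (p' : ℝ) ≤ (w.length : ℝ) + 1 := by exact_mod_cast hp'
    have hd := distToTest_le (Nat.cast_nonneg p') hpos' q'
    have hd0 := distToTest_nonneg (Nat.cast_nonneg p') hpos' q'
    refine .step hacc hrej hask (hnext ▸ boundedFor_of_sound hN w n q' p' v' hs) (by linarith) ?_
      (by linarith)
    have h2 := mul_le_mul_of_nonneg_right hp (add_nonneg hd0 hB0)
    have h3 := mul_le_mul_of_nonneg_right h1 hd0
    unfold lieTime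
    nlinarith

/-- Once a lie has been told, a step that may reject for other reasons can only improve the bounds
on time and acceptance, and no success is claimed. -/
lemma controlled_any {q q' : SweepState M.Cell β} {p p' : ℕ} {v v' : Fin 5 → ℚ × ℚ} {T F : ℝ}
    (hnext : (sweepConf M N hβ q p v).next w = sweepConf M N hβ q' p' v') (hacc : q ≠ .accept)
    (hrej : q ≠ .reject) (hask : M.sweepAsk β q = none)
    (h : Controlled w A False (sweepConf M N hβ q' p' v') T F) (hT : 0 ≤ T) (hA : 0 ≤ A) :
    Controlled w A False (sweepConf M N hβ q p v) (T + 1) F :=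
  .step hacc hrej hask (hnext ▸ h) hT hA (by linarith) False.elim

lemma controlled_walkBack {acc : Bool} {a b c d e : ℚ × ℚ} {T F : ℝ} (hT : 0 ≤ T) (hA : 0 ≤ A)
    (p : ℕ) (hp : p ≤ w.length + 1)
    (h : Controlled w A Q (sweepConf M N hβ (testCount acc) 0
      ![((β : ℚ) ^ p * a.1, (β : ℚ)⁻¹ ^ p * a.2), b, ((β : ℚ) ^ p * c.1, (β : ℚ)⁻¹ ^ p * c.2),
        d, e]) T F) :
    Controlled w A Q (sweepConf M N hβ (walkBack acc) p ![a, b, c, d, e]) (T + p + 1) F := by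
  induction p generalizing a c with
  | zero =>
    have h' := controlled_move (next_walkBack_left _) (by simp) (by simp) rfl rfl h hT hA
    simpa using h'
  | succ p ih =>
    have h' := controlled_move (w := w) (next_walkBack ![a, b, c, d, e] (by omega)) (by simp)
      (by simp) rfl rfl (ih (a := ((β : ℚ) * a.1, (β : ℚ)⁻¹ * a.2))
        (c := ((β : ℚ) * c.1, (β : ℚ)⁻¹ * c.2)) (by omega) ?_) (by positivity) hA
    · refine h'.mono ?_ le_rfl le_rfl
      push_cast; linarith
    · convert h using 4 <;> simp only [pow_succ] <;> ring_nf

/-- The value in a test register after the amplification. -/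
lemma controlled_turnBack {acc : Bool} {a b c d e : ℚ × ℚ} {T F : ℝ} (hT : 0 ≤ T) (hA : 0 ≤ A)
    (h : Controlled w A Q (sweepConf M N hβ (testCount acc) 0
      ![((β : ℚ) ^ (w.length + 1) * (N * a.1), alarmRate β N w), b,
        ((β : ℚ) ^ (w.length + 1) * (N * c.1), alarmRate β N w), d, e]) T F) :
    Controlled w A Q (sweepConf M N hβ (turnBack acc) (w.length + 1) ![a, b, c, d, e])
      (T + w.length + 3) F := by
  have h1 := controlled_walkBack (hβ := hβ) (acc := acc) (b := b) (d := d) (e := e) (F := F) (Q := Q)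
    (a := (N * a.1, (N : ℚ)⁻¹)) (c := (N * c.1, (N : ℚ)⁻¹)) hT hA
    (w.length + 1) le_rfl (by simpa only [alarmRate, mul_comm (N : ℚ)⁻¹] using h)
  refine (controlled_move (next_turnBack ![a, b, c, d, e]) (by simp) (by simp) rfl rfl h1
    (by positivity) hA).mono ?_ le_rfl le_rfl
  push_cast; linarith

/-- Zero stays zero under amplification, so both final tests of a sweep have correct values; they
add `2 η` to the error. -/
lemma controlled_turnBack_honest {acc : Bool} {b d e : ℚ × ℚ} {y y' : ℚ} {T F : ℝ} (hN : 0 < N)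
    (hT : 0 ≤ T) (hA : 0 ≤ A) (hF : 0 ≤ F)
    (h : Controlled w A Q (sweepConf M N hβ (if acc then .accept else sweepStart) 0
      ![b, (0, 0), e, d, (0, 0)]) T F) :
    Controlled w A Q (sweepConf M N hβ (turnBack acc) (w.length + 1)
      ![(0, y), b, (0, y'), d, e]) (T + w.length + 5) (F + 2 * alarmRate β N w) := by
  have h0 : (0 : ℝ) < (alarmRate β N w : ℝ) := by exact_mod_cast alarmRate_pos hβ hN w
  have h1 := controlled_test (v := ![(0, alarmRate β N w), b, (0, 0), d, e]) (p := 0)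
    (q := testTape acc) hN (next_testTape _) (by simp) (by simp) rfl rfl rfl h hT hA hF
  have h2 := controlled_test (v := ![(0, alarmRate β N w), b, (0, alarmRate β N w), d, e])
    (p := 0) (q := testCount acc) hN (next_testCount _) (by simp) (by simp) rfl rfl rfl h1
    (by linarith) hA (by linarith)
  refine (controlled_turnBack (T := T + 1 + 1)
    (F := F + alarmRate β N w + alarmRate β N w) (by linarith) hA
    (by simpa using h2)).mono ?_ le_rfl ?_ <;> linarith

/-- The amplification factor is exactly `1/η`. -/
lemma one_le_amplified (hβ : 0 < β) (hN : 0 < N) {x : ℚ} (hx : 1 ≤ |x|) :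
    1 ≤ |(β : ℚ) ^ (w.length + 1) * (N * x)| * alarmRate β N w := by
  have h1 : (0 : ℚ) < β := by exact_mod_cast hβ
  have h2 : (0 : ℚ) < N := by exact_mod_cast hN
  rw [abs_mul, abs_mul, abs_of_pos h2, abs_of_pos (pow_pos h1 _), alarmRate, inv_pow]
  field_simp
  exact hx

lemma controlled_turnBack_lie {acc : Bool} {a b c d e : ℚ × ℚ} (hN : 0 < N)
    (hA : (alarmRate β N w : ℝ) ≤ A) (h : 1 ≤ |a.1| ∨ 1 ≤ |c.1|) :
    Controlled w A False (sweepConf M N hβ (turnBack acc) (w.length + 1) ![a, b, c, d, e])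
      (lieTime w + w.length + 4) 0 := by
  have h0 : (0 : ℝ) < (alarmRate β N w : ℝ) := by exact_mod_cast alarmRate_pos hβ hN w
  have hA0 : 0 ≤ A := h0.le.trans hA
  have hl := lieTime_pos w
  -- The count is tested before the tape. If the count is small, its test is treated as an arbitrary
  -- step and the tape test reveals the lie.
  by_cases hc : 1 ≤ |c.1|
  · refine (controlled_turnBack hl.le hA0 (controlled_lie hN (next_testCount _) (by simp) (by simp)
      rfl rfl rfl (one_le_amplified hβ hN hc) ⟨rfl, rfl⟩ (by omega) hA)).mono ?_ le_rfl le_rfl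
    linarith
  · have ha := h.resolve_right hc
    refine (controlled_turnBack (T := lieTime w + 1) (by linarith) hA0 ?_).mono
      (by linarith) le_rfl le_rfl
    exact controlled_any (next_testCount _) (by simp) (by simp) rfl (controlled_lie hN
      (next_testTape _) (by simp) (by simp) rfl rfl rfl (one_le_amplified hβ hN ha)
      (by cases acc <;> simp [Sound]) (by omega) hA) hl.le hA0

/-! #### The countdown -/

lemma controlled_check {l : Option M.Cell} {x : M.Cell} {acc : Bool} {a b c d e : ℚ × ℚ} {T F : ℝ}
    (hT : 0 ≤ T) (hA : 0 ≤ A) (k : ℕ) (hk : k ≤ w.length + 1)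
    (h : Controlled w A Q (sweepConf M N hβ (checkTest l x acc) (w.length + 1)
      ![a, b, ((β : ℚ) ^ k * c.1, (β : ℚ)⁻¹ ^ k * c.2), d, e]) T F) :
    Controlled w A Q (sweepConf M N hβ (check l x acc) (w.length + 1 - k) ![a, b, c, d, e])
      (T + k + 1) F := by
  induction k generalizing c with
  | zero =>
    have h' := controlled_move (next_check_right _) (by simp) (by simp) rfl rfl h hT hA
    simpa using h'
  | succ k ih =>
    have he : w.length + 1 - (k + 1) + 1 = w.length + 1 - k := by omega
    have h1 := ih (c := ((β : ℚ) * c.1, (β : ℚ)⁻¹ * c.2)) (by omega) (by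
      convert h using 4; simp only [pow_succ]; ring_nf)
    rw [← he] at h1
    refine (controlled_move (next_check ![a, b, c, d, e] (by omega)) (by simp) (by simp) rfl rfl h1
      (by positivity) hA).mono ?_ le_rfl le_rfl
    push_cast; linarith

/-- Each digit enters two Horner schemes with the same current value `h`, so comparison value and
retained copy agree whatever the prover sends. The time bound is needed for all values that the
digits can form, success for just one of them. `Q` is quantified inside because replies other than
the honest one are handled with `False`. -/
lemma controlled_digits {l : Option M.Cell} {x : M.Cell} {acc : Bool} {a b e : ℚ × ℚ} {D : ℚ}
    {T F : ℝ} (hT : 0 ≤ T) (hA : 0 ≤ A) (p : ℕ) : ∀ (Q : Prop) (h : ℕ), p ≤ w.length + 1 →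
    (∀ r < β ^ (p + 1), Controlled w A False (sweepConf M N hβ (checkStart l x acc) 0
      ![a, b, (D, ((h * β ^ (p + 1) + r : ℕ) : ℚ)), (((h * β ^ (p + 1) + r : ℕ) : ℚ), 0), e])
        T 0) →
    (Q → ∃ r < β ^ (p + 1), Attains w (sweepConf M N hβ (checkStart l x acc) 0
      ![a, b, (D, ((h * β ^ (p + 1) + r : ℕ) : ℚ)), (((h * β ^ (p + 1) + r : ℕ) : ℚ), 0), e])
        F) →
    Controlled w A Q (sweepConf M N hβ (askDigit l x acc) p
      ![a, b, (D, (h : ℚ)), ((h : ℚ), 0), e]) (T + 2 * p + 2) F := by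
  induction p with
  | zero =>
    intro Q h _ h1 h2
    have key : ∀ (Q : Prop) (d : Fin β), Controlled w A Q (sweepConf M N hβ (checkStart l x acc) 0
        ![a, b, (D, ((h * β ^ (0 + 1) + d : ℕ) : ℚ)), (((h * β ^ (0 + 1) + d : ℕ) : ℚ), 0), e])
        T F → Controlled w A Q (sweepConf M N hβ (digit l x acc d) 0
          ![a, b, (D, (h : ℚ)), ((h : ℚ), 0), e]) (T + 1) F := by
      intro Q d hd
      refine controlled_move (next_digit_left _) (by simp) (by simp) rfl rfl ?_ hT hA
      convert hd using 4 <;> simp [mul_comm]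
    refine .comm (T := T + 1) (by simp [sweepConf, sweepProgram])
      (by simp [sweepConf, sweepProgram]) rfl ?_ (by linarith) (by push_cast; linarith) ?_
    · rintro ⟨z, d⟩ n
      exact (key False d ⟨(h1 d (by simp)).bounded, False.elim⟩).bounded n
    · intro hQ
      obtain ⟨r, hr, hat⟩ := h2 hQ
      rw [zero_add, pow_one] at hr
      exact ⟨(none, ⟨r, hr⟩), (key True ⟨r, hr⟩ ⟨(h1 r (by simpa using hr)).bounded,
        fun _ => hat⟩).attains trivial⟩
  | succ p ih =>
    intro Q h hp h1 h2
    have hval : ∀ d r : ℕ, (β * h + d) * β ^ (p + 1) + r =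
        h * β ^ (p + 1 + 1) + (d * β ^ (p + 1) + r) := by
      intro d r; ring
    have hlt : ∀ (d : Fin β) (r : ℕ), r < β ^ (p + 1) →
        (d : ℕ) * β ^ (p + 1) + r < β ^ (p + 1 + 1) := by
      intro d r hr
      calc (d : ℕ) * β ^ (p + 1) + r < d * β ^ (p + 1) + β ^ (p + 1) := by omega
        _ = (d + 1) * β ^ (p + 1) := by ring
        _ ≤ β * β ^ (p + 1) := Nat.mul_le_mul_right _ d.2
        _ = _ := by ring
    have key : ∀ (Q : Prop) (d : Fin β), (Q → ∃ r < β ^ (p + 1),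
        Attains w (sweepConf M N hβ (checkStart l x acc) 0
          ![a, b, (D, ((h * β ^ (p + 1 + 1) + (d * β ^ (p + 1) + r) : ℕ) : ℚ)),
            (((h * β ^ (p + 1 + 1) + (d * β ^ (p + 1) + r) : ℕ) : ℚ), 0), e]) F) →
        Controlled w A Q (sweepConf M N hβ (digit l x acc d) (p + 1)
          ![a, b, (D, (h : ℚ)), ((h : ℚ), 0), e]) (T + 2 * p + 2 + 1) F := by
      intro Q d hd
      refine controlled_move (next_digit _ (by omega)) (by simp) (by simp) rfl rfl ?_
        (by positivity) hA
      have := ih Q (β * h + d) (by omega) (fun r hr => hval d r ▸ h1 _ (hlt d r hr)) (by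
        simpa only [hval] using hd)
      push_cast at this
      exact this
    refine .comm (T := T + 2 * p + 2 + 1) (by simp [sweepConf, sweepProgram])
      (by simp [sweepConf, sweepProgram]) rfl ?_ (by positivity) (by push_cast; linarith) ?_
    · rintro ⟨z, d⟩ n
      exact (key False d False.elim).bounded n
    · intro hQ
      obtain ⟨r, hr, hat⟩ := h2 hQ
      -- The honest reply is the leading digit of `r`; the remainder is left to the induction
      -- hypothesis.
      have hd : r / β ^ (p + 1) < β :=
        Nat.div_lt_of_lt_mul (by rwa [pow_succ] at hr)
      refine ⟨(none, ⟨r / β ^ (p + 1), hd⟩), (key True ⟨_, hd⟩ fun _ =>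
        ⟨r % β ^ (p + 1), Nat.mod_lt _ (by positivity), ?_⟩).attains trivial⟩
      have : r / β ^ (p + 1) * β ^ (p + 1) + r % β ^ (p + 1) = r := Nat.div_add_mod' _ _
      simpa only [this] using hat

/-- The processing of the announcement that there is a further cell beyond the input. -/
lemma controlled_askDigit {l : Option M.Cell} {x : M.Cell} {acc : Bool} {a b e : ℚ × ℚ} {D : ℕ}
    {T F : ℝ} (hN : 0 < N) (hT : lieTime w ≤ T) (hA : (alarmRate β N w : ℝ) ≤ A) (hF : 0 ≤ F)
    (h : 1 ≤ D → Controlled w A Q (sweepConf M N hβ (askNext l x acc) (w.length + 1)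
      ![a, b, (((D - 1 : ℕ) : ℚ), 0), (0, 0), e]) T F)
    (hQ : Q → 1 ≤ D ∧ D ≤ β ^ (w.length + 1)) :
    Controlled w A Q (sweepConf M N hβ (askDigit l x acc) (w.length + 1)
      ![a, b, ((D : ℚ), 0), (0, 0), e]) (T + 3 * w.length + 8) (F + alarmRate β N w) := by
  have h0 : (0 : ℝ) < (alarmRate β N w : ℝ) := by exact_mod_cast alarmRate_pos hβ hN w
  have hA0 : 0 ≤ A := h0.le.trans hA
  have hT0 : 0 ≤ T := (lieTime_pos w).le.trans hT
  have walk : ∀ (Q : Prop) (F : ℝ) (c d : ℚ × ℚ),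
      Controlled w A Q (sweepConf M N hβ (checkTest l x acc) (w.length + 1)
        ![a, b, ((β : ℚ) ^ (w.length + 1) * (N * (c.1 - c.2 - 1)), alarmRate β N w), d, e])
        (T + 1) F →
      Controlled w A Q (sweepConf M N hβ (checkStart l x acc) 0 ![a, b, c, d, e])
        (T + w.length + 4) F := by
    intro Q F c d hh
    have h1 := controlled_check (hβ := hβ) (w := w) (a := a) (b := b) (d := d) (e := e) (l := l)
      (x := x) (acc := acc) (F := F) (Q := Q)
      (c := (N * (c.1 - c.2 - 1), (N : ℚ)⁻¹)) (by linarith : 0 ≤ T + 1) hA0 (w.length + 1) le_rfl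
      (by simpa only [alarmRate, mul_comm (N : ℚ)⁻¹] using hh)
    rw [Nat.sub_self] at h1
    refine (controlled_move (next_checkStart _) (by simp) (by simp) rfl rfl h1 (by positivity)
      hA0).mono ?_ le_rfl le_rfl
    push_cast; linarith
  have honest : 1 ≤ D → ∀ Q' : Prop, (Q' → Q) →
      Controlled w A Q' (sweepConf M N hβ (checkStart l x acc) 0
        ![a, b, ((D : ℚ), ((D - 1 : ℕ) : ℚ)), (((D - 1 : ℕ) : ℚ), 0), e]) (T + w.length + 4)
        (F + alarmRate β N w) := by
    intro hD Q' hQ'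
    have hz : ((D : ℚ) - ((D - 1 : ℕ) : ℚ) - 1) = 0 := by
      rw [Nat.cast_sub hD]; push_cast; ring
    have h' : Controlled w A Q' (sweepConf M N hβ (askNext l x acc) (w.length + 1)
      ![a, b, (((D - 1 : ℕ) : ℚ), 0), (0, 0), e]) T F := ⟨(h hD).bounded, fun q =>
        (h hD).attains (hQ' q)⟩
    exact walk _ _ _ _ (controlled_test hN (next_checkTest _) (by simp) (by simp) rfl rfl
      (by simp [hz]) h' hT0 hA0 hF)
  have all : ∀ D' : ℕ, Controlled w A False (sweepConf M N hβ (checkStart l x acc) 0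
      ![a, b, ((D : ℚ), (D' : ℚ)), ((D' : ℚ), 0), e]) (T + w.length + 4) 0 := by
    intro D'
    by_cases hD : D = D' + 1
    · subst hD
      exact ⟨(honest (by omega) False False.elim).bounded, False.elim⟩
    -- Computed in `ℤ`, so that `D = 0` is covered: then every announced `D'` is wrong, and an extra
    -- cell cannot be claimed safely.
    · have h1 : ((D : ℤ) - D' - 1) ≠ 0 := by omega
      have h2 : 1 ≤ |(D : ℚ) - D' - 1| := by exact_mod_cast Int.one_le_abs h1
      refine walk False 0 ((D : ℚ), (D' : ℚ)) ((D' : ℚ), 0) ?_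
      have h3 := controlled_lie (hβ := hβ) (r := 2) hN (next_checkTest (w := w) (M := M) (l := l)
        (x := x) (acc := acc) (p := w.length + 1) ![a, b, ((β : ℚ) ^ (w.length + 1) *
          (N * ((D : ℚ) - D' - 1)), alarmRate β N w), ((D' : ℚ), 0), e]) (by simp) (by simp)
        rfl rfl rfl (one_le_amplified hβ hN h2) ⟨by omega, le_rfl⟩ le_rfl hA
      exact h3.mono (by linarith) le_rfl le_rfl
  have hQ' : Q → ∃ r < β ^ (w.length + 1 + 1), Attains w (sweepConf M N hβ (checkStart l x acc) 0
      ![a, b, ((D : ℚ), ((0 * β ^ (w.length + 1 + 1) + r : ℕ) : ℚ)),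
        (((0 * β ^ (w.length + 1 + 1) + r : ℕ) : ℚ), 0), e]) (F + alarmRate β N w) := by
    intro q
    obtain ⟨h1, h2⟩ := hQ q
    -- A digit is sent in each of the `w.length + 2` cells of the input tape, end-markers included,
    -- which leaves room to spare.
    refine ⟨D - 1, ?_, ?_⟩
    · calc D - 1 < D := by omega
        _ ≤ β ^ (w.length + 1) := h2
        _ ≤ _ := Nat.pow_le_pow_right hβ (by omega)
    · have h3 := (honest h1 Q id).attains q
      rw [zero_mul, zero_add]
      exact h3
  have hall : ∀ r < β ^ (w.length + 1 + 1), Controlled w A False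
      (sweepConf M N hβ (checkStart l x acc) 0
      ![a, b, ((D : ℚ), ((0 * β ^ (w.length + 1 + 1) + r : ℕ) : ℚ)),
        (((0 * β ^ (w.length + 1 + 1) + r : ℕ) : ℚ), 0), e]) (T + w.length + 4) 0 :=
    fun r _ => all (0 * β ^ (w.length + 1 + 1) + r)
  have hfin := controlled_digits (add_nonneg (add_nonneg hT0 (Nat.cast_nonneg _)) (by norm_num))
    hA0 (w.length + 1) Q 0 le_rfl hall hQ'
  rw [Nat.cast_zero] at hfin
  refine hfin.mono ?_ le_rfl le_rfl
  push_cast; linarith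

end SingleTapeDTM

/-! ### Base expansions of tapes, and sweeps after a false announcement -/

namespace SingleTapeDTM

open SweepState RegProgram RegCoeff

variable {α : Type} (M : SingleTapeDTM α)

/-- The base `cellBase` expansion with the codes of `f 0, …, f (k - 1)`, beginning at position
`j`. -/
noncomputable def cellSum (f : ℕ → M.Cell) (j k : ℕ) : ℚ :=
  ∑ i ∈ Finset.range k, (M.cellCode (f i) : ℚ) * (M.cellBase : ℚ) ^ (j + i)

variable {M}

lemma cellSum_succ' (f : ℕ → M.Cell) (j k : ℕ) : M.cellSum f j (k + 1) =
    M.cellCode (f 0) * (M.cellBase : ℚ) ^ j + M.cellSum (fun i => f (i + 1)) (j + 1) k := by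
  unfold cellSum
  rw [Finset.sum_range_succ', add_comm]
  simp only [add_zero, add_assoc, add_comm 1]

lemma cellSum_succ (f : ℕ → M.Cell) (j k : ℕ) : M.cellSum f j (k + 1) =
    M.cellSum f j k + M.cellCode (f k) * (M.cellBase : ℚ) ^ (j + k) := by
  unfold cellSum
  rw [Finset.sum_range_succ]

lemma exists_cellSum_eq (f : ℕ → M.Cell) (j k : ℕ) :
    ∃ K : ℤ, M.cellSum f j k = (M.cellBase : ℚ) ^ j * K := by
  refine ⟨∑ i ∈ Finset.range k, (M.cellCode (f i) : ℤ) * (M.cellBase : ℤ) ^ i, ?_⟩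
  unfold cellSum
  push_cast
  rw [Finset.mul_sum]
  refine Finset.sum_congr rfl fun i _ => ?_
  rw [pow_add]; ring

/-- After division by `cellBase ^ j` the difference is an integer congruent modulo `cellBase` to the
difference of the first two codes. These are distinct and smaller than the base, so the integer is
nonzero, however the later digits are chosen. -/
lemma one_le_abs_cellSum_sub {f g : ℕ → M.Cell} (h : f 0 ≠ g 0) (j k : ℕ) :
    1 ≤ |M.cellSum f j (k + 1) - M.cellSum g j (k + 1)| := by
  rw [cellSum_succ', cellSum_succ']
  obtain ⟨K, hK⟩ := exists_cellSum_eq (fun i => f (i + 1)) (j + 1) k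
  obtain ⟨K', hK'⟩ := exists_cellSum_eq (fun i => g (i + 1)) (j + 1) k
  rw [hK, hK']
  have hb : (1 : ℚ) ≤ M.cellBase := by exact_mod_cast M.cellBase_pos
  have he : (M.cellCode (f 0) : ℚ) * (M.cellBase : ℚ) ^ j + (M.cellBase : ℚ) ^ (j + 1) * K -
      (M.cellCode (g 0) * (M.cellBase : ℚ) ^ j + (M.cellBase : ℚ) ^ (j + 1) * K') =
      (M.cellBase : ℚ) ^ j *
        (((M.cellCode (f 0) : ℤ) - M.cellCode (g 0) + M.cellBase * (K - K') : ℤ) : ℚ) := by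
    push_cast; ring
  rw [he, abs_mul, abs_of_nonneg (by positivity)]
  have hne : ((M.cellCode (f 0) : ℤ) - M.cellCode (g 0) + M.cellBase * (K - K')) ≠ 0 := by
    intro h0
    have h1 := M.cellCode_lt (f 0)
    have h2 := M.cellCode_lt (g 0)
    have h3 : (M.cellBase : ℤ) ∣ (M.cellCode (f 0) : ℤ) - M.cellCode (g 0) :=
      ⟨-(K - K'), by linarith⟩
    have h4 := Int.eq_zero_of_abs_lt_dvd h3 (by rw [abs_lt]; constructor <;> omega)
    exact h (M.cellCode_injective (by omega))
  have h1 : (1 : ℚ) ≤ |(((M.cellCode (f 0) : ℤ) - M.cellCode (g 0) +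
      M.cellBase * (K - K') : ℤ) : ℚ)| := by exact_mod_cast Int.one_le_abs hne
  exact one_le_mul_of_one_le_of_one_le (one_le_pow₀ hb) h1

variable (M) in
/-- No continuation of the expansion by `k` cells gives `u`. -/
def Unreachable (j k : ℕ) (u : ℚ) : Prop := ∀ f : ℕ → M.Cell, 1 ≤ |u - M.cellSum f j k|

/-- A completion after the announcement of `x` is a completion from before with `x` put in front. -/
lemma Unreachable.succ {j k : ℕ} {u : ℚ} (h : M.Unreachable j (k + 1) u) (x : M.Cell) :
    M.Unreachable (j + 1) k (u - M.cellCode x * (M.cellBase : ℚ) ^ j) := by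
  intro f
  have := h fun i => i.casesOn x f
  rw [cellSum_succ'] at this
  rwa [sub_sub]

lemma Unreachable.one_le_abs {j : ℕ} {u : ℚ} (h : M.Unreachable j 0 u) : 1 ≤ |u| := by
  simpa [cellSum] using h fun _ => M.blankCell

/-- The first wrong cell is irreparable: it already decides the lowest remaining digit. -/
lemma unreachable_of_ne {f : ℕ → M.Cell} {x : M.Cell} (h : x ≠ f 0) (j k : ℕ) :
    M.Unreachable (j + 1) k
      (M.cellSum f j (k + 1) - M.cellCode x * (M.cellBase : ℚ) ^ j) := by
  intro g
  have := one_le_abs_cellSum_sub (f := f) (g := fun i => i.casesOn x g) (Ne.symm h) j k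
  rw [cellSum_succ' (fun i => i.casesOn x g)] at this
  rwa [sub_sub]

variable (M) in
/-- The announcement `z` of the next cell, after cell `j`, leads to a failing test. -/
def FalseAnnouncement (j k : ℕ) (u : ℚ) : Option M.Cell → Prop
  | none => 1 ≤ k ∨ 1 ≤ |u|
  | some z => k = 0 ∨
      M.Unreachable (j + 2) (k - 1) (u - M.cellCode z * (M.cellBase : ℚ) ^ (j + 1))

/-- Once the remainder is unreachable, every further announcement is doomed: ending too early or too
late violates the count, and ending on time leaves a nonzero remainder. -/
lemma Unreachable.falseAnnouncement {j k : ℕ} {u : ℚ} (h : M.Unreachable (j + 1) k u)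
    (z : Option M.Cell) : M.FalseAnnouncement j k u z := by
  cases k with
  | zero =>
    cases z with
    | none => exact Or.inr h.one_le_abs
    | some z => exact Or.inl rfl
  | succ k =>
    cases z with
    | none => exact Or.inl (by omega)
    | some z => exact Or.inr (h.succ z)

/-- A bound for the number of steps until the end of a sweep when `k` cells are to come. -/
noncomputable def sweepTime (w : List α) (E k : ℕ) : ℝ :=
  2 * k + 1 + (3 * w.length + 10) * (min E k : ℕ)

lemma sweepTime_nonneg (w : List α) (E k : ℕ) : 0 ≤ sweepTime w E k := by
  unfold sweepTime; positivity

lemma sweepTime_mono (w : List α) (E k : ℕ) : sweepTime w E k + 2 ≤ sweepTime w E (k + 1) := by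
  have : ((min E k : ℕ) : ℝ) ≤ (min E (k + 1) : ℕ) := by
    exact_mod_cast min_le_min le_rfl (Nat.le_succ k)
  unfold sweepTime
  push_cast at this ⊢
  nlinarith [(Nat.cast_nonneg w.length : (0 : ℝ) ≤ w.length)]

lemma sweepTime_succ_of_lt (w : List α) {E k : ℕ} (h : k < E) :
    sweepTime w E k + 3 * w.length + 12 ≤ sweepTime w E (k + 1) := by
  unfold sweepTime
  rw [min_eq_right h.le, min_eq_right h]
  push_cast
  linarith

variable {β N : ℕ} {hβ : 0 < β} {w : List α} {A : ℝ} {Q : Prop}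

lemma controlled_consume_reject {p : ℕ} {l : Option M.Cell} {x : M.Cell} {z : Option M.Cell}
    {acc : Bool} {v : Fin 5 → ℚ × ℚ} {T F : ℝ} (hx : x.1 = some M.reject ∨
      markedTape w p = .leftEnd ∨ (∃ a, markedTape w p = .letter a) ∧ z = none)
    (hT : 1 ≤ T) (hA : 0 ≤ A) (hQ : ¬ Q) :
    Controlled w A Q (sweepConf M N hβ (consume l x z acc) p v) T F :=
  .move (T := 0) (by simp [sweepConf, sweepProgram]) (by simp [sweepConf, sweepProgram])
    rfl rfl (.of_rej (next_consume_reject v hx) hQ) le_rfl hA (by linarith)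

/-- The lie about the tape is tested only at the end of the sweep, so the sweep must be shown to
end. The true count, still in register 2, limits it: a prover that deviates from the count is caught
by that test, otherwise `k` decreases and falseness is inherited. -/
lemma controlled_consume_false (hN : 0 < N) (hA : (alarmRate β N w : ℝ) ≤ A) {E : ℕ} {T : ℝ}
    (hT : lieTime w + 3 * w.length + 8 ≤ T) (k : ℕ) : ∀ (j : ℕ) (l : Option M.Cell) (x : M.Cell)
    (z : Option M.Cell) (acc : Bool) (v : ℚ) (y e : ℚ × ℚ), j + k = w.length + E →
    M.FalseAnnouncement j k (v - M.cellCode x * (M.cellBase : ℚ) ^ j) z →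
    Controlled w A False (sweepConf M N hβ (consume l x z acc) (min j w.length + 1)
      ![(v, (M.cellBase : ℚ) ^ j), y, (((min E k : ℕ) : ℚ), 0), (0, 0), e])
      (T + sweepTime w E k) 0 := by
  have hl := lieTime_pos w
  have hn : (0 : ℝ) ≤ w.length := Nat.cast_nonneg _
  have h0 : (0 : ℝ) < (alarmRate β N w : ℝ) := by exact_mod_cast alarmRate_pos hβ hN w
  have hA0 : 0 ≤ A := h0.le.trans hA
  induction k with
  | zero =>
    intro j l x z acc v y e hjk hz
    have hs : (1 : ℝ) ≤ sweepTime w E 0 := by unfold sweepTime; simp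
    by_cases hx : x.1 = some M.reject
    · exact controlled_consume_reject (Or.inl hx) (by linarith) hA0 id
    rw [min_eq_right (by omega : w.length ≤ j)]
    cases z with
    | none =>
      have h1 := controlled_move (v := ![(v, (M.cellBase : ℚ) ^ j), y,
        (((min E 0 : ℕ) : ℚ), 0), (0, 0), e]) (next_consume_end (M := M) (N := N) (hβ := hβ)
        (l := l) (acc := acc) _ hx (markedTape_right w)) (by simp) (by simp) rfl rfl
        (controlled_turnBack_lie hN hA (Or.inl ?_)) (by positivity) hA0
      · exact h1.mono (by linarith) le_rfl le_rfl
      · have := hz.resolve_left (by omega)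
        simp only [push_apply, Matrix.cons_val]
        rwa [neg_mul, ← sub_eq_add_neg]
    | some z =>
      -- A cell too many: the count is `0` and cannot be decremented, so the honest branch of
      -- `controlled_askDigit` is vacuous.
      have h1 := controlled_move (v := ![(v, (M.cellBase : ℚ) ^ j), y,
        (((0 : ℕ) : ℚ), 0), (0, 0), e]) (next_consume_right (M := M) (N := N) (hβ := hβ)
        (l := l) (z := z) (acc := acc) _ hx (markedTape_right w)) (by simp) (by simp) rfl rfl
        (controlled_askDigit (Q := False) (T := lieTime w) (F := 0) hN le_rfl hA le_rfl
          (by omega) False.elim) (by positivity) hA0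
      rw [Nat.min_zero]
      exact ⟨fun n => (h1.bounded n).mono (by linarith) le_rfl, False.elim⟩
  | succ k ih =>
    intro j l x z acc v y e hjk hz
    have hs := sweepTime_mono w E k
    have hs0 := sweepTime_nonneg w E k
    by_cases hx : x.1 = some M.reject
    · exact controlled_consume_reject (Or.inl hx) (by linarith) hA0 id
    have hpush : ∀ v : ℚ, (push M.cellBase (-M.cellCode x)).apply (v, (M.cellBase : ℚ) ^ j) =
        (v - M.cellCode x * (M.cellBase : ℚ) ^ j, (M.cellBase : ℚ) ^ (j + 1)) := by
      intro v
      rw [push_apply, pow_succ', neg_mul, ← sub_eq_add_neg]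
    have next : ∀ (z : M.Cell) (acc : Bool) (y e : ℚ × ℚ), M.FalseAnnouncement j (k + 1)
        (v - M.cellCode x * (M.cellBase : ℚ) ^ j) (some z) →
        Controlled w A False (sweepConf M N hβ (askNext (some x) z acc)
          (min (j + 1) w.length + 1) ![(v - M.cellCode x * (M.cellBase : ℚ) ^ j,
            (M.cellBase : ℚ) ^ (j + 1)), y, (((min E k : ℕ) : ℚ), 0), (0, 0), e])
          (T + sweepTime w E k + 1) 0 := by
      intro z acc y e hz
      refine .comm (T := T + sweepTime w E k) (by simp [sweepConf, sweepProgram])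
        (by simp [sweepConf, sweepProgram]) rfl ?_ (by linarith) (by linarith) False.elim
      rintro ⟨z', d⟩ n
      exact (ih (j + 1) (some x) z z' acc _ y e (by omega)
        ((hz.resolve_left (by omega)).falseAnnouncement z')).bounded n
    rcases Nat.lt_or_ge j w.length with hj | hj
    · rw [min_eq_left hj.le]
      cases z with
      | none =>
        exact controlled_consume_reject (Or.inr (Or.inr ⟨⟨_, markedTape_letter w hj⟩, rfl⟩))
          (by linarith) hA0 id
      | some z =>
        have h1 := next z (flag acc x) ((push M.cellBase (M.cellCode (M.nextCell l x (some z)))).apply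
          y) e hz
        rw [min_eq_left hj, min_eq_left (by omega : E ≤ k)] at h1
        rw [min_eq_left (by omega : E ≤ k + 1)]
        refine (controlled_move (next_consume_letter _ hx (markedTape_letter w hj)) (by simp)
          (by simp) rfl rfl (by simpa only [Matrix.cons_val, hpush] using h1) (by linarith)
          hA0).mono (by linarith) le_rfl le_rfl
    · rw [min_eq_right hj, min_eq_right (by omega : k + 1 ≤ E)]
      cases z with
      | none =>
        -- The end comes too early: the count is still `k + 1` and fails the count test, whatever
        -- register 0 holds.
        refine (controlled_move (next_consume_end _ hx (markedTape_right w)) (by simp) (by simp)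
          rfl rfl (controlled_turnBack_lie hN hA (Or.inr ?_)) (by linarith) hA0).mono
          (by linarith) le_rfl le_rfl
        simp only [Matrix.cons_val]
        rw [Nat.abs_cast]
        push_cast
        linarith [(Nat.cast_nonneg k : (0 : ℚ) ≤ k)]
      | some z =>
        have hs' := sweepTime_succ_of_lt w (by omega : k < E)
        have h1 := next z (flag acc x)
          ((push M.cellBase (M.cellCode (M.nextCell l x (some z)))).apply y) (e.1 + 1, e.2) hz
        rw [min_eq_right (by omega : w.length ≤ j + 1), min_eq_right (by omega : k ≤ E)] at h1
        have h2 := controlled_move (v := ![(v, (M.cellBase : ℚ) ^ j), y,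
          (((k + 1 : ℕ) : ℚ), 0), (0, 0), e]) (next_consume_right (M := M) (N := N) (hβ := hβ)
          (l := l) (z := z) (acc := acc) _ hx (markedTape_right w)) (by simp) (by simp) rfl rfl
          (controlled_askDigit (Q := False) (F := 0) hN
            (by linarith : lieTime w ≤ T + sweepTime w E k + 1) hA le_rfl
            (fun _ => by simpa only [Matrix.cons_val, hpush, Nat.add_sub_cancel] using h1)
            False.elim) (by linarith) hA0
        exact ⟨fun n => (h2.bounded n).mono (by linarith) le_rfl, False.elim⟩

/-! #### Honest sweeps -/

variable (M) in
/-- The cells after one step, for a tape with the cells `0, …, m`. -/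
def nextCells (X : ℕ → M.Cell) (m j : ℕ) : M.Cell :=
  if j ≤ m then
    M.nextCell (if j = 0 then none else some (X (j - 1))) (X j)
      (if j = m then none else some (X (j + 1)))
  else M.nextCell (some (X m)) M.blankCell none

variable (M) in
/-- The acceptance flag when the cells `0, …, j - 1` have been seen. -/
noncomputable def flagBefore (X : ℕ → M.Cell) : ℕ → Bool
  | 0 => false
  | j + 1 => flag (flagBefore X j) (X j)

variable (M) in
/-- The number of cells after one step, for a tape with the cells `0, …, m`. -/
def nextLength (X : ℕ → M.Cell) (m : ℕ) : ℕ := m + 1 + (if M.grows (X m) then 1 else 0)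

/-- Invariant of a truthful sweep at cell `j`: register 0 holds the cells from `j` on, register 1
the successor's cells before `j`, register 2 the cells beyond the input still to come, register 4
those already passed. The next announcement is either the true one, which preserves this, or falls
under `controlled_consume_false`. Each cell beyond the input adds one test to the error. -/
lemma controlled_askNext (hN : 0 < N) (hA : (alarmRate β N w : ℝ) ≤ A) {E : ℕ} {T F : ℝ}
    (hT : lieTime w + 3 * w.length + 8 ≤ T) (hF : 0 ≤ F) (X : ℕ → M.Cell)
    (hQ : ∀ j ≤ w.length + E, (X j).1 = some M.reject → ¬ Q) (hE : E ≤ β ^ (w.length + 1))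
    (h : (∀ j ≤ w.length + E, (X j).1 ≠ some M.reject) → ∀ y y' : ℚ,
      Controlled w A Q (sweepConf M N hβ (turnBack (M.flagBefore X (w.length + E + 1)))
        (w.length + 1) ![(0, y), (M.cellSum (M.nextCells X (w.length + E)) 0
          (M.nextLength X (w.length + E)), y'), (0, 0), (0, 0),
          (((M.nextLength X (w.length + E) - (w.length + 1) : ℕ) : ℚ), 0)]) T F) (k : ℕ) :
    ∀ j, j + k = w.length + E → (∀ i < j, (X i).1 ≠ some M.reject) →
    Controlled w A Q (sweepConf M N hβ (askNext (if j = 0 then none else some (X (j - 1))) (X j)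
        (M.flagBefore X j)) (min j w.length + 1)
      ![(M.cellSum (fun i => X (j + i)) j (k + 1), (M.cellBase : ℚ) ^ j),
        (M.cellSum (M.nextCells X (w.length + E)) 0 j, (M.cellBase : ℚ) ^ j),
        (((min E k : ℕ) : ℚ), 0), (0, 0), (((j - w.length : ℕ) : ℚ), 0)])
      (T + sweepTime w E k + 1) (F + (min E k : ℕ) * alarmRate β N w) := by
  have hl := lieTime_pos w
  have hn : (0 : ℝ) ≤ w.length := Nat.cast_nonneg _
  have h0 : (0 : ℝ) < (alarmRate β N w : ℝ) := by exact_mod_cast alarmRate_pos hβ hN w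
  have hA0 : 0 ≤ A := h0.le.trans hA
  -- It is enough to treat the honest announcement.
  have start : ∀ (j k : ℕ) (T' F' : ℝ) (l : Option M.Cell) (acc : Bool) (y e : ℚ × ℚ),
      j + k = w.length + E → T + sweepTime w E k ≤ T' → (1 : ℝ) ≤ T' →
      Controlled w A Q (sweepConf M N hβ (consume l (X j)
        (if k = 0 then none else some (X (j + 1))) acc) (min j w.length + 1)
        ![(M.cellSum (fun i => X (j + i)) j (k + 1), (M.cellBase : ℚ) ^ j), y,
          (((min E k : ℕ) : ℚ), 0), (0, 0), e]) T' F' →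
      Controlled w A Q (sweepConf M N hβ (askNext l (X j) acc) (min j w.length + 1)
        ![(M.cellSum (fun i => X (j + i)) j (k + 1), (M.cellBase : ℚ) ^ j), y,
          (((min E k : ℕ) : ℚ), 0), (0, 0), e]) (T' + 1) F' := by
    intro j k T' F' l acc y e hjk hTT' hT' hh
    refine .comm (T := T') (by simp [sweepConf, sweepProgram])
      (by simp [sweepConf, sweepProgram]) rfl ?_ (by linarith) (by linarith)
      fun q => ⟨(_, ⟨0, hβ⟩), hh.attains q⟩
    rintro ⟨z, d⟩ n
    by_cases hz : z = if k = 0 then none else some (X (j + 1))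
    · subst hz
      exact hh.bounded n
    · refine ((controlled_consume_false hN hA hT k j l (X j) z acc _ y e hjk ?_).mono hTT' le_rfl
        le_rfl).bounded n
      rw [cellSum_succ', add_zero, add_sub_cancel_left]
      cases k with
      | zero =>
        cases z with
        | none => exact absurd rfl hz
        | some z => exact Or.inl rfl
      | succ k =>
        cases z with
        | none => exact Or.inl (by omega)
        | some z =>
          refine Or.inr (unreachable_of_ne ?_ (j + 1) k)
          intro he
          apply hz
          rw [he, if_neg (by omega)]
  have hpop : ∀ j k, (push M.cellBase (-M.cellCode (X j))).apply
      (M.cellSum (fun i => X (j + i)) j (k + 1), (M.cellBase : ℚ) ^ j) =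
        (M.cellSum (fun i => X (j + 1 + i)) (j + 1) k, (M.cellBase : ℚ) ^ (j + 1)) := by
    intro j k
    have hX : (fun i => X (j + (i + 1))) = fun i => X (j + 1 + i) := by
      funext i; congr 1; omega
    rw [push_apply, pow_succ', cellSum_succ', hX, add_zero]
    simp
  have hpush : ∀ j c, c = M.nextCells X (w.length + E) j → (push M.cellBase (M.cellCode c)).apply
      (M.cellSum (M.nextCells X (w.length + E)) 0 j, (M.cellBase : ℚ) ^ j) =
        (M.cellSum (M.nextCells X (w.length + E)) 0 (j + 1), (M.cellBase : ℚ) ^ (j + 1)) := by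
    rintro j c rfl
    rw [push_apply, pow_succ', cellSum_succ, zero_add]
  induction k with
  | zero =>
    intro j hjk hrej
    obtain rfl : j = w.length + E := by omega
    have hs : sweepTime w E 0 = 1 := by unfold sweepTime; simp
    refine (start _ 0 (T + 1) F _ _ _ _ hjk (by rw [hs]) (by linarith) ?_).mono (by rw [hs]) le_rfl
      (by simp)
    by_cases hx : (X (w.length + E)).1 = some M.reject
    · exact controlled_consume_reject (Or.inl hx) (by linarith) hA0 (hQ _ le_rfl hx)
    rw [min_eq_right (by omega : w.length ≤ w.length + E), if_pos rfl]
    have hlast : M.nextCell (if w.length + E = 0 then none else some (X (w.length + E - 1)))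
        (X (w.length + E)) none = M.nextCells X (w.length + E) (w.length + E) := by
      simp [nextCells]
    have hnew : M.nextCell (some (X (w.length + E))) M.blankCell none =
        M.nextCells X (w.length + E) (w.length + E + 1) := by
      simp [nextCells]
    refine controlled_move (next_consume_end _ hx (markedTape_right w)) (by simp) (by simp)
      rfl rfl ?_ (by linarith) hA0
    have hpop0 : (push M.cellBase (-M.cellCode (X (w.length + E)))).apply
        (M.cellSum (fun i => X (w.length + E + i)) (w.length + E) (0 + 1),
          (M.cellBase : ℚ) ^ (w.length + E)) = (0, (M.cellBase : ℚ) ^ (w.length + E + 1)) := by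
      rw [hpop]; simp [cellSum]
    have hrej' : ∀ j ≤ w.length + E, (X j).1 ≠ some M.reject := fun j hj =>
      (Nat.lt_or_eq_of_le hj).elim (hrej j) fun h => h ▸ hx
    have hh := h hrej'
    simp only [Matrix.cons_val, hpop0, Nat.min_zero, Nat.cast_zero, hlast, hnew]
    -- If the head leaves the last cell to the right, that cell and the new one are appended in the
    -- same step, by `pushTwo`, and the count of the successor goes up.
    by_cases hg : M.grows (X (w.length + E))
    · simp only [hg, if_true, nextLength] at hh ⊢
      have hpush2 : (pushTwo M.cellBase (M.cellCode (M.nextCells X (w.length + E) (w.length + E)))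
          (M.cellCode (M.nextCells X (w.length + E) (w.length + E + 1)))).apply
          (M.cellSum (M.nextCells X (w.length + E)) 0 (w.length + E),
            (M.cellBase : ℚ) ^ (w.length + E)) =
          (M.cellSum (M.nextCells X (w.length + E)) 0 (w.length + E + 1 + 1),
            (M.cellBase : ℚ) * M.cellBase * (M.cellBase : ℚ) ^ (w.length + E)) := by
        rw [pushTwo_apply, cellSum_succ, cellSum_succ, zero_add, zero_add, pow_succ]
        congr 1
        ring
      have he : ((w.length + E - w.length : ℕ) : ℚ) + 1 =
          ((w.length + E + 1 + 1 - (w.length + 1) : ℕ) : ℚ) := by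
        rw [← Nat.cast_succ]; congr 1; omega
      rw [hpush2, he]
      exact hh _ _
    · simp only [hg, nextLength, Bool.false_eq_true, if_false, add_zero] at hh ⊢
      have he : ((w.length + E - w.length : ℕ) : ℚ) =
          ((w.length + E + 1 - (w.length + 1) : ℕ) : ℚ) := by
        congr 1; omega
      rw [hpush _ _ rfl, he]
      exact hh _ _
  | succ k ih =>
    intro j hjk hrej
    have hs := sweepTime_mono w E k
    have hs0 := sweepTime_nonneg w E k
    have hFk : F ≤ F + (min E (k + 1) : ℕ) * alarmRate β N w := by
      have : (0 : ℝ) ≤ (min E (k + 1) : ℕ) * (alarmRate β N w : ℝ) := by positivity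
      linarith
    have hT0 : 0 ≤ T := by linarith
    refine start j (k + 1) (T + sweepTime w E (k + 1)) _ _ _ _ _ hjk le_rfl (by linarith) ?_
    by_cases hx : (X j).1 = some M.reject
    · exact controlled_consume_reject (Or.inl hx) (by linarith) hA0 (hQ _ (by omega) hx)
    have h1 := ih (j + 1) (by omega) fun i hi =>
      (Nat.lt_or_eq_of_le (Nat.le_of_lt_succ hi)).elim (hrej i) fun h => h ▸ hx
    rw [if_neg (Nat.succ_ne_zero j), Nat.add_sub_cancel] at h1
    have hnext : M.nextCell (if j = 0 then none else some (X (j - 1))) (X j) (some (X (j + 1))) =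
        M.nextCells X (w.length + E) j := by
      have h3 : j ≤ w.length + E := by omega
      have h4 : j ≠ w.length + E := by omega
      simp only [nextCells, if_pos h3, if_neg h4]
    rw [if_neg (Nat.succ_ne_zero k)]
    -- Over the input the head moves along with the cells and the count rests at `E`. From cell
    -- `w.length` on, the head waits on the right end-marker and the count is `k + 1`.
    rcases Nat.lt_or_ge j w.length with hj | hj
    · rw [min_eq_left (by omega : E ≤ k), min_eq_left hj, Nat.sub_eq_zero_of_le hj] at h1
      rw [min_eq_left (by omega : E ≤ k + 1), min_eq_left hj.le, Nat.sub_eq_zero_of_le hj.le]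
      refine (controlled_move (T := T + sweepTime w E k + 1)
        (next_consume_letter _ hx (markedTape_letter w hj)) (by simp)
        (by simp) rfl rfl ?_ (by linarith) hA0).mono (by linarith) le_rfl le_rfl
      · simp only [Matrix.cons_val, hpop, hnext, hpush _ _ rfl]
        exact h1
    · have hs' := sweepTime_succ_of_lt w (by omega : k < E)
      rw [min_eq_right (by omega : k ≤ E), min_eq_right (by omega : w.length ≤ j + 1)] at h1
      rw [min_eq_right (by omega : k + 1 ≤ E), min_eq_right hj]
      have hu : ((j - w.length : ℕ) : ℚ) + 1 = ((j + 1 - w.length : ℕ) : ℚ) := by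
        rw [← Nat.cast_succ]; congr 1; omega
      have h2 := controlled_askDigit (hβ := hβ) (T := T + sweepTime w E k + 1)
        (F := F + (k : ℕ) * alarmRate β N w) (D := k + 1) (Q := Q) (l := some (X j)) (x := X (j + 1))
        (acc := M.flagBefore X (j + 1)) hN (by linarith) hA (by positivity)
        (fun _ => by rw [Nat.add_sub_cancel]; exact h1) (fun _ => ⟨by omega, by omega⟩)
      refine (controlled_move (T := T + sweepTime w E k + 1 + 3 * w.length + 8)
        (F := F + (k : ℕ) * alarmRate β N w + alarmRate β N w)
        (next_consume_right _ hx (markedTape_right w)) (by simp) (by simp)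
        rfl rfl ?_ ?_ hA0).mono ?_ le_rfl ?_
      · simp only [Matrix.cons_val, hpop, hnext, hpush _ _ rfl, hu]
        exact h2
      · linarith
      · linarith
      · push_cast; linarith

end SingleTapeDTM

/-! ### Whole sweeps, loading of the input, steps of the machine -/

namespace SingleTapeDTM

open SweepState RegProgram RegCoeff

variable {α : Type} {M : SingleTapeDTM α} {β N : ℕ} {hβ : 0 < β} {w : List α} {A : ℝ} {Q : Prop}

/-- The first cell has no predecessor that could have announced it, so a lie about it is treated
here; all later announcements are the business of `controlled_askNext`. -/
lemma controlled_sweepStart (hN : 0 < N) (hA : (alarmRate β N w : ℝ) ≤ A) {E : ℕ} {T F : ℝ}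
    (hT : lieTime w + 3 * w.length + 8 ≤ T) (hF : 0 ≤ F) (X : ℕ → M.Cell)
    (hQ : ∀ j ≤ w.length + E, (X j).1 = some M.reject → ¬ Q) (hE : E ≤ β ^ (w.length + 1))
    (h : (∀ j ≤ w.length + E, (X j).1 ≠ some M.reject) → ∀ y y' : ℚ,
      Controlled w A Q (sweepConf M N hβ (turnBack (M.flagBefore X (w.length + E + 1)))
        (w.length + 1) ![(0, y), (M.cellSum (M.nextCells X (w.length + E)) 0
          (M.nextLength X (w.length + E)), y'), (0, 0), (0, 0),
          (((M.nextLength X (w.length + E) - (w.length + 1) : ℕ) : ℚ), 0)]) T F) (y y' : ℚ) :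
    Controlled w A Q (sweepConf M N hβ sweepStart 0
      ![(M.cellSum X 0 (w.length + E + 1), y), (0, y'), ((E : ℚ), 0), (0, 0), (0, 0)])
      (T + sweepTime w E (w.length + E) + 3) (F + E * alarmRate β N w) := by
  have hl := lieTime_pos w
  have hn : (0 : ℝ) ≤ w.length := Nat.cast_nonneg _
  have h0 : (0 : ℝ) < (alarmRate β N w : ℝ) := by exact_mod_cast alarmRate_pos hβ hN w
  have hA0 : 0 ≤ A := h0.le.trans hA
  have hs := sweepTime_nonneg w E (w.length + E)
  have hmain := controlled_askNext hN hA hT hF X hQ hE h (w.length + E) 0 (Nat.zero_add _)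
    (fun i hi => absurd hi (Nat.not_lt_zero i))
  rw [if_pos rfl, Nat.zero_min, pow_zero, min_eq_left (by omega : E ≤ w.length + E),
    Nat.zero_sub] at hmain
  simp only [Nat.zero_add, Nat.cast_zero] at hmain
  have hz : M.cellSum (M.nextCells X (w.length + E)) 0 0 = 0 := by simp [cellSum]
  rw [hz] at hmain
  refine (controlled_move (T := T + sweepTime w E (w.length + E) + 2) (next_sweepStart _) (by simp)
    (by simp) rfl rfl ?_ (by linarith) hA0).mono (by linarith) le_rfl le_rfl
  simp only [Matrix.cons_val]
  refine .comm (T := T + sweepTime w E (w.length + E) + 1) (by simp [sweepConf, sweepProgram])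
    (by simp [sweepConf, sweepProgram]) rfl ?_ (by linarith) (by linarith)
    fun q => ⟨(some (X 0), ⟨0, hβ⟩), hmain.attains q⟩
  rintro ⟨_ | x, d⟩ n
  · exact .of_rej rfl
  by_cases hx : x = X 0
  · subst hx
    exact hmain.bounded n
  · have hun := unreachable_of_ne (f := X) hx 0 (w.length + E)
    have hfalse : Controlled w A False (sweepConf M N hβ (askNext none x false) 1
        ![(M.cellSum X 0 (w.length + E + 1), 1), (0, 1), ((E : ℚ), 0), (0, 0), (0, 0)])
        (T + sweepTime w E (w.length + E) + 1) 0 := by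
      refine .comm (T := T + sweepTime w E (w.length + E)) (by simp [sweepConf, sweepProgram])
        (by simp [sweepConf, sweepProgram]) rfl ?_ (by linarith) (by linarith) False.elim
      rintro ⟨z, d'⟩ n
      have := (controlled_consume_false (hβ := hβ) hN hA hT (w.length + E) 0 none x z false
        (M.cellSum X 0 (w.length + E + 1)) (0, 1) (0, 0) (Nat.zero_add _)
        (hun.falseAnnouncement z)).bounded n
      rw [Nat.zero_min, pow_zero, min_eq_left (by omega : E ≤ w.length + E)] at this
      exact this
    exact hfalse.bounded n

/-- The cells in a configuration of the machine. -/
def Conf.cells (c : M.Conf) (j : ℕ) : M.Cell := (if j = c.pos then some c.state else none, c.tape j)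

/-- The input is copied to the register. -/
lemma controlled_loadStart (hA : 0 ≤ A) {T F : ℝ} (hT : 0 ≤ T)
    (h : ∀ y : ℚ, Controlled w A Q (sweepConf M N hβ (turnBack false) (w.length + 1)
      ![(0, 0), (M.cellSum (M.initConf w).cells 0 (w.length + 1), y), (0, 0), (0, 0), (0, 0)])
      T F) :
    Controlled w A Q (sweepConf M N hβ loadStart 0 fun _ => (0, 0)) (T + w.length + 2) F := by
  set X := (M.initConf w).cells with hX
  have hpush : ∀ j c, c = X j → (push M.cellBase (M.cellCode c)).apply
      (M.cellSum X 0 j, (M.cellBase : ℚ) ^ j) =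
        (M.cellSum X 0 (j + 1), (M.cellBase : ℚ) ^ (j + 1)) := by
    rintro j c rfl
    rw [push_apply, pow_succ', cellSum_succ, zero_add]
  have hrest : ∀ k j, 1 ≤ j → j + k = w.length → Controlled w A Q (sweepConf M N hβ loadRest (j + 1)
      ![(0, 0), (M.cellSum X 0 j, (M.cellBase : ℚ) ^ j), (0, 0), (0, 0), (0, 0)])
      (T + k + 1) F := by
    intro k
    induction k with
    | zero =>
      intro j hj hjk
      obtain rfl : j = w.length := by omega
      -- The right end-marker stands for the first blank cell, so `w.length + 1` cells are loaded
      -- and the count starts at `0`.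
      have hx : ((none, M.blank) : M.Cell) = X w.length := by
        simp only [hX, Conf.cells, initConf, if_neg (by omega : ¬ w.length = 0)]
        simp
      refine (controlled_move (next_loadRest_right _ (markedTape_right w)) (by simp) (by simp)
        rfl rfl ?_ hT hA).mono (by simp) le_rfl le_rfl
      simp only [Matrix.cons_val, hpush _ _ hx]
      exact h _
    | succ k ih =>
      intro j hj hjk
      have hj' : j < w.length := by omega
      have hx : ((none, M.letter w[j]) : M.Cell) = X j := by
        simp only [hX, Conf.cells, initConf, if_neg (by omega : ¬ j = 0)]
        simp [hj']
      refine (controlled_move (T := T + k + 1) (next_loadRest_letter _ (markedTape_letter w hj'))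
        (by simp) (by simp) rfl rfl ?_ (by positivity) hA).mono (by push_cast; linarith) le_rfl
        le_rfl
      simp only [Matrix.cons_val, hpush _ _ hx]
      exact ih (j + 1) (by omega) (by omega)
  have hpush0 : ∀ c, c = X 0 → (push M.cellBase (M.cellCode c)).apply (0, 1) =
      (M.cellSum X 0 1, (M.cellBase : ℚ) ^ 1) := by
    intro c hc
    have := hpush 0 c hc
    simpa [cellSum] using this
  refine (controlled_move (T := T + w.length + 1) (next_loadStart _) (by simp) (by simp) rfl rfl ?_
    (by positivity) hA).mono (by linarith) le_rfl le_rfl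
  -- For the empty input the start state sits on the blank cell at the right end-marker.
  rcases Nat.eq_zero_or_pos w.length with h0 | h0
  · have hr : markedTape w 1 = .rightEnd := by
      have := markedTape_right w
      rwa [h0] at this
    have hx : ((some M.start, M.blank) : M.Cell) = X 0 := by
      simp [hX, Conf.cells, initConf, List.length_eq_zero_iff.1 h0]
    refine (controlled_move (T := T) (next_loadFirst_right _ hr) (by simp) (by simp) rfl rfl ?_
      hT hA).mono (by linarith [(Nat.cast_nonneg w.length : (0 : ℝ) ≤ w.length)]) le_rfl le_rfl
    simp only [Matrix.cons_val, hpush0 _ hx]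
    have := h ((M.cellBase : ℚ) ^ 1)
    rw [h0] at this
    exact this
  · have hx : ((some M.start, M.letter w[0]) : M.Cell) = X 0 := by
      simp [hX, Conf.cells, initConf, h0]
    refine (controlled_move (T := T + (w.length - 1 : ℕ) + 1)
      (next_loadFirst_letter _ (markedTape_letter w h0)) (by simp) (by simp) rfl rfl ?_
      (by positivity) hA).mono (by rw [Nat.cast_sub h0]; push_cast; linarith) le_rfl le_rfl
    simp only [Matrix.cons_val, hpush0 _ hx]
    exact hrest (w.length - 1) 1 le_rfl (by omega)

/-! #### The computation of the machine -/

lemma flagBefore_eq_true (X : ℕ → M.Cell) (j : ℕ) :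
    M.flagBefore X j = true ↔ ∃ i < j, (X i).1 = some M.accept := by
  induction j with
  | zero => simp [flagBefore]
  | succ j ih =>
    simp only [flagBefore, flag, Bool.or_eq_true, ih, decide_eq_true_eq]
    constructor
    · rintro (⟨i, hi, h⟩ | h)
      · exact ⟨i, by omega, h⟩
      · exact ⟨j, by omega, h⟩
    · rintro ⟨i, hi, h⟩
      rcases Nat.lt_or_eq_of_le (Nat.le_of_lt_succ hi) with hi | rfl
      · exact Or.inl ⟨i, hi, h⟩
      · exact Or.inr h

/-- The new contents depend on three neighbouring cells only. The boundaries need care: at cell `0`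
a left move stays, and cell `m + 1`, blank by `hb`, can only receive the head from cell `m`. -/
lemma nextCells_cells {c : M.Conf} (hacc : c.state ≠ M.accept) (hrej : c.state ≠ M.reject) {m : ℕ}
    (hm : c.pos ≤ m) (hb : ∀ j, m < j → c.tape j = M.blank) {j : ℕ} (hj : j ≤ m + 1) :
    M.nextCells c.cells m j = (M.step c).cells j := by
  have hstep : M.step c = ⟨(M.trans c.state (c.tape c.pos)).1,
      (M.trans c.state (c.tape c.pos)).2.2.apply c.pos,
      Function.update c.tape c.pos (M.trans c.state (c.tape c.pos)).2.1⟩ := by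
    rw [step, if_neg (by tauto)]
  rw [hstep]
  rcases ht : M.trans c.state (c.tape c.pos) with ⟨q', a', d⟩
  have hL : ∀ i, M.fromLeft (some (c.cells i)) =
      if i = c.pos then (match d with | .right => some q' | _ => none) else none := by
    intro i
    by_cases hi : i = c.pos
    · subst hi
      cases d <;> simp [Conf.cells, fromLeft, ht]
    · simp [Conf.cells, fromLeft, hi]
  have hR : ∀ i, M.fromRight (some (c.cells i)) =
      if i = c.pos then (match d with | .left => some q' | _ => none) else none := by
    intro i
    by_cases hi : i = c.pos
    · subst hi
      cases d <;> simp [Conf.cells, fromRight, ht]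
    · simp [Conf.cells, fromRight, hi]
  have hS : ∀ l i, M.fromSelf l (c.cells i) = if i = c.pos then (match d with
      | .stay => some q'
      | .left => if l.isNone then some q' else none
      | .right => none) else none := by
    intro l i
    by_cases hi : i = c.pos
    · subst hi
      cases d <;> simp [Conf.cells, fromSelf, ht]
    · simp [Conf.cells, fromSelf, hi]
  have hsym : ∀ i, M.nextSymbol (c.cells i) = Function.update c.tape c.pos a' i := by
    intro i
    by_cases hi : i = c.pos
    · subst hi
      simp [Conf.cells, nextSymbol, ht]
    · simp [Conf.cells, nextSymbol, hi]
  have hL0 : M.fromLeft none = none := rfl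
  have hR0 : M.fromRight none = none := rfl
  rcases Nat.lt_or_ge m j with hjm | hjm
  · obtain rfl : j = m + 1 := by omega
    have h1 : ¬ m + 1 ≤ m := by omega
    simp only [nextCells, if_neg h1, nextCell, hL, hR0]
    refine Prod.ext ?_ ?_
    · change _ = if m + 1 = d.apply c.pos then some q' else none
      cases d <;> simp only [HeadMove.apply, blankCell, fromSelf] <;>
        grind
    · simp only [Conf.cells, blankCell, nextSymbol]
      rw [Function.update_of_ne (by omega), hb _ (by omega)]
      rfl
  · simp only [nextCells, if_pos hjm, nextCell, hsym, hS]
    refine Prod.ext ?_ rfl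
    change _ = if j = d.apply c.pos then some q' else none
    rcases Nat.eq_zero_or_pos j with rfl | hj0 <;> rcases Nat.lt_or_eq_of_le hjm with hjm | hjm
    · have h1 : ¬ 0 = m := by omega
      simp only [if_true, if_neg h1, hL0, hR]
      cases d <;> simp only [HeadMove.apply, Option.isNone] <;>
        grind
    · simp only [if_true, if_pos hjm, hL0, hR0]
      cases d <;> simp only [HeadMove.apply, Option.isNone] <;>
        grind
    · have h1 : ¬ j = m := by omega
      have h2 : ¬ j = 0 := by omega
      simp only [if_neg h1, if_neg h2, hL, hR]
      cases d <;> simp only [HeadMove.apply, Option.isNone] <;>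
        grind
    · have h2 : ¬ j = 0 := by omega
      simp only [if_neg h2, if_pos hjm, hL, hR0]
      cases d <;> simp only [HeadMove.apply, Option.isNone] <;>
        grind

lemma grows_cells {c : M.Conf} (hacc : c.state ≠ M.accept) (hrej : c.state ≠ M.reject) {m : ℕ}
    (hm : c.pos ≤ m) : M.grows (c.cells m) = true ↔ (M.step c).pos = m + 1 := by
  have hstep : (M.step c).pos = (M.trans c.state (c.tape c.pos)).2.2.apply c.pos := by
    rw [step, if_neg (by tauto)]
  rw [hstep, grows]
  by_cases hi : m = c.pos
  · subst hi
    simp only [Conf.cells, fromLeft, if_true]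
    cases (M.trans c.state (c.tape c.pos)).2.2 <;> simp [HeadMove.apply]
  · simp only [Conf.cells, fromLeft, if_neg hi]
    cases (M.trans c.state (c.tape c.pos)).2.2 <;> simp [HeadMove.apply] <;> omega

lemma step_of_halted {c : M.Conf} (h : c.state = M.accept ∨ c.state = M.reject) :
    M.step c = c := by
  rw [step, if_pos h]

lemma run_succ (w : List α) (i : ℕ) : M.run w (i + 1) = M.step (M.run w i) :=
  Function.iterate_succ_apply' _ _ _

lemma run_of_halted {i j : ℕ} (hij : i ≤ j)
    (h : (M.run w i).state = M.accept ∨ (M.run w i).state = M.reject) :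
    M.run w j = M.run w i := by
  induction j, hij using Nat.le_induction with
  | base => rfl
  | succ j _ ih => rw [run_succ, ih, step_of_halted h]

lemma run_pos_le (w : List α) (i : ℕ) : (M.run w i).pos ≤ i := by
  induction i with
  | zero => exact le_rfl
  | succ i ih =>
    rw [run_succ, step]
    split_ifs
    · omega
    · show HeadMove.apply _ _ ≤ _
      cases (M.trans (M.run w i).state ((M.run w i).tape (M.run w i).pos)).2.2 <;>
        simp only [HeadMove.apply] <;> omega

lemma step_tape_of_lt {c : M.Conf} {j : ℕ} (h : c.pos < j) : (M.step c).tape j = c.tape j := by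
  rw [step]
  split_ifs
  · rfl
  · exact Function.update_of_ne (by omega) _ _

end SingleTapeDTM

/-! ### Induction over the computation of the machine -/

namespace SingleTapeDTM

open SweepState RegProgram RegCoeff

variable {α : Type} {M : SingleTapeDTM α} {w : List α}

lemma run_pos_succ_le (w : List α) (i : ℕ) : (M.run w (i + 1)).pos ≤ (M.run w i).pos + 1 := by
  rw [run_succ, step]
  split_ifs
  · omega
  · show HeadMove.apply _ _ ≤ _
    cases (M.trans (M.run w i).state ((M.run w i).tape (M.run w i).pos)).2.2 <;>
      simp only [HeadMove.apply] <;> omega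

/-- The head moves by at most one cell, so the scanned cells form an initial segment; their number
therefore bounds the positions. -/
lemma run_pos_lt_of_cellsScanned_le {m : ℕ} (h : M.cellsScanned w ≤ (m : ℕ∞)) (i : ℕ) :
    (M.run w i).pos < m := by
  have hsub : ∀ i, Set.Iic (M.run w i).pos ⊆ Set.range fun n => (M.run w n).pos := by
    intro i
    induction i with
    | zero =>
      intro q hq
      have h0 : (M.run w 0).pos = 0 := rfl
      exact ⟨0, by rw [Set.mem_Iic, h0] at hq; simp only [h0]; omega⟩
    | succ i ih =>
      intro q hq
      have := M.run_pos_succ_le w i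
      rw [Set.mem_Iic] at hq
      rcases Nat.lt_or_eq_of_le hq with hq | rfl
      · exact ih (by rw [Set.mem_Iic]; omega)
      · exact ⟨i + 1, rfl⟩
  have h1 := (Set.encard_le_encard (hsub i)).trans h
  rw [← Finset.coe_Iic, Set.encard_coe_eq_coe_finsetCard, Nat.card_Iic] at h1
  exact_mod_cast h1

/-- Halted configurations persist until time `T`, where the verdict of `M` is known. Seeing the
state at any earlier step is thus conclusive. -/
lemma state_of_accept {L : Language α} {T : ℕ}
    (hM : (w ∈ L → (M.run w T).state = M.accept) ∧ (w ∉ L → (M.run w T).state = M.reject)) {i : ℕ}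
    (hi : i ≤ T) (h : (M.run w i).state = M.accept) : w ∈ L := by
  by_contra hw
  have := hM.2 hw
  rw [run_of_halted hi (Or.inl h), h] at this
  exact M.accept_ne_reject this

lemma state_of_reject {L : Language α} {T : ℕ}
    (hM : (w ∈ L → (M.run w T).state = M.accept) ∧ (w ∉ L → (M.run w T).state = M.reject)) {i : ℕ}
    (hi : i ≤ T) (h : (M.run w i).state = M.reject) : w ∉ L := by
  intro hw
  have := hM.1 hw
  rw [run_of_halted hi (Or.inr h), h] at this
  exact M.accept_ne_reject this.symm

/-- A bound for the number of steps in a sweep with at most `e` cells beyond the input. -/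
def roundTime (w : List α) (e : ℕ) : ℝ :=
  2 * ((w.length : ℝ) + e) + 1 + (3 * w.length + 10) * e + w.length + 8

lemma sweepTime_le {E e : ℕ} (h : E ≤ e) :
    sweepTime w E (w.length + E) + w.length + 8 ≤ roundTime w e := by
  have h1 : (E : ℝ) ≤ e := by exact_mod_cast h
  unfold sweepTime roundTime
  rw [min_eq_left (by omega)]
  push_cast
  nlinarith [(Nat.cast_nonneg w.length : (0 : ℝ) ≤ w.length)]

variable {β N : ℕ} {hβ : 0 < β} {L : Language α} {A : ℝ}

/-- One sweep per step of `M`, with `k` steps to go. A sweep adds at most `e` countdown tests and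
two final ones, hence `(e + 2) η`, to the error. Lies do not add up in `A`: each branch with a lie
is bounded by `η` on its own, and truthful play accepts only members of `L`. -/
lemma controlled_run (hN : 0 < N) {T e : ℕ}
    (hM : (w ∈ L → (M.run w T).state = M.accept) ∧ (w ∉ L → (M.run w T).state = M.reject))
    (hpos : ∀ i, (M.run w i).pos ≤ w.length + e) (he : e ≤ β ^ (w.length + 1))
    (hA : (alarmRate β N w : ℝ) ≤ A) (hA1 : w ∈ L → 1 ≤ A) (k : ℕ) : ∀ i E : ℕ, i + k = T → E ≤ e →
    (M.run w i).pos ≤ w.length + E → (∀ j, w.length + E < j → (M.run w i).tape j = M.blank) →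
    ∀ y y' : ℚ, Controlled w A (w ∈ L) (sweepConf M N hβ sweepStart 0
      ![(M.cellSum (M.run w i).cells 0 (w.length + E + 1), y), (0, y'), ((E : ℚ), 0), (0, 0),
        (0, 0)])
      (lieTime w + 3 * w.length + 8 + (k + 1) * roundTime w e)
      ((k + 1) * (e + 2) * alarmRate β N w) := by
  have hl := lieTime_pos w
  have hn : (0 : ℝ) ≤ w.length := Nat.cast_nonneg _
  have h0 : (0 : ℝ) < (alarmRate β N w : ℝ) := by exact_mod_cast alarmRate_pos hβ hN w
  have hA0 : 0 ≤ A := h0.le.trans hA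
  have hR : 0 ≤ roundTime w e := by unfold roundTime; positivity
  induction k using Nat.strong_induction_on with
  | _ k ih =>
  intro i E hik hE hp hb
  have hi : i ≤ T := by omega
  have hcell : ∀ j q, ((M.run w i).cells j).1 = some q → (M.run w i).state = q := by
    intro j q h
    unfold Conf.cells at h
    split_ifs at h
    exact Option.some_injective _ h
  have hEe : (E : ℝ) ≤ e := by exact_mod_cast hE
  have hEη : (E : ℝ) * alarmRate β N w ≤ e * alarmRate β N w :=
    mul_le_mul_of_nonneg_right hEe h0.le
  have hkR : 0 ≤ (k : ℝ) * roundTime w e := by positivity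
  have hF0 : 0 ≤ (k : ℝ) * (e + 2) * alarmRate β N w := by positivity
  have hs := sweepTime_le (w := w) hE
  intro y y'
  refine (controlled_sweepStart (T := lieTime w + 3 * w.length + 8 + k * roundTime w e +
      w.length + 5) (F := k * (e + 2) * alarmRate β N w + 2 * alarmRate β N w)
    hN hA (by linarith) (by positivity) (M.run w i).cells
    (fun j _ h => state_of_reject hM hi (hcell j _ h)) (hE.trans he) ?_ y y').mono
    (by linarith) le_rfl (by linarith)
  intro hrej y y'
  refine controlled_turnBack_honest hN (by linarith) hA0 hF0 ?_
  have hpcell : ((M.run w i).cells (M.run w i).pos).1 = some (M.run w i).state := if_pos rfl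
  have hrej' : (M.run w i).state ≠ M.reject := fun h => hrej _ hp (by rw [hpcell, h])
  by_cases hflag : M.flagBefore (M.run w i).cells (w.length + E + 1) = true
  · obtain ⟨j, -, hj⟩ := (flagBefore_eq_true _ _).1 hflag
    rw [if_pos hflag]
    exact .of_acc rfl (hA1 (state_of_accept hM hi (hcell j _ hj))) hF0
  have hacc' : (M.run w i).state ≠ M.accept := fun h =>
    hflag ((flagBefore_eq_true _ _).2 ⟨_, Nat.lt_succ_of_le hp, by rw [hpcell, h]⟩)
  rw [if_neg hflag]
  -- At `i = T` the machine has halted, so the sweep has already shown an accepting or a rejecting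
  -- state.
  obtain ⟨k, rfl⟩ : ∃ k', k = k' + 1 := by
    refine Nat.exists_eq_succ_of_ne_zero ?_
    rintro rfl
    obtain rfl : i = T := by omega
    exact (Classical.em (w ∈ L)).elim (fun h => hacc' (hM.1 h)) fun h => hrej' (hM.2 h)
  have hgrow := grows_cells hacc' hrej' hp
  rw [← run_succ] at hgrow
  -- The stored tape is lengthened only when the head really enters a new cell; `hpos` then keeps
  -- `E'` within `e`.
  obtain ⟨E', hE', hE'e, hp'⟩ : ∃ E', M.nextLength (M.run w i).cells (w.length + E) =
      w.length + E' + 1 ∧ E' ≤ e ∧ (M.run w (i + 1)).pos ≤ w.length + E' ∧ E ≤ E' := by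
    have h1 := M.run_pos_succ_le w i
    have h2 := hpos (i + 1)
    by_cases hg : M.grows ((M.run w i).cells (w.length + E)) = true
    · have h3 := hgrow.1 hg
      exact ⟨E + 1, by simp only [nextLength, hg, if_true]; rfl, by omega, by omega, by omega⟩
    · have h3 := mt hgrow.2 hg
      exact ⟨E, by simp only [nextLength, hg, Bool.false_eq_true, if_false, add_zero], by omega,
        by omega, le_rfl⟩
  have hsum : M.cellSum (M.nextCells (M.run w i).cells (w.length + E)) 0
      (M.nextLength (M.run w i).cells (w.length + E)) =
        M.cellSum (M.run w (i + 1)).cells 0 (w.length + E' + 1) := by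
    rw [hE']
    refine Finset.sum_congr rfl fun j hj => ?_
    have hj' : j ≤ w.length + E + 1 := by
      rw [Finset.mem_range, ← hE', nextLength] at hj
      split_ifs at hj <;> omega
    rw [nextCells_cells hacc' hrej' hp hb hj', ← run_succ]
  rw [hsum, hE', show w.length + E' + 1 - (w.length + 1) = E' by omega]
  push_cast
  refine ih k (Nat.lt_succ_self k) (i + 1) E' (by omega) hE'e hp'.1 (fun j hj => ?_) y' 0
  rw [run_succ, step_tape_of_lt (by omega), hb j (by omega)]

/-- A bound for the expected number of steps. -/
def totalTime (w : List α) (T e : ℕ) : ℝ :=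
  lieTime w + 5 * w.length + 15 + (T + 1) * roundTime w e

/-- After loading, the two final tests are run once on zero registers, only to exchange roles. Their
`2 η` is absorbed by passing from `e + 2` to `e + 4`. -/
lemma controlled_startConf (hN : 0 < N) {T e : ℕ}
    (hM : (w ∈ L → (M.run w T).state = M.accept) ∧ (w ∉ L → (M.run w T).state = M.reject))
    (hstart : ¬ (M.start = M.accept ∨ M.start = M.reject))
    (hpos : ∀ i, (M.run w i).pos ≤ w.length + e) (he : e ≤ β ^ (w.length + 1))
    (hA : (alarmRate β N w : ℝ) ≤ A) (hA1 : w ∈ L → 1 ≤ A) :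
    Controlled w A (w ∈ L) (M.sweepProgram β N hβ).startConf (totalTime w T e)
      ((T + 1) * (e + 4) * alarmRate β N w) := by
  have hl := lieTime_pos w
  have hn : (0 : ℝ) ≤ w.length := Nat.cast_nonneg _
  have h0 : (0 : ℝ) < (alarmRate β N w : ℝ) := by exact_mod_cast alarmRate_pos hβ hN w
  have hA0 : 0 ≤ A := h0.le.trans hA
  have hR : 0 ≤ roundTime w e := by unfold roundTime; positivity
  have hconf : (M.sweepProgram β N hβ).startConf = sweepConf M N hβ loadStart 0 fun _ => (0, 0) := by
    rw [not_or] at hstart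
    simp [RegProgram.startConf, sweepProgram, sweepConf, hstart.1, hstart.2]
  rw [hconf]
  have hTR : 0 ≤ ((T : ℝ) + 1) * roundTime w e := by positivity
  have hF0 : 0 ≤ ((T : ℝ) + 1) * (e + 2) * alarmRate β N w := by positivity
  have hFT : 0 ≤ (T : ℝ) * alarmRate β N w := by positivity
  have hrun := controlled_run (hβ := hβ) hN hM hpos he hA hA1 T 0 0 (Nat.zero_add T) (Nat.zero_le e)
    (Nat.zero_le _) (fun j hj => by simp [run, initConf, (by omega : w.length ≤ j)])
  rw [Nat.cast_zero, add_zero] at hrun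
  refine (controlled_loadStart hA0 (by positivity) fun y =>
    controlled_turnBack_honest (acc := false) hN (by positivity) hA0 hF0 (hrun y 0)).mono ?_ le_rfl ?_
  · unfold totalTime; linarith
  · linarith

lemma totalTime_le {T c s : ℕ} (hw : 1 ≤ w.length) (hT : 1 ≤ T) (hs : 1 ≤ s) :
    totalTime w T (c * s) ≤ (80 + 30 * c) * (w.length * s * T) := by
  have h1 : (1 : ℝ) ≤ w.length := by exact_mod_cast hw
  have h2 : (1 : ℝ) ≤ T := by exact_mod_cast hT
  have h3 : (1 : ℝ) ≤ s := by exact_mod_cast hs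
  have hc : (0 : ℝ) ≤ c := Nat.cast_nonneg c
  have h4 : (w.length : ℝ) ≤ w.length * s := le_mul_of_one_le_right (by linarith) h3
  have h5 : (c : ℝ) * s ≤ c * (w.length * s) :=
    mul_le_mul_of_nonneg_left (le_mul_of_one_le_left (by linarith) h1) hc
  have h6 : roundTime w (c * s) ≤ (12 + 15 * c) * (w.length * s) := by
    unfold roundTime; push_cast; linarith
  have h7 : (w.length : ℝ) * s ≤ w.length * s * T := le_mul_of_one_le_right (by positivity) h2
  have h8 : ((T : ℝ) + 1) * roundTime w (c * s) ≤ 2 * T * ((12 + 15 * c) * (w.length * s)) :=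
    mul_le_mul (by linarith) h6 (by unfold roundTime; positivity) (by positivity)
  unfold totalTime lieTime
  linarith

end SingleTapeDTM

/-! ### Choice of the base `β`, and the constants -/

/-- Take `β` above `C`, above `2 ^ k` and above the finitely many values `g n` with `n < m`. The
exponent `n + 1` leaves one factor `β` for the constant. -/
lemma exists_le_pow_succ {S : Set ℕ} {g : ℕ → ℕ} {C k m : ℕ}
    (h : ∀ n ∈ S, m ≤ n → g n ≤ C * 2 ^ (k * n)) : ∃ β > 0, ∀ n ∈ S, g n ≤ β ^ (n + 1) := by
  refine ⟨C + 2 ^ k + ∑ i ∈ Finset.range m, g i, by positivity, fun n hn => ?_⟩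
  set β := C + 2 ^ k + ∑ i ∈ Finset.range m, g i with hβ
  have hk : 0 < 2 ^ k := by positivity
  rcases Nat.lt_or_ge n m with hnm | hnm
  · have h1 : g n ≤ ∑ i ∈ Finset.range m, g i :=
      Finset.single_le_sum (fun _ _ => Nat.zero_le _) (Finset.mem_range.2 hnm)
    have h2 : β ^ 1 ≤ β ^ (n + 1) := Nat.pow_le_pow_right (by omega) (by omega)
    rw [pow_one] at h2
    omega
  · refine (h n hn hnm).trans ?_
    rw [pow_mul, pow_succ, mul_comm]
    exact Nat.mul_le_mul (Nat.pow_le_pow_left (by omega) n) (by omega)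

/-- The polynomial case is contained in the exponential one, since `n ≤ 2 ^ n`. -/
lemma exists_le_two_pow {f : ℕ → ℕ} (h : ∃ k : ℕ,
      (fun n : ℕ => (f n : ℝ)) =O[atTop] (fun n : ℕ => (n : ℝ) ^ k) ∨
      (fun n : ℕ => (f n : ℝ)) =O[atTop] (fun n : ℕ => (2 : ℝ) ^ (k * n))) :
    ∃ C k m : ℕ, ∀ n, m ≤ n → f n ≤ C * 2 ^ (k * n) := by
  obtain ⟨k, h⟩ := h
  have h' : (fun n : ℕ => (f n : ℝ)) =O[atTop] (fun n : ℕ => (2 : ℝ) ^ (k * n)) := by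
    refine h.elim (fun h => h.trans (.of_bound 1 (.of_forall fun n => ?_))) id
    rw [one_mul, Real.norm_of_nonneg (by positivity), Real.norm_of_nonneg (by positivity), mul_comm,
      pow_mul]
    exact pow_le_pow_left₀ (by positivity) (by exact_mod_cast Nat.lt_two_pow_self.le) k
  obtain ⟨C, hC⟩ := h'.bound
  obtain ⟨m, hm⟩ := eventually_atTop.1 hC
  refine ⟨⌈C⌉₊, k, m, fun n hn => ?_⟩
  have h1 := hm n hn
  rw [Real.norm_of_nonneg (by positivity), Real.norm_of_nonneg (by positivity)] at h1
  have h2 : (f n : ℝ) ≤ ⌈C⌉₊ * 2 ^ (k * n) :=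
    h1.trans (mul_le_mul_of_nonneg_right (Nat.le_ceil C) (by positivity))
  exact_mod_cast h2

namespace SingleTapeDTM

open RegProgram

variable {α : Type} {M : SingleTapeDTM α} {L : Language α} {s t : ℕ → ℕ}

-- If `M` starts in a halting state then `t` may vanish, and so must the running time; the program
-- then starts in a halting state as well.
open Classical in
lemma exists_controlled_of_halted (htime : M.DecidesInTime L t)
    (hstart : M.start = M.accept ∨ M.start = M.reject) {N : ℕ} {w : List α} :
    Controlled w (if w ∈ L then 1 else (N : ℝ)⁻¹) (w ∈ L)
      (M.sweepProgram 1 N one_pos).startConf 0 (N : ℝ)⁻¹ := by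
  have h0 : M.run w 0 = M.initConf w := rfl
  have hN : (0 : ℝ) ≤ (N : ℝ)⁻¹ := by positivity
  rcases hstart with h | h
  · have hw : w ∈ L := state_of_accept (htime w) (Nat.zero_le _) h
    exact .of_acc (by simp [RegProgram.startConf, sweepProgram, h]) (by rw [if_pos hw]) hN
  · have hw : w ∉ L := state_of_reject (htime w) (Nat.zero_le _) h
    exact .of_rej (by simp [RegProgram.startConf, sweepProgram, h, M.accept_ne_reject.symm]) hw

-- `β` and the time bound are fixed before `N`: the error is tuned by the initial coin `1/N` alone,
-- at no cost in time.
open Classical in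
lemma exists_controlled (hspace : M.UsesSpaceBigO s) (htime : M.DecidesInTime L t)
    (hst : ∃ k : ℕ,
      (fun n : ℕ => (s n : ℝ) * (t n : ℝ)) =O[atTop] (fun n : ℕ => (n : ℝ) ^ k) ∨
      (fun n : ℕ => (s n : ℝ) * (t n : ℝ)) =O[atTop] (fun n : ℕ => (2 : ℝ) ^ (k * n))) :
    ∃ (K : ℝ) (n₁ β : ℕ) (hβ : 0 < β) (T : List α → ℝ), 0 ≤ K ∧
      (∀ w, n₁ ≤ w.length → T w ≤ K * (w.length * s w.length * t w.length)) ∧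
      ∀ (N : ℕ) w, 0 < N → Controlled w (if w ∈ L then 1 else (N : ℝ)⁻¹) (w ∈ L)
        (M.sweepProgram β N hβ).startConf (T w) (N : ℝ)⁻¹ := by
  by_cases hstart : M.start = M.accept ∨ M.start = M.reject
  · exact ⟨0, 0, 1, one_pos, fun _ => 0, le_rfl, fun _ _ => by simp,
      fun N w _ => exists_controlled_of_halted htime hstart⟩
  obtain ⟨c, n₀, hc⟩ := hspace
  have ht : ∀ w : List α, 1 ≤ t w.length := by
    intro w
    by_contra h
    obtain h0 : t w.length = 0 := by omega
    have hM := htime w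
    rw [h0] at hM
    exact hstart ((Classical.em (w ∈ L)).elim (fun h => Or.inl (hM.1 h)) fun h => Or.inr (hM.2 h))
  have hs : ∀ w : List α, n₀ ≤ w.length → 1 ≤ s w.length := by
    intro w hw
    have := run_pos_lt_of_cellsScanned_le (hc w hw) 0
    exact Nat.pos_of_ne_zero fun h0 => by rw [h0, mul_zero] at this; omega
  -- The space bound is known only from `n₀` on. For shorter inputs the head cannot get beyond `t
  -- n`.
  set e : ℕ → ℕ := fun n => if n₀ ≤ n then c * s n else t n with he
  have hpos : ∀ (w : List α) i, (M.run w i).pos ≤ w.length + e w.length := by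
    intro w i
    simp only [he]
    split_ifs with hn
    · have := run_pos_lt_of_cellsScanned_le (hc w hn) i
      omega
    · rcases Nat.lt_or_ge i (t w.length) with hi | hi
      · have := M.run_pos_le w i
        omega
      · rw [run_of_halted hi ((Classical.em (w ∈ L)).elim (fun h => Or.inl ((htime w).1 h))
          fun h => Or.inr ((htime w).2 h))]
        have := M.run_pos_le w (t w.length)
        omega
  obtain ⟨C, k, m, hC⟩ := exists_le_two_pow (f := fun n => s n * t n) (by simpa using hst)
  -- Only lengths of actual words are considered, because `ht` and `hs` say nothing about other
  -- lengths.
  obtain ⟨β, hβ, hg⟩ := exists_le_pow_succ (S := Set.range (List.length : List α → ℕ))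
    (g := fun n => (t n + 1) * (e n + 4)) (C := 2 * (c + 4) * C) (k := k) (m := max n₀ m) (by
      rintro _ ⟨w, rfl⟩ hn
      have h1 := ht w
      have h2 := hs w ((le_max_left _ _).trans hn)
      have h3 := hC w.length ((le_max_right _ _).trans hn)
      simp only [he, if_pos ((le_max_left _ _).trans hn)]
      calc _ ≤ (2 * t w.length) * ((c + 4) * s w.length) :=
            Nat.mul_le_mul (by omega) (by nlinarith)
        _ = 2 * (c + 4) * (s w.length * t w.length) := by ring
        _ ≤ 2 * (c + 4) * (C * 2 ^ (k * w.length)) := Nat.mul_le_mul_left _ h3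
        _ = _ := by ring)
  refine ⟨80 + 30 * c, max n₀ 1, β, hβ, fun w => totalTime w (t w.length) (e w.length),
    by positivity, fun w hw => ?_, fun N w hN => ?_⟩
  · have h1 : n₀ ≤ w.length := (le_max_left _ _).trans hw
    simp only [he, if_pos h1]
    exact totalTime_le ((le_max_right _ _).trans hw) (ht w) (hs w h1)
  · have hgw := hg w.length ⟨w, rfl⟩
    have h0 : (0 : ℝ) < (alarmRate β N w : ℝ) := by exact_mod_cast alarmRate_pos hβ hN w
    have hη : ((β ^ (w.length + 1) : ℕ) : ℝ) * alarmRate β N w = (N : ℝ)⁻¹ := by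
      unfold alarmRate
      have hβ0 : (β : ℝ) ≠ 0 := by positivity
      push_cast
      rw [inv_pow, mul_left_comm, mul_inv_cancel₀ (pow_ne_zero _ hβ0), mul_one]
    have hF : ((t w.length : ℝ) + 1) * (e w.length + 4) * alarmRate β N w ≤ (N : ℝ)⁻¹ := by
      rw [← hη]
      exact mul_le_mul_of_nonneg_right (by exact_mod_cast hgw) h0.le
    have hβ1 : (1 : ℝ) ≤ ((β ^ (w.length + 1) : ℕ) : ℝ) := by
      exact_mod_cast Nat.one_le_pow _ _ hβ
    refine (controlled_startConf hN (htime w) hstart (hpos w) ?_ ?_ fun hw => ?_).mono le_rfl le_rfl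
      hF
    -- The bound on the number of tests also ensures that all counts fit into the digits sent.
    · exact le_trans (by nlinarith) hgw
    · split_ifs
      · exact_mod_cast alarmRate_le_one hβ hN w
      · rw [← hη]
        exact le_mul_of_one_le_left h0.le hβ1
    · rw [if_pos hw]

end SingleTapeDTM

theorem mainTheorem6 {α : Type} [Fintype α] (L : Language α) (s t : ℕ → ℕ)
    (M : SingleTapeDTM α) (hspace : M.UsesSpaceBigO s) (htime : M.DecidesInTime L t)
    (hst : ∃ k : ℕ,
      (fun n : ℕ => (s n : ℝ) * (t n : ℝ)) =O[atTop] (fun n : ℕ => (n : ℝ) ^ k) ∨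
      (fun n : ℕ => (s n : ℝ) * (t n : ℝ)) =O[atTop] (fun n : ℕ => (2 : ℝ) ^ (k * n))) :
    ∃ (K : ℝ) (n₁ : ℕ), ∀ ε : ℝ, 0 < ε → ε < 1 / 2 →
      ∃ V : Rat2ADfAVerifier α,
        V.StronglyVerifies L ε ∧
        ∀ (P : V.Prover) (w : List α), n₁ ≤ w.length →
          V.expectedTime P w ≤
            ENNReal.ofReal (K * ((w.length : ℝ) * (s w.length : ℝ) * (t w.length : ℝ)) / ε) := by
  classical
  obtain ⟨K, n₁, β, hβ, T, hK, hT, h⟩ := M.exists_controlled hspace htime hst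
  refine ⟨K, n₁, fun ε hε hε' => ?_⟩
  have hN : 0 < ⌈ε⁻¹⌉₊ := Nat.ceil_pos.2 (inv_pos.2 hε)
  have hNε : ((⌈ε⁻¹⌉₊ : ℕ) : ℝ)⁻¹ ≤ ε := inv_le_of_inv_le₀ hε (Nat.le_ceil _)
  refine ⟨(M.sweepProgram β ⌈ε⁻¹⌉₊ hβ).toVerifier, RegProgram.stronglyVerifies _ _ _
    (fun w => h _ w hN) (fun w => ?_) (fun w hw => ?_) (fun w _ => hNε), fun P w hw => ?_⟩
  · split_ifs <;> positivity
  · rw [if_neg hw]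
    exact hNε
  · refine (RegProgram.expectedTime_le (h _ w hN).bounded P).trans (ENNReal.ofReal_le_ofReal ?_)
    -- The time bound is independent of `ε`; dividing by `ε < 1` only weakens it.
    refine (hT w hw).trans (le_div_self ?_ hε (by linarith))
    positivity
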